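/- Notation. For a real square matrix $A$ let $A^\dagger$ be its Moore–Penrose pseudoinverse, $\kappa(A)=\|A\|_2\|A^\dagger\|_2$ and $U_A=\frac12(A+A^\top)$; for symmetric positive semidefinite $U$ let $\|x\|_U=\sqrt{x^\top Ux}$. An Eulerian Laplacian is a real square matrix with non-positive off-diagonal entries all of whose row sums and column sums are $0$; it is connected if its kernel is spanned by $\vec 1$. Computation is on a real random access machine with unit-cost exact arithmetic and comparisons, with a step count, that can call a solver: it hands over (as a list of entries) a matrix $\mathcal{M}$, a vector $c$ and an error parameter $\varepsilon$, and gets back a vector $y$. For $n,m,C$, call $(\mathcal{M},\varepsilon)$ tame if $\mathcal{M}$ is a connected Eulerian Laplacian on at most $Cn$ vertices, with at most $Cm$ nonzero entries (and handed over by a list of at most $Cm$ entries), $n^{-C}\le\varepsilon\le1$ and $\kappa(\mathcal{M}+\mathcal{M}^\top)\le n^{C}$. An approximate Eulerian solver is one whose answers $y$ satisfy $\|y-\mathcal{M}^\dagger c\|_{U_{\mathcal{M}}}\le\varepsilon\|\mathcal{M}^\dagger c\|_{U_{\mathcal{M}}}$ whenever $(\mathcal{M},\varepsilon)$ is tame and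 $c\perp\vec 1$; nothing is required of its other answers, and its answers may depend on its earlier calls. Theorem. There are a constant $C$ and a program CrudeSolveIllConditioned such that the following holds for every nonzero $n\times n$ Eulerian Laplacian $\mathcal{L}$ with $m$ nonzero entries, given by the list of its nonzero entries in any order. (1) For every $b\in\mathbb{R}^n$, every real $\kappa\ge\kappa(\mathcal{L}+\mathcal{L}^\top)$ (not known to the program) and every approximate Eulerian solver, the program halts on input $(\mathcal{L},b)$ with an output $x$ such that $$\|x-\mathcal{L}^\dagger b\|_{U_{\mathcal{L}}}\le\tfrac12\,\|\mathcal{L}^\dagger b\|_{U_{\mathcal{L}}}.$$ It makes at most $C\log(n\kappa)$ calls to the solver, each for a tame $(\mathcal{M},\varepsilon)$ and a right-hand side orthogonal to $\vec 1$, and takes at most $C\,m\log(n\kappa)$ steps, where each call counts as one step. In other words, it performs $O(\log(n\kappa))$ calls on $O(n)$ vertices with $O(m)$ nonzero entries, error parameter $1/n^{O(1)}$ and condition number $n^{O(1)}$, plus $O(m\log(n\kappa))$ additional work. (2) If the solver is an implicit matrix, i.e. its $t$-th call on a tame $(\mathcal{M},\varepsilon)$ returns $Zc$ for a matrix $Z$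 that depends on $t$, $\mathcal{M}$ and $\varepsilon$ (and on how $\mathcal{M}$ is handed over) but not on $c$, then the overall procedure is an implicit polynomial in the solver: the list $(\mathcal{M}_0,\varepsilon_0),\dots,(\mathcal{M}_{T-1},\varepsilon_{T-1})$ of systems on which the solver is called and a non-commutative polynomial expression $P$ with matrix coefficients are determined by $\mathcal{L}$ and the listing of its entries alone (not by $b$ or the solver), and the output is $x=P(Z_0,\dots,Z_{T-1})\,b$, where $Z_t$ is the matrix by which the solver answers the $t$-th call. -/

import Mathlib

noncomputable section

namespace IllCond

open Matrix

/-! ### Linear algebra -/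

/-- The four Penrose equations: `X` is the Moore–Penrose pseudoinverse of the real matrix `A`. -/
structure IsMoorePenrose {ι : Type*} [Fintype ι] (A X : Matrix ι ι ℝ) : Prop where
  mul_mul_self : A * X * A = A
  mul_mul_inv : X * A * X = X
  symm_left : (A * X)ᵀ = A * X
  symm_right : (X * A)ᵀ = X * A

theorem IsMoorePenrose.unique {ι : Type*} [Fintype ι] {A X Y : Matrix ι ι ℝ}
    (hX : IsMoorePenrose A X) (hY : IsMoorePenrose A Y) : X = Y := by
  have h1 : A * X = A * Y := by
    calc A * X = (A * Y * A) * X := by rw [hY.mul_mul_self]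
      _ = (A * Y) * (A * X) := by simp only [Matrix.mul_assoc]
      _ = (A * Y)ᵀ * (A * X)ᵀ := by rw [hX.symm_left, hY.symm_left]
      _ = ((A * X * A) * Y)ᵀ := by
        rw [← Matrix.transpose_mul]; simp only [Matrix.mul_assoc]
      _ = A * Y := by rw [hX.mul_mul_self, hY.symm_left]
  have h2 : X * A = Y * A := by
    calc X * A = X * (A * Y * A) := by rw [hY.mul_mul_self]
      _ = (X * A) * (Y * A) := by simp only [Matrix.mul_assoc]
      _ = (X * A)ᵀ * (Y * A)ᵀ := by rw [hX.symm_right, hY.symm_right]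
      _ = (Y * (A * X * A))ᵀ := by
        rw [← Matrix.transpose_mul]; simp only [Matrix.mul_assoc]
      _ = Y * A := by rw [hX.mul_mul_self, hY.symm_right]
  calc X = X * A * X := hX.mul_mul_inv.symm
    _ = Y * (A * X) := by rw [h2, Matrix.mul_assoc]
    _ = Y * A * Y := by rw [h1, Matrix.mul_assoc]
    _ = Y := hY.mul_mul_inv

theorem exists_symm_pinv {ι : Type*} [Fintype ι] (H : Matrix ι ι ℝ) (hH : H.IsHermitian) :
    ∃ G : Matrix ι ι ℝ, H * G * H = H ∧ G * H * G = G ∧ Gᵀ = G ∧ (G * H)ᵀ = G * H := by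
  classical
  obtain ⟨V, d, hVV, hsp⟩ : ∃ (V : Matrix ι ι ℝ) (d : ι → ℝ), Vᵀ * V = 1 ∧
      H = V * Matrix.diagonal d * Vᵀ := by
    refine ⟨(hH.eigenvectorUnitary : Matrix ι ι ℝ), hH.eigenvalues, ?_, ?_⟩
    · have := (Matrix.mem_unitaryGroup_iff').1 hH.eigenvectorUnitary.2
      rwa [Matrix.star_eq_conjTranspose, Matrix.conjTranspose_eq_transpose_of_trivial] at this
    · have h := hH.spectral_theorem
      simpa [Unitary.conjStarAlgAut_apply, Matrix.star_eq_conjTranspose,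
        Matrix.conjTranspose_eq_transpose_of_trivial, Function.comp_def] using h
  have key : ∀ f g : ι → ℝ, (V * Matrix.diagonal f * Vᵀ) * (V * Matrix.diagonal g * Vᵀ)
      = V * Matrix.diagonal (fun i => f i * g i) * Vᵀ := by
    intro f g
    calc (V * Matrix.diagonal f * Vᵀ) * (V * Matrix.diagonal g * Vᵀ)
        = V * Matrix.diagonal f * (Vᵀ * V) * Matrix.diagonal g * Vᵀ := by
          simp only [Matrix.mul_assoc]
      _ = _ := by rw [hVV, Matrix.mul_one, Matrix.mul_assoc V, Matrix.diagonal_mul_diagonal]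
  have ht : ∀ f : ι → ℝ, (V * Matrix.diagonal f * Vᵀ)ᵀ = V * Matrix.diagonal f * Vᵀ := by
    intro f
    simp [Matrix.transpose_mul, Matrix.mul_assoc]
  refine ⟨V * Matrix.diagonal (fun i => (d i)⁻¹) * Vᵀ, ?_, ?_, ht _, ?_⟩
  · rw [hsp, key, key]
    congr 3
    funext i
    by_cases h : d i = 0 <;> simp [h]
  · rw [hsp, key, key]
    congr 3
    funext i
    by_cases h : d i = 0 <;> simp [h]
  · rw [hsp, key, ht]

theorem exists_isMoorePenrose {ι : Type*} [Fintype ι] (A : Matrix ι ι ℝ) :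
    ∃ X, IsMoorePenrose A X := by
  classical
  have hH : (Aᵀ * A).IsHermitian := by
    have := Matrix.isHermitian_conjTranspose_mul_self A
    rwa [Matrix.conjTranspose_eq_transpose_of_trivial] at this
  obtain ⟨G, hG1, hG2, hG3, hG4⟩ := exists_symm_pinv (Aᵀ * A) hH
  refine ⟨G * Aᵀ, ?_, ?_, ?_, ?_⟩
  · have hB : Aᵀ * (A * G * (Aᵀ * A) - A) = 0 := by
      rw [Matrix.mul_sub, sub_eq_zero]
      simpa only [Matrix.mul_assoc] using hG1
    have hBB : (A * G * (Aᵀ * A) - A)ᵀ * (A * G * (Aᵀ * A) - A) = 0 := by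
      have : (A * G * (Aᵀ * A) - A)ᵀ = ((G * (Aᵀ * A))ᵀ - 1) * Aᵀ := by
        rw [Matrix.transpose_sub, Matrix.mul_assoc A, Matrix.transpose_mul, Matrix.sub_mul,
          Matrix.one_mul]
      rw [this, Matrix.mul_assoc, hB, Matrix.mul_zero]
    have h0 : A * G * (Aᵀ * A) - A = 0 := by
      rw [← Matrix.conjTranspose_eq_transpose_of_trivial] at hBB
      exact Matrix.conjTranspose_mul_self_eq_zero.1 hBB
    rw [sub_eq_zero] at h0
    rw [← Matrix.mul_assoc A G, Matrix.mul_assoc (A * G), h0]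
  · calc G * Aᵀ * A * (G * Aᵀ) = (G * (Aᵀ * A) * G) * Aᵀ := by simp only [Matrix.mul_assoc]
      _ = G * Aᵀ := by rw [hG2]
  · rw [Matrix.transpose_mul, Matrix.transpose_mul, hG3, Matrix.transpose_transpose,
      Matrix.mul_assoc]
  · rw [Matrix.mul_assoc, hG4]

/-- The Moore–Penrose pseudoinverse `A†` of a real square matrix. -/
def pinv {ι : Type*} [Fintype ι] (A : Matrix ι ι ℝ) : Matrix ι ι ℝ :=
  (exists_isMoorePenrose A).choose

theorem pinv_spec {ι : Type*} [Fintype ι] (A : Matrix ι ι ℝ) : IsMoorePenrose A (pinv A) :=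
  (exists_isMoorePenrose A).choose_spec

/-- The spectral norm `‖A‖₂`, the operator norm for the Euclidean norm. -/
def specNorm {ι : Type*} [Fintype ι] [DecidableEq ι] (A : Matrix ι ι ℝ) : ℝ :=
  ‖Matrix.toEuclideanCLM (n := ι) (𝕜 := ℝ) A‖

/-- The condition number `κ(A) = ‖A‖₂ ‖A†‖₂`. -/
def condNumber {ι : Type*} [Fintype ι] [DecidableEq ι] (A : Matrix ι ι ℝ) : ℝ :=
  specNorm A * specNorm (pinv A)

/-- The symmetrization `U_A = (A + Aᵀ) / 2`. -/
def symPart {ι : Type*} (A : Matrix ι ι ℝ) : Matrix ι ι ℝ := (1 / 2 : ℝ) • (A + Aᵀ)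

/-- The seminorm `‖x‖_U = √(xᵀ U x)` of a positive semidefinite matrix `U`. -/
def energyNorm {ι : Type*} [Fintype ι] (U : Matrix ι ι ℝ) (x : ι → ℝ) : ℝ :=
  Real.sqrt (x ⬝ᵥ U *ᵥ x)

/-- Eulerian Laplacians: non-positive off-diagonal entries, all column sums and row sums zero. -/
structure IsEulerianLaplacian {ι : Type*} [Fintype ι] (L : Matrix ι ι ℝ) : Prop where
  offDiag : ∀ i j, i ≠ j → L i j ≤ 0
  colSum : (1 : ι → ℝ) ᵥ* L = 0
  rowSum : L *ᵥ (1 : ι → ℝ) = 0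

/-- The graph of an Eulerian Laplacian `L` is connected: the kernel of `L` is spanned by the
all-ones vector. -/
def IsConnectedLaplacian {ι : Type*} [Fintype ι] (L : Matrix ι ι ℝ) : Prop :=
  ∀ y : ι → ℝ, L *ᵥ y = 0 → ∃ c : ℝ, ∀ i, y i = c

/-! ### Approximate Eulerian solvers -/

/-- What a call to a solver specifies, apart from the right-hand side: the number of vertices,
the matrix, the number of entries in the list by which the matrix is handed over, and the error
parameter. -/
structure SystemSpec where
  size : ℕ
  mat : Matrix (Fin size) (Fin size) ℝ
  entries : ℕ
  accuracy : ℝ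

/-- A solver answers the `t`-th call, `t = 0, 1, …`. Since the answer may depend on `t`, solvers
with a memory and runs of randomized solvers are included. -/
abbrev Solver := ℕ → (S : SystemSpec) → (Fin S.size → ℝ) → (Fin S.size → ℝ)

/-- With `n`, `m` the numbers of vertices and of nonzeros of the original system: `S` is a
connected Eulerian Laplacian on at most `C n` vertices, with at most `C m` nonzeros and given by
at most `C m` entries, with error parameter between `n ^ (-C)` and `1`, whose symmetrization has
condition number at most `n ^ C`. -/
structure IsTame (n m C : ℕ) (S : SystemSpec) : Prop where
  eulerian : IsEulerianLaplacian S.mat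
  connected : IsConnectedLaplacian S.mat
  size_le : S.size ≤ C * n
  nnz_le : Nat.card {p : Fin S.size × Fin S.size // S.mat p.1 p.2 ≠ 0} ≤ S.entries
  entries_le : S.entries ≤ C * m
  accuracy_ge : ((n : ℝ) ^ C)⁻¹ ≤ S.accuracy
  accuracy_le : S.accuracy ≤ 1
  cond_le : condNumber (S.mat + S.matᵀ) ≤ (n : ℝ) ^ C

/-- `O` is an approximate solver for the tame systems: nothing is required of its answers on
other systems, or on right-hand sides that are not orthogonal to the all-ones vector. -/
def IsApproxSolver (n m C : ℕ) (O : Solver) : Prop :=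
  ∀ (t : ℕ) (S : SystemSpec), IsTame n m C S → ∀ b : Fin S.size → ℝ, ∑ i, b i = 0 →
    energyNorm (symPart S.mat) (O t S b - pinv S.mat *ᵥ b)
      ≤ S.accuracy * energyNorm (symPart S.mat) (pinv S.mat *ᵥ b)

/-- The solver `O` applies a linear operator to the right-hand side: on a tame system `S` the
`t`-th call multiplies the right-hand side by the matrix `Z t S`. -/
def IsImplicitMatrix (n m C : ℕ) (O : Solver)
    (Z : ℕ → (S : SystemSpec) → Matrix (Fin S.size) (Fin S.size) ℝ) : Prop :=
  ∀ (t : ℕ) (S : SystemSpec), IsTame n m C S → ∀ b : Fin S.size → ℝ, ∑ i, b i = 0 →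
    O t S b = Z t S *ᵥ b

/-! ### The machine model

A real random access machine with exact unit-cost arithmetic. Its memory consists of arrays of
natural numbers and arrays of reals, of unbounded length, all cells initially zero; a program is
a finite piece of syntax that mentions finitely many arrays, the same for all inputs. -/

/-- One element of the record of solver calls: the system and the right-hand side. -/
abbrev Call := (S : SystemSpec) × (Fin S.size → ℝ)

/-- `nat a i` and `real a i` are the contents of cell `i` of array `a`; `time` counts the steps
done so far, and `calls` lists the solver calls made so far, in order. -/
structure State where
  nat : ℕ → ℕ → ℕ
  real : ℕ → ℕ → ℝ
  time : ℕ
  calls : List Call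

/-- Index arithmetic: literals, cells, sums, truncated differences. -/
inductive NExp where
  | lit (k : ℕ)
  | get (a : ℕ) (i : NExp)
  | add (e f : NExp)
  | sub (e f : NExp)

def NExp.eval (s : State) : NExp → ℕ
  | .lit k => k
  | .get a i => s.nat a (i.eval s)
  | .add e f => e.eval s + f.eval s
  | .sub e f => e.eval s - f.eval s

/-- Real arithmetic; the only real literals are natural numbers. -/
inductive RExp where
  | ofNat (e : NExp)
  | get (a : ℕ) (i : NExp)
  | add (e f : RExp)
  | sub (e f : RExp)
  | mul (e f : RExp)
  | div (e f : RExp)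

def RExp.eval (s : State) : RExp → ℝ
  | .ofNat e => (e.eval s : ℝ)
  | .get a i => s.real a (i.eval s)
  | .add e f => e.eval s + f.eval s
  | .sub e f => e.eval s - f.eval s
  | .mul e f => e.eval s * f.eval s
  | .div e f => e.eval s / f.eval s

inductive Test where
  | natLt (e f : NExp)
  | natEq (e f : NExp)
  | realLt (e f : RExp)
  | realEq (e f : RExp)
  | not (t : Test)
  | and (t u : Test)

def Test.Holds (s : State) : Test → Prop
  | .natLt e f => e.eval s < f.eval s
  | .natEq e f => e.eval s = f.eval s
  | .realLt e f => e.eval s < f.eval s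
  | .realEq e f => e.eval s = f.eval s
  | .not t => ¬ t.Holds s
  | .and t u => t.Holds s ∧ u.Holds s

/-- Programs. `setNat a i e` and `setReal a i e` assign the value of `e` to cell `i` of array `a`;
`solve` calls the solver. -/
inductive Program where
  | skip
  | setNat (a : ℕ) (i : NExp) (e : NExp)
  | setReal (a : ℕ) (i : NExp) (e : RExp)
  | seq (c d : Program)
  | ite (t : Test) (c d : Program)
  | loop (t : Test) (c : Program)
  | solve

/-- One more step has been done. -/
def State.tick (s : State) : State := { s with time := s.time + 1 }

def State.writeNat (s : State) (a i v : ℕ) : State :=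
  { s with nat := Function.update s.nat a (Function.update (s.nat a) i v) }

def State.writeReal (s : State) (a i : ℕ) (v : ℝ) : State :=
  { s with real := Function.update s.real a (Function.update (s.real a) i v) }

/-- The system that `solve` hands over: the numbers of vertices and of listed entries are
cells `0` and `1` of the array `3` of naturals; the `e`-th listed entry has its row, its column
and its value in cell `e` of the arrays `4` and `5` of naturals and `3` of reals, and
entries listed for the same position are added up; the error parameter is cell `0` of
the array `5` of reals. -/
def State.system (s : State) : SystemSpec where
  size := s.nat 3 0
  mat := fun i j => ∑ e ∈ Finset.range (s.nat 3 1),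
    if s.nat 4 e = i ∧ s.nat 5 e = j then s.real 3 e else 0
  entries := s.nat 3 1
  accuracy := s.real 5 0

/-- The right-hand side that `solve` hands over is in the array `4` of reals. -/
def State.rhs (s : State) : Fin s.system.size → ℝ := fun i => s.real 4 i

/-- The effect of `solve`: the call is recorded, and the answer to it is in the array `6` of
reals. -/
def State.afterSolve (O : Solver) (s : State) : State :=
  { s with
    real := Function.update s.real 6 (fun i =>
      if h : i < s.system.size then O s.calls.length s.system s.rhs ⟨i, h⟩ else s.real 6 i)
    calls := s.calls ++ [⟨s.system, s.rhs⟩] }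

/-- `Exec O c s s'`: started in state `s`, with `O` as the solver, the program `c` terminates in
state `s'`. Every assignment, every test and every call counts as one step. -/
inductive Exec (O : Solver) : Program → State → State → Prop
  | skip (s : State) : Exec O .skip s s
  | setNat (a : ℕ) (i e : NExp) (s : State) :
      Exec O (.setNat a i e) s (s.writeNat a (i.eval s) (e.eval s)).tick
  | setReal (a : ℕ) (i : NExp) (e : RExp) (s : State) :
      Exec O (.setReal a i e) s (s.writeReal a (i.eval s) (e.eval s)).tick
  | seq {c d : Program} {s s₁ s₂ : State} :
      Exec O c s s₁ → Exec O d s₁ s₂ → Exec O (.seq c d) s s₂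
  | iteTrue {t : Test} {c d : Program} {s s' : State} :
      t.Holds s → Exec O c s.tick s' → Exec O (.ite t c d) s s'
  | iteFalse {t : Test} {c d : Program} {s s' : State} :
      ¬ t.Holds s → Exec O d s.tick s' → Exec O (.ite t c d) s s'
  | loopDone {t : Test} {c : Program} {s : State} :
      ¬ t.Holds s → Exec O (.loop t c) s s.tick
  | loopStep {t : Test} {c : Program} {s s₁ s₂ : State} :
      t.Holds s → Exec O c s.tick s₁ → Exec O (.loop t c) s₁ s₂ → Exec O (.loop t c) s s₂
  | solve (s : State) : Exec O .solve s (s.afterSolve O).tick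

/-- A program has at most one outcome. -/
theorem Exec.deterministic {O : Solver} {c : Program} {s s₁ s₂ : State}
    (h₁ : Exec O c s s₁) (h₂ : Exec O c s s₂) : s₁ = s₂ := by
  induction h₁ generalizing s₂ with
  | skip | setNat | setReal | solve => cases h₂; rfl
  | seq _ _ ih ih' => cases h₂ with | seq k k' => cases ih k; exact ih' k'
  | iteTrue ht _ ih => cases h₂ with | iteTrue _ k => exact ih k | iteFalse hf _ => exact (hf ht).elim
  | iteFalse hf _ ih => cases h₂ with | iteTrue ht _ => exact (hf ht).elim | iteFalse _ k => exact ih k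
  | loopDone hf => cases h₂ with | loopDone _ => rfl | loopStep ht _ _ => exact (hf ht).elim
  | loopStep ht _ _ ih ih' =>
    cases h₂ with
    | loopDone hf => exact (hf ht).elim
    | loopStep _ k k' => cases ih k; exact ih' k'

/-- The input `L x = b`. The numbers of vertices and of nonzeros are cells `0` and `1` of the
array `0` of naturals. The nonzero entries of `L` are listed in an arbitrary order `e`, with
rows, columns and values in the arrays `1` and `2` of naturals and `0` of reals. The vector `b`
is in the array `1` of reals. All other cells are zero. -/
def inputState {n m : ℕ} (L : Matrix (Fin n) (Fin n) ℝ)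
    (e : Fin m ≃ {p : Fin n × Fin n // L p.1 p.2 ≠ 0}) (b : Fin n → ℝ) : State where
  nat := fun a i =>
    if a = 0 then (if i = 0 then n else if i = 1 then m else 0)
    else if h : i < m then
      (if a = 1 then ((e ⟨i, h⟩).1.1 : ℕ) else if a = 2 then ((e ⟨i, h⟩).1.2 : ℕ) else 0)
    else 0
  real := fun a i =>
    if a = 0 then (if h : i < m then L (e ⟨i, h⟩).1.1 (e ⟨i, h⟩).1.2 else 0)
    else if a = 1 then (if h : i < n then b ⟨i, h⟩ else 0)
    else 0
  time := 0
  calls := []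

/-- The output vector, in the array `2` of reals. -/
def State.output (s : State) (n : ℕ) : Fin n → ℝ := fun i => s.real 2 i

/-! ### Implicit polynomials -/

/-- (Non-commutative) polynomial expressions, of format `p × q`, in the matrices by which the
solver answers a list `Ss` of calls, with arbitrary matrices as coefficients. -/
inductive SolverPoly (Ss : List SystemSpec) : ℕ → ℕ → Type
  | coeff {p q : ℕ} (A : Matrix (Fin p) (Fin q) ℝ) : SolverPoly Ss p q
  | solver (t : Fin Ss.length) : SolverPoly Ss (Ss.get t).size (Ss.get t).size
  | add {p q : ℕ} (P Q : SolverPoly Ss p q) : SolverPoly Ss p q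
  | mul {p q r : ℕ} (P : SolverPoly Ss p q) (Q : SolverPoly Ss q r) : SolverPoly Ss p r

/-- The value of the polynomial when the `t`-th call multiplies by `Z t S`. -/
def SolverPoly.eval {Ss : List SystemSpec}
    (Z : ℕ → (S : SystemSpec) → Matrix (Fin S.size) (Fin S.size) ℝ) :
    {p q : ℕ} → SolverPoly Ss p q → Matrix (Fin p) (Fin q) ℝ
  | _, _, .coeff A => A
  | _, _, .solver t => Z t (Ss.get t)
  | _, _, .add P Q => P.eval Z + Q.eval Z
  | _, _, .mul P Q => P.eval Z * Q.eval Z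

end IllCond

end

/-!
A potential `x` with `L x = b` is assembled from approximate solutions of systems that each see only
one range of edge weights. Isolated vertices are dropped, and `b` is made to sum to zero on every
connected component, as the pseudoinverse does; let `ν ≤ n` vertices remain, let `W` be the trace
and `N = P ^ 2 = n ^ 40`. At a threshold `τ`, the clusters are the components of the graph of the
edges heavier than `τ` (`heavy`, `rep`). The demand of a scale `τ` is the difference between the
total demands of the clusters at `τ` and at `τ / N`, placed at their representatives (`demand`).
Over the thresholds `τ = W / N ^ k` these differences telescope from `b`, since no edge is heavier
than `W`, to zero, once the clusters are the connected components.

**The system of a scale.** Clusters at `τ N` are contracted. The edges between different clusters at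
`τ / N ^ 3` are cut, and their halves are joined to a ground vertex, with which one vertex of each
such cluster is identified; contracted vertices stay, attached with weight `τ / N ^ 3` (`phi`,
`contraction`, `scaleMat`). This matrix is a connected Eulerian Laplacian in which all vertices are
joined to the ground by edges of weight at least `τ / N ^ 3`, and no weight exceeds `τ N` by more
than a polynomial factor. Its condition number is therefore polynomial in `n`, whatever `L` is
(`scaleMat_poincare`, `scaleMat_condNumber_le`). With error parameter `1 / N`, it is tame
(`Setup.Reads.tame`).

**The error.** The demand of a scale sums to zero on each cluster at `τ / N`, so the potentials of
the system of the scale stay in a short range: clamping them to a gap between the ranges of the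
clusters would otherwise exhibit a current without a source (`IsEulerianLaplacian.form_clamp_le`,
`scaleMat_potential_le`). Hence contracting the heavy edges and cutting the light ones costs little
(`sub_rep_le`, `scaleMat_residual_le`, `level_error`). Symmetry of `L` is never used: the energy
`zᵀ L z` is a sum over the edges all the same, and the mixed terms `zᵀ L y` are bounded edge by
edge. If no clusters merge between `τ` and `τ / N`, the demand of the scale is zero and so is its
error; the other errors are charged to the merging clusters (`scale_error`), and the total is at
most `200 ν ^ 10 / P` times the norm of the solution (`total_error`).

**The number of scales.** If an entry joins different clusters at `τ`, then only edges of weight at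
most `τ` leave some cluster, and testing the pseudoinverse of `L + Lᵀ` on the entry gives
`W ≤ 2 n ^ 3 τ κ` (`IsEulerianLaplacian.trace_le`). So no entry joins different clusters after
`O(log (n κ))` scales (`Setup.Reads.exists_scales`); the program checks this itself and does not
need to know `κ`.

**The program.** Clusters are found in linear time by a breadth-first search on linked lists of
half-edges (`cluster`, `WP.cluster`), and each scale takes `O(m)` steps (`WP.stepP`). Runs are
analysed by a calculus for total correctness with time bounds (`WP`), in which the list of the
arrays that a program may write serves as a frame condition (`Frame`). The systems do not depend on
the answers, and every right-hand side is linear in `b`, so with an implicit matrix as solver the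
output is `∑ k, lift k * Z k * rhs k` applied to `b` (`mainP_polynomial`).
-/

noncomputable section

namespace IllCond

open Matrix

/-! ### Bilinear forms of Eulerian Laplacians -/

/-- The bilinear form `zᵀ L y` of a matrix. -/
def form {V : Type*} [Fintype V] (L : Matrix V V ℝ) (z y : V → ℝ) : ℝ := z ⬝ᵥ L *ᵥ y

/-- The energy seminorm `√(zᵀ L z)` of a (not necessarily symmetric) matrix. -/
def nrm {V : Type*} [Fintype V] (L : Matrix V V ℝ) (z : V → ℝ) : ℝ := Real.sqrt (form L z z)

section Forms

variable {V : Type*} [Fintype V] {L : Matrix V V ℝ}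

theorem form_eq_sum (L : Matrix V V ℝ) (z y : V → ℝ) :
    form L z y = ∑ u, ∑ v, L u v * (z u * y v) := by
  simp only [form, dotProduct, mulVec, Finset.mul_sum]
  exact Finset.sum_congr rfl fun u _ => Finset.sum_congr rfl fun v _ => by ring

theorem form_add_left (L : Matrix V V ℝ) (z z' y : V → ℝ) :
    form L (z + z') y = form L z y + form L z' y := by simp [form, add_dotProduct]

theorem form_sub_right (L : Matrix V V ℝ) (z y y' : V → ℝ) :
    form L z (y - y') = form L z y - form L z y' := by simp [form, mulVec_sub, dotProduct_sub]

theorem form_sum_mat {ι : Type*} (s : Finset ι) (A : ι → Matrix V V ℝ) (z y : V → ℝ) :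
    form (∑ i ∈ s, A i) z y = ∑ i ∈ s, form (A i) z y := by
  simp [form, sum_mulVec, dotProduct_sum]

theorem form_vecMulVec (a b z y : V → ℝ) : form (vecMulVec a b) z y = (z ⬝ᵥ a) * (b ⬝ᵥ y) := by
  rw [form, vecMulVec_mulVec]
  simp [mul_comm]

theorem form_add_mat (A B : Matrix V V ℝ) (z y : V → ℝ) :
    form (A + B) z y = form A z y + form B z y := by simp [form, add_mulVec, dotProduct_add]

theorem form_sub_mat (A B : Matrix V V ℝ) (z y : V → ℝ) :
    form (A - B) z y = form A z y - form B z y := by simp [form, sub_mulVec, dotProduct_sub]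

theorem form_smul_mat (a : ℝ) (A : Matrix V V ℝ) (z y : V → ℝ) :
    form (a • A) z y = a * form A z y := by simp [form, smul_mulVec, dotProduct_smul]

theorem form_symPart (L : Matrix V V ℝ) (z : V → ℝ) : z ⬝ᵥ symPart L *ᵥ z = form L z z := by
  have h : z ⬝ᵥ Lᵀ *ᵥ z = z ⬝ᵥ L *ᵥ z := by
    rw [mulVec_transpose, dotProduct_comm, ← dotProduct_mulVec]
  simp only [symPart, smul_mulVec, add_mulVec, dotProduct_smul, dotProduct_add, h, form,
      smul_eq_mul]
  ring

theorem energyNorm_symPart (L : Matrix V V ℝ) (z : V → ℝ) :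
    energyNorm (symPart L) z = nrm L z := by
  rw [energyNorm, form_symPart, nrm]

theorem IsEulerianLaplacian.row (hL : IsEulerianLaplacian L) (u : V) : ∑ v, L u v = 0 := by
  simpa [mulVec, dotProduct] using congrFun hL.rowSum u

theorem IsEulerianLaplacian.col (hL : IsEulerianLaplacian L) (v : V) : ∑ u, L u v = 0 := by
  simpa [vecMul, dotProduct] using congrFun hL.colSum v

theorem IsEulerianLaplacian.sum_left (hL : IsEulerianLaplacian L) (f : V → ℝ) :
    ∑ u, ∑ v, L u v * f u = 0 :=
  Finset.sum_eq_zero fun u _ => by rw [← Finset.sum_mul, hL.row, zero_mul]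

theorem IsEulerianLaplacian.sum_right (hL : IsEulerianLaplacian L) (f : V → ℝ) :
    ∑ u, ∑ v, L u v * f v = 0 := by
  rw [Finset.sum_comm]
  exact Finset.sum_eq_zero fun u _ => by rw [← Finset.sum_mul, hL.col, zero_mul]

/-- Since the columns sum to zero, the form only sees differences of its left argument. -/
theorem IsEulerianLaplacian.form_col (hL : IsEulerianLaplacian L) (z y : V → ℝ) :
    form L z y = ∑ u, ∑ v, -L u v * ((z v - z u) * y v) := by
  rw [form_eq_sum, ← sub_eq_zero, ← Finset.sum_sub_distrib, ← hL.sum_right fun v => z v * y v]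
  refine Finset.sum_congr rfl fun u _ => ?_
  rw [← Finset.sum_sub_distrib]
  exact Finset.sum_congr rfl fun v _ => by ring

/-- The energy is a sum over the edges: the values at the two ends only enter through the square of
their difference, because the row sums and the column sums vanish. -/
theorem IsEulerianLaplacian.form_self (hL : IsEulerianLaplacian L) (z : V → ℝ) :
    form L z z = 1 / 2 * ∑ u, ∑ v, -L u v * (z u - z v) ^ 2 := by
  have h : ∑ u, ∑ v, -L u v * (z u - z v) ^ 2 = ∑ u, ∑ v, (2 * (L u v * (z u * z v))
      - L u v * z u ^ 2 - L u v * z v ^ 2) :=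
    Finset.sum_congr rfl fun u _ => Finset.sum_congr rfl fun v _ => by ring
  rw [h]
  simp only [Finset.sum_sub_distrib, hL.sum_left fun u => z u ^ 2, hL.sum_right fun u => z u ^ 2,
    ← Finset.mul_sum, form_eq_sum]
  ring

theorem IsEulerianLaplacian.term_nonneg (hL : IsEulerianLaplacian L) (u v : V) (z : V → ℝ) :
    0 ≤ -L u v * (z u - z v) ^ 2 := by
  by_cases h : u = v
  · simp [h]
  · exact mul_nonneg (neg_nonneg.2 (hL.offDiag u v h)) (sq_nonneg _)

theorem IsEulerianLaplacian.form_nonneg (hL : IsEulerianLaplacian L) (z : V → ℝ) :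
    0 ≤ form L z z := by
  rw [hL.form_self]
  exact mul_nonneg (by norm_num) (Finset.sum_nonneg fun u _ => Finset.sum_nonneg fun v _ =>
    hL.term_nonneg u v z)

theorem nrm_nonneg (L : Matrix V V ℝ) (z : V → ℝ) : 0 ≤ nrm L z := Real.sqrt_nonneg _

theorem IsEulerianLaplacian.nrm_sq (hL : IsEulerianLaplacian L) (z : V → ℝ) :
    nrm L z ^ 2 = form L z z := Real.sq_sqrt (hL.form_nonneg z)

theorem IsEulerianLaplacian.edge_le (hL : IsEulerianLaplacian L) (u v : V) (z : V → ℝ) :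
    -L u v * (z u - z v) ^ 2 ≤ 2 * form L z z := by
  rw [hL.form_self]
  have h1 := Finset.single_le_sum (f := fun v => -L u v * (z u - z v) ^ 2)
    (fun v _ => hL.term_nonneg u v z) (Finset.mem_univ v)
  have h2 := Finset.single_le_sum (f := fun u => ∑ v, -L u v * (z u - z v) ^ 2)
    (fun u _ => Finset.sum_nonneg fun v _ => hL.term_nonneg u v z) (Finset.mem_univ u)
  linarith

/-- An edge of weight more than `t ^ 2` sees a small potential difference. -/
theorem IsEulerianLaplacian.heavy_edge (hL : IsEulerianLaplacian L) {t : ℝ} (ht : 0 < t) {u v : V}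
    (h : t ^ 2 < -L u v) (z : V → ℝ) : |z u - z v| ≤ 2 * nrm L z / t := by
  rw [le_div_iff₀ ht]
  refine abs_le_of_sq_le_sq' ?_ (by have := nrm_nonneg L z; positivity) |>.2
  have h1 := hL.edge_le u v z
  have h2 := hL.nrm_sq z
  have h3 := mul_le_mul_of_nonneg_right h.le (sq_nonneg (z u - z v))
  rw [mul_pow, sq_abs, mul_pow, h2]
  nlinarith [hL.form_nonneg z]

/-- An edge of weight at most `t ^ 2` carries a small current. -/
theorem IsEulerianLaplacian.light_edge (hL : IsEulerianLaplacian L) {t : ℝ} (ht : 0 < t) {u v : V}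
    (huv : u ≠ v) (h : -L u v ≤ t ^ 2) (z : V → ℝ) : -L u v * |z u - z v| ≤ 2 * t * nrm L z := by
  refine abs_le_of_sq_le_sq' ?_ (by have := nrm_nonneg L z; positivity) |>.2
  have h1 := hL.edge_le u v z
  have h2 := hL.nrm_sq z
  have h0 : 0 ≤ -L u v := neg_nonneg.2 (hL.offDiag u v huv)
  have h3 : (-L u v * |z u - z v|) ^ 2 ≤ t ^ 2 * (2 * form L z z) := by
    calc (-L u v * |z u - z v|) ^ 2 = -L u v * (-L u v * (z u - z v) ^ 2) := by
          rw [mul_pow, sq_abs]; ring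
      _ ≤ t ^ 2 * (2 * form L z z) :=
          mul_le_mul h h1 (hL.term_nonneg u v z) (by positivity)
  refine h3.trans ?_
  rw [mul_pow, mul_pow, h2]
  nlinarith [hL.form_nonneg z, sq_nonneg t, mul_nonneg (sq_nonneg t) (hL.form_nonneg z)]

theorem IsEulerianLaplacian.nrm_add_le (hL : IsEulerianLaplacian L) (x y : V → ℝ) :
    nrm L (x + y) ≤ nrm L x + nrm L y := by
  classical
  -- the seminorm is the Euclidean norm of the vector of scaled potential differences
  let F : (V → ℝ) → EuclideanSpace ℝ (V × V) := fun z =>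
    WithLp.toLp 2 fun p => Real.sqrt (1 / 2 * (if p.1 = p.2 then 0 else -L p.1 p.2)) *
        (z p.1 - z p.2)
  have hF : ∀ z, nrm L z = ‖F z‖ := by
    intro z
    rw [nrm, EuclideanSpace.norm_eq, hL.form_self]
    congr 1
    rw [Fintype.sum_prod_type, Finset.mul_sum]
    refine Finset.sum_congr rfl fun u _ => ?_
    rw [Finset.mul_sum]
    refine Finset.sum_congr rfl fun v _ => ?_
    simp only [F, Real.norm_eq_abs, sq_abs, mul_pow]
    by_cases h : u = v
    · simp [h]
    · have := hL.offDiag u v h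
      rw [if_neg h, Real.sq_sqrt (by linarith)]
      ring
  have hadd : F (x + y) = F x + F y := by
    ext p
    simp only [F, Pi.add_apply, PiLp.add_apply]
    ring
  rw [hF, hF, hF, hadd]
  exact norm_add_le _ _

theorem nrm_zero (L : Matrix V V ℝ) : nrm L 0 = 0 := by simp [nrm, form]

theorem nrm_neg (L : Matrix V V ℝ) (x : V → ℝ) : nrm L (-x) = nrm L x := by
  simp [nrm, form, mulVec_neg]

theorem IsEulerianLaplacian.nrm_sub_le (hL : IsEulerianLaplacian L) (x y : V → ℝ) :
    nrm L (x - y) ≤ nrm L x + nrm L y := by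
  rw [sub_eq_add_neg, ← nrm_neg L y]
  exact hL.nrm_add_le _ _

theorem IsEulerianLaplacian.nrm_sum_le (hL : IsEulerianLaplacian L) {ι : Type*} (s : Finset ι)
    (f : ι → V → ℝ) : nrm L (∑ i ∈ s, f i) ≤ ∑ i ∈ s, nrm L (f i) := by
  classical
  induction s using Finset.induction_on with
  | empty => simp [nrm_zero]
  | insert a s ha ih =>
    rw [Finset.sum_insert ha, Finset.sum_insert ha]
    exact (hL.nrm_add_le _ _).trans (by linarith)

theorem IsEulerianLaplacian.const_of_form_eq_zero (hL : IsEulerianLaplacian L) {w : V → ℝ}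
    (hw : form L w w = 0) {u v : V} (h : L u v ≠ 0) : w u = w v := by
  by_cases huv : u = v
  · rw [huv]
  have h1 := hL.edge_le u v w
  have h2 : 0 < -L u v := lt_of_le_of_ne (neg_nonneg.2 (hL.offDiag u v huv))
      (by simpa [eq_comm] using h)
  rw [hw] at h1
  have h3 : (w u - w v) ^ 2 ≤ 0 := by
    by_contra h4
    push Not at h4
    nlinarith [mul_pos h2 h4]
  have := pow_eq_zero_iff (two_ne_zero) |>.1 (le_antisymm h3 (sq_nonneg _))
  linarith

theorem IsEulerianLaplacian.mulVec_eq_zero_of_form (hL : IsEulerianLaplacian L) {w : V → ℝ}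
    (hw : form L w w = 0) : L *ᵥ w = 0 := by
  ext u
  have : ∀ v, L u v * w v = L u v * w u := fun v => by
    by_cases h : L u v = 0
    · simp [h]
    · rw [hL.const_of_form_eq_zero hw h]
  simp only [mulVec, dotProduct, this, ← Finset.sum_mul, hL.row, zero_mul, Pi.zero_apply]

theorem IsEulerianLaplacian.transpose (hL : IsEulerianLaplacian L) : IsEulerianLaplacian Lᵀ where
  offDiag i j h := hL.offDiag j i h.symm
  colSum := by rw [vecMul_transpose]; exact hL.rowSum
  rowSum := by rw [mulVec_transpose]; exact hL.colSum

theorem form_transpose (L : Matrix V V ℝ) (z y : V → ℝ) : form Lᵀ z y = form L y z := by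
  rw [form, form, mulVec_transpose, dotProduct_comm, ← dotProduct_mulVec]

theorem IsEulerianLaplacian.transpose_mulVec_eq_zero_of_form (hL : IsEulerianLaplacian L)
    {w : V → ℝ} (hw : form L w w = 0) : Lᵀ *ᵥ w = 0 :=
  hL.transpose.mulVec_eq_zero_of_form (by rw [form_transpose, hw])

/-- Adding a constant to the right argument does not change the form. -/
theorem IsEulerianLaplacian.form_sub_const (hL : IsEulerianLaplacian L) (z y : V → ℝ) (a : ℝ) :
    form L z (fun v => y v - a) = form L z y := by
  have h : (fun v => y v - a) = y - a • (1 : V → ℝ) := by ext v; simp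
  rw [h, form_sub_right]
  simp [form, mulVec_smul, hL.rowSum]

/-- Clamping a potential to an interval lowers its energy: the clamped potential has energy at
most the power that the currents of the original potential deliver to it. -/
theorem IsEulerianLaplacian.form_clamp_le (hL : IsEulerianLaplacian L) (y : V → ℝ) {a b : ℝ}
    (hab : a ≤ b) :
    form L (fun v => max a (min b (y v))) (fun v => max a (min b (y v)))
      ≤ form L (fun v => max a (min b (y v))) y := by
  set f : V → ℝ := fun v => max a (min b (y v)) with hf
  have h1 : form L f y - form L f f = form L f (y - f) := (form_sub_right L f y f).symm
  have h2 : 0 ≤ form L f (y - f) := by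
    rw [hL.form_col]
    refine Finset.sum_nonneg fun u _ => Finset.sum_nonneg fun v _ => ?_
    by_cases huv : u = v
    · simp [huv]
    refine mul_nonneg (neg_nonneg.2 (hL.offDiag u v huv)) ?_
    have ha : ∀ w, a ≤ f w := fun w => le_max_left _ _
    have hb : ∀ w, f w ≤ b := fun w => max_le hab (min_le_left _ _)
    simp only [Pi.sub_apply]
    rcases le_total (y v) a with h | h
    · have : f v = a := by simp [hf, h, h.trans hab]
      rw [this]
      nlinarith [ha u]
    rcases le_total (y v) b with h' | h'
    · have : f v = y v := by simp [hf, h, h']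
      simp [this]
    · have : f v = b := by simp [hf, h', hab]
      rw [this]
      nlinarith [hb u]
  linarith

/-- If `g` is orthogonal to the left kernel of `A` (or just to the null vectors of its form), then
the pseudoinverse solves `A x = g`. -/
theorem mulVec_pinv_mulVec (A : Matrix V V ℝ) (g : V → ℝ)
    (hg : ∀ w, form A w w = 0 → g ⬝ᵥ w = 0) : A *ᵥ (pinv A *ᵥ g) = g := by
  have hp := pinv_spec A
  set w := g - A *ᵥ (pinv A *ᵥ g) with hw
  have h1 : Aᵀ *ᵥ w = 0 := by
    rw [hw, mulVec_sub, mulVec_mulVec, mulVec_mulVec]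
    have : Aᵀ * (A * pinv A) = Aᵀ := by
      conv_lhs => rw [← hp.symm_left, ← transpose_mul, hp.mul_mul_self]
    rw [← Matrix.mul_assoc] at this
    rw [this, sub_self]
  have h2 : form A w w = 0 := by rw [← form_transpose, form, h1, dotProduct_zero]
  have h3 : (A *ᵥ (pinv A *ᵥ g)) ⬝ᵥ w = 0 := by
    rw [dotProduct_comm, dotProduct_mulVec, ← mulVec_transpose, h1, zero_dotProduct]
  have h4 : w ⬝ᵥ w = 0 := by
    conv_lhs => rw [hw, sub_dotProduct]
    rw [hg w h2, h3, sub_zero]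
  have h5 := dotProduct_self_eq_zero.1 h4
  rw [hw, sub_eq_zero] at h5
  exact h5.symm

end Forms

/-! ### Clusters -/

/-- The graph of the edges of weight more than `τ`, directions forgotten. -/
def heavy {V : Type*} (L : Matrix V V ℝ) (τ : ℝ) : SimpleGraph V where
  Adj u v := u ≠ v ∧ (τ < -L u v ∨ τ < -L v u)
  symm := ⟨fun _ _ h => ⟨h.1.symm, h.2.symm⟩⟩
  loopless := ⟨fun _ h => h.1 rfl⟩

theorem heavy_mono {V : Type*} (L : Matrix V V ℝ) {τ τ' : ℝ} (h : τ' ≤ τ) :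
    heavy L τ ≤ heavy L τ' :=
  fun _ _ h' => ⟨h'.1, h'.2.imp (h.trans_lt ·) (h.trans_lt ·)⟩

/-- A function that varies by at most `D` along each edge varies by at most `D` times the number of
vertices on a connected component. -/
theorem abs_sub_le_of_reachable {V : Type*} [Fintype V] {G : SimpleGraph V} {z : V → ℝ} {D : ℝ}
    (hD : 0 ≤ D) (h : ∀ u v, G.Adj u v → |z u - z v| ≤ D) {u v : V} (huv : G.Reachable u v) :
    |z u - z v| ≤ Fintype.card V * D := by
  classical
  have key : ∀ (u v : V) (p : G.Walk u v), |z u - z v| ≤ p.length * D := by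
    intro u v p
    induction p with
    | nil => simp
    | @cons a b c hab p ih =>
      calc |z a - z c| ≤ |z a - z b| + |z b - z c| := abs_sub_le _ _ _
        _ ≤ D + p.length * D := add_le_add (h _ _ hab) ih
        _ = _ := by rw [SimpleGraph.Walk.length_cons]; push_cast; ring
  obtain ⟨p, hp⟩ := huv.exists_isPath
  refine (key u v p).trans (mul_le_mul_of_nonneg_right ?_ hD)
  exact_mod_cast hp.length_lt.le

section Rep

variable {ν : ℕ} (L : Matrix (Fin ν) (Fin ν) ℝ)

/-- The representative of the cluster of `u` at threshold `τ`: the least vertex that can be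
reached from `u` through edges of weight more than `τ`. -/
def rep (τ : ℝ) (u : Fin ν) : Fin ν :=
  letI := Classical.decPred ((heavy L τ).Reachable u)
  (Finset.univ.filter ((heavy L τ).Reachable u)).min' ⟨u, by simp⟩

theorem reachable_rep (τ : ℝ) (u : Fin ν) : (heavy L τ).Reachable u (rep L τ u) := by
  unfold rep
  let := Classical.decPred ((heavy L τ).Reachable u)
  exact (Finset.mem_filter.1 (Finset.min'_mem _ _)).2

variable {L}

theorem rep_le {τ : ℝ} {u v : Fin ν} (h : (heavy L τ).Reachable u v) : rep L τ u ≤ v := by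
  unfold rep
  let := Classical.decPred ((heavy L τ).Reachable u)
  exact Finset.min'_le _ _ (Finset.mem_filter.2 ⟨Finset.mem_univ _, h⟩)

theorem rep_eq_of_reachable {τ : ℝ} {u v : Fin ν} (h : (heavy L τ).Reachable u v) :
    rep L τ u = rep L τ v :=
  le_antisymm (rep_le (h.trans (reachable_rep L τ v))) (rep_le (h.symm.trans (reachable_rep L τ u)))

theorem rep_unique {τ : ℝ} {u r : Fin ν} (h : (heavy L τ).Reachable u r)
    (h' : ∀ v, (heavy L τ).Reachable u v → r ≤ v) : rep L τ u = r :=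
  le_antisymm (rep_le h) (h' _ (reachable_rep L τ u))

theorem rep_rep {τ : ℝ} (u : Fin ν) : rep L τ (rep L τ u) = rep L τ u :=
  (rep_eq_of_reachable (reachable_rep L τ u)).symm

theorem rep_rep_of_le {τ τ' : ℝ} (h : τ' ≤ τ) (u : Fin ν) :
    rep L τ' (rep L τ u) = rep L τ' u :=
  (rep_eq_of_reachable ((reachable_rep L τ u).mono (heavy_mono L h))).symm

/-- A representative at a low threshold is also one at every higher threshold. -/
theorem rep_rep_of_ge {τ τ' : ℝ} (h : τ' ≤ τ) (u : Fin ν) :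
    rep L τ (rep L τ' u) = rep L τ' u := by
  refine rep_unique (SimpleGraph.Reachable.refl _) fun v hv => rep_le ?_
  exact (reachable_rep L τ' u).trans (hv.mono (heavy_mono L h))

theorem rep_least {τ : ℝ} {o : Fin ν} (ho : ∀ v, o ≤ v) : rep L τ o = o :=
  le_antisymm (rep_le (SimpleGraph.Reachable.refl _)) (ho _)

theorem le_of_rep_ne {τ : ℝ} {u v : Fin ν} (h : rep L τ u ≠ rep L τ v) : -L u v ≤ τ := by
  by_contra h'
  push Not at h'
  have huv : u ≠ v := fun h'' => h (h'' ▸ rfl)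
  exact h (rep_eq_of_reachable (SimpleGraph.Adj.reachable ⟨huv, Or.inl h'⟩))

/-- Inside a cluster the potential varies little, since a path of heavy edges joins any two
vertices. -/
theorem IsEulerianLaplacian.abs_sub_rep_le (hL : IsEulerianLaplacian L) {t : ℝ} (ht : 0 < t)
    (z : Fin ν → ℝ) (u : Fin ν) : |z u - z (rep L (t ^ 2) u)| ≤ ν * (2 * nrm L z / t) := by
  have := abs_sub_le_of_reachable (G := heavy L (t ^ 2)) (z := z) (D := 2 * nrm L z / t)
    (by have := nrm_nonneg L z; positivity) ?_ (reachable_rep L (t ^ 2) u)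
  · simpa using this
  · rintro a b ⟨-, h | h⟩
    · exact hL.heavy_edge ht h z
    · rw [abs_sub_comm]
      exact hL.heavy_edge ht h z

/-- Potentials of energy zero are constant on all clusters. -/
theorem rep_comp_of_form_eq_zero (hL : IsEulerianLaplacian L) {τ : ℝ} (hτ : 0 ≤ τ) {w : Fin ν → ℝ}
    (hw : form L w w = 0) (u : Fin ν) : w (rep L τ u) = w u := by
  have := abs_sub_le_of_reachable (G := heavy L τ) (z := w) (D := 0) le_rfl ?_
    (reachable_rep L τ u)
  · rw [mul_zero] at this
    have := abs_nonpos_iff.1 this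
    linarith
  · rintro a b ⟨-, h | h⟩
    · rw [hL.const_of_form_eq_zero hw (u := a) (v := b) (by intro h0; rw [h0] at h; linarith)]
      simp
    · rw [hL.const_of_form_eq_zero hw (u := b) (v := a) (by intro h0; rw [h0] at h; linarith)]
      simp

end Rep

/-! ### Contraction of heavy edges and grounding of light ones -/

section Contraction

variable {V : Type*} [Fintype V] [DecidableEq V]

/-- The contracted system. The vertices are mapped by `φ`; an edge between different classes of
`q` is cut, and its two halves are joined to the ground `o`. Vertices outside the range of the
idempotent map `φ` are kept, attached to their images by edges of weight `ω`. -/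
def contraction (L : Matrix V V ℝ) (o : V) (φ q : V → V) (ω : ℝ) : Matrix V V ℝ :=
  ∑ u, ∑ v, L u v • (if q u = q v then vecMulVec (Pi.single (φ u) 1) (Pi.single (φ v) 1)
      else vecMulVec (Pi.single (φ u) 1) (Pi.single o 1)
        + vecMulVec (Pi.single o 1) (Pi.single (φ v) 1)
        - vecMulVec (Pi.single o 1) (Pi.single o 1))
    + ω • ∑ i, vecMulVec (Pi.single i 1 - Pi.single (φ i) 1) (Pi.single i 1 - Pi.single (φ i) 1)

variable {L : Matrix V V ℝ} {o : V} {φ q : V → V} {ω : ℝ}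

theorem form_contraction (L : Matrix V V ℝ) (o : V) (φ q : V → V) (ω : ℝ) (z y : V → ℝ) :
    form (contraction L o φ q ω) z y
      = ∑ u, ∑ v, L u v * (if q u = q v then z (φ u) * y (φ v)
          else z (φ u) * y o + z o * y (φ v) - z o * y o)
        + ω * ∑ i, (z i - z (φ i)) * (y i - y (φ i)) := by
  have hs : ∀ (a : V) (x : V → ℝ), Pi.single a (1 : ℝ) ⬝ᵥ x = x a := fun a x => by simp
  have hs' : ∀ (a : V) (x : V → ℝ), x ⬝ᵥ Pi.single a (1 : ℝ) = x a := fun a x => by simp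
  rw [contraction, form_add_mat, form_smul_mat, form_sum_mat, form_sum_mat]
  congr 1
  · refine Finset.sum_congr rfl fun u _ => ?_
    rw [form_sum_mat]
    refine Finset.sum_congr rfl fun v _ => ?_
    rw [form_smul_mat]
    congr 1
    split_ifs
    · simp only [form_vecMulVec, hs, hs']
    · simp only [form_add_mat, form_sub_mat, form_vecMulVec, hs, hs']
  · congr 1
    refine Finset.sum_congr rfl fun i _ => ?_
    simp only [form_vecMulVec, sub_dotProduct, dotProduct_sub, hs, hs']

/-- The energy in the contracted system, as a sum over the edges of `L` and the attaching edges: the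
energy of a cut edge is that of its two halves. -/
theorem IsEulerianLaplacian.form_contraction_self (hL : IsEulerianLaplacian L) (w : V → ℝ) :
    form (contraction L o φ q ω) w w
      = 1 / 2 * ∑ u, ∑ v, -L u v * (if q u = q v then (w (φ u) - w (φ v)) ^ 2
          else (w (φ u) - w o) ^ 2 + (w o - w (φ v)) ^ 2)
        + ω * ∑ i, (w i - w (φ i)) ^ 2 := by
  rw [form_contraction]
  congr 1
  · have h : ∑ u, ∑ v, -L u v * (if q u = q v then (w (φ u) - w (φ v)) ^ 2
          else (w (φ u) - w o) ^ 2 + (w o - w (φ v)) ^ 2)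
        = ∑ u, ∑ v, (2 * (L u v * (if q u = q v then w (φ u) * w (φ v)
          else w (φ u) * w o + w o * w (φ v) - w o * w o))
          - L u v * w (φ u) ^ 2 - L u v * w (φ v) ^ 2) :=
      Finset.sum_congr rfl fun u _ => Finset.sum_congr rfl fun v _ => by split_ifs <;> ring
    rw [h]
    simp only [Finset.sum_sub_distrib, hL.sum_left fun u => w (φ u) ^ 2,
      hL.sum_right fun u => w (φ u) ^ 2, ← Finset.mul_sum]
    ring
  · simp only [sq]

theorem IsEulerianLaplacian.contraction_apply_le (hL : IsEulerianLaplacian L) (hω : 0 ≤ ω)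
    {i j : V} (hij : i ≠ j) : contraction L o φ q ω i j ≤ 0 := by
  have h1 : ∀ a b : V, (0 : ℝ) ≤ vecMulVec (Pi.single a (1 : ℝ)) (Pi.single b (1 : ℝ)) i j := by
    intro a b
    rw [vecMulVec_apply]
    exact mul_nonneg (by rw [Pi.single_apply]; split_ifs <;> norm_num)
      (by rw [Pi.single_apply]; split_ifs <;> norm_num)
  have h2 : ∀ a : V, vecMulVec (Pi.single a (1 : ℝ)) (Pi.single a (1 : ℝ)) i j = 0 := by
    intro a
    rw [vecMulVec_apply, Pi.single_apply, Pi.single_apply]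
    split_ifs with ha hb
    · exact (hij (ha.trans hb.symm)).elim
    all_goals simp
  simp only [contraction, Matrix.add_apply, Matrix.sum_apply, Matrix.smul_apply, smul_eq_mul]
  refine add_nonpos (Finset.sum_nonpos fun u _ => Finset.sum_nonpos fun v _ => ?_)
    (mul_nonpos_of_nonneg_of_nonpos hω (Finset.sum_nonpos fun k _ => ?_))
  · by_cases huv : u = v
    · subst huv
      simp [h2]
    refine mul_nonpos_of_nonpos_of_nonneg (hL.offDiag u v huv) ?_
    split_ifs
    · exact h1 _ _
    · rw [Matrix.sub_apply, Matrix.add_apply, h2, sub_zero]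
      exact add_nonneg (h1 _ _) (h1 _ _)
  · have := h1 k (φ k)
    have := h1 (φ k) k
    have e1 := h2 k
    have e2 := h2 (φ k)
    rw [vecMulVec_apply] at *
    simp only [Pi.sub_apply]
    nlinarith

theorem IsEulerianLaplacian.contraction (hL : IsEulerianLaplacian L) (hω : 0 ≤ ω) :
    IsEulerianLaplacian (contraction L o φ q ω) where
  offDiag _ _ hij := hL.contraction_apply_le hω hij
  colSum := by
    ext j
    have : ((1 : V → ℝ) ᵥ* IllCond.contraction L o φ q ω) j
        = form (IllCond.contraction L o φ q ω) 1 (Pi.single j 1) := by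
      rw [form, dotProduct_mulVec]; simp
    rw [this, form_contraction]
    simp only [Pi.one_apply, one_mul, sub_self, zero_mul, Finset.sum_const_zero, mul_zero, add_zero,
      Pi.zero_apply]
    simpa using hL.sum_right fun v => (Pi.single j (1 : ℝ) : V → ℝ) (φ v)
  rowSum := by
    ext j
    have : (IllCond.contraction L o φ q ω *ᵥ (1 : V → ℝ)) j
        = form (IllCond.contraction L o φ q ω) (Pi.single j 1) 1 := by
      rw [form]; simp
    rw [this, form_contraction]
    simp only [Pi.one_apply, mul_one, sub_self, mul_zero, Finset.sum_const_zero, add_zero,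
      Pi.zero_apply]
    simpa using hL.sum_left fun v => (Pi.single j (1 : ℝ) : V → ℝ) (φ v)

theorem IsEulerianLaplacian.contraction_term_nonneg (hL : IsEulerianLaplacian L) (w : V → ℝ)
    (u v : V) : 0 ≤ -L u v * (if q u = q v then (w (φ u) - w (φ v)) ^ 2
          else (w (φ u) - w o) ^ 2 + (w o - w (φ v)) ^ 2) := by
  by_cases h : u = v
  · simp [h]
  · exact mul_nonneg (neg_nonneg.2 (hL.offDiag u v h)) (by split_ifs <;> positivity)

theorem IsEulerianLaplacian.contraction_edge_le (hL : IsEulerianLaplacian L) (hω : 0 ≤ ω)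
    (w : V → ℝ) {u v : V} (h : q u = q v) :
    -L u v * (w (φ u) - w (φ v)) ^ 2 ≤ 2 * form (IllCond.contraction L o φ q ω) w w := by
  rw [hL.form_contraction_self]
  have h1 := Finset.single_le_sum (fun v _ => hL.contraction_term_nonneg (o := o) (φ := φ) (q := q)
      w u v)
    (Finset.mem_univ v)
  have h2 := Finset.single_le_sum (s := Finset.univ)
    (fun u _ => Finset.sum_nonneg (s := Finset.univ) fun v _ =>
      hL.contraction_term_nonneg (o := o) (φ := φ) (q := q) w u v) (Finset.mem_univ u)
  have h3 : 0 ≤ ω * ∑ i, (w i - w (φ i)) ^ 2 :=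
    mul_nonneg hω (Finset.sum_nonneg fun i _ => sq_nonneg _)
  rw [if_pos h] at h1
  linarith

theorem IsEulerianLaplacian.contraction_attach_le (hL : IsEulerianLaplacian L) (hω : 0 ≤ ω)
    (w : V → ℝ) (i : V) :
    ω * (w i - w (φ i)) ^ 2 ≤ form (IllCond.contraction L o φ q ω) w w := by
  rw [hL.form_contraction_self]
  have h1 := Finset.single_le_sum (f := fun i => (w i - w (φ i)) ^ 2) (fun i _ => sq_nonneg _)
    (Finset.mem_univ i)
  have h2 : 0 ≤ ∑ u, ∑ v, -L u v * (if q u = q v then (w (φ u) - w (φ v)) ^ 2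
          else (w (φ u) - w o) ^ 2 + (w o - w (φ v)) ^ 2) :=
    Finset.sum_nonneg fun u _ => Finset.sum_nonneg fun v _ => hL.contraction_term_nonneg w u v
  have := mul_le_mul_of_nonneg_left h1 hω
  linarith

/-- A potential lifted from the contracted system has at most twice the energy. -/
theorem IsEulerianLaplacian.form_comp_le (hL : IsEulerianLaplacian L) (hω : 0 ≤ ω) (w : V → ℝ) :
    form L (fun v => w (φ v)) (fun v => w (φ v))
      ≤ 2 * form (IllCond.contraction L o φ q ω) w w := by
  rw [hL.form_contraction_self, hL.form_self]
  have h3 : 0 ≤ ω * ∑ i, (w i - w (φ i)) ^ 2 :=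
    mul_nonneg hω (Finset.sum_nonneg fun i _ => sq_nonneg _)
  have h4 : ∑ u, ∑ v, -L u v * (w (φ u) - w (φ v)) ^ 2
      ≤ ∑ u, ∑ v, 2 * (-L u v * (if q u = q v then (w (φ u) - w (φ v)) ^ 2
          else (w (φ u) - w o) ^ 2 + (w o - w (φ v)) ^ 2)) := by
    refine Finset.sum_le_sum fun u _ => Finset.sum_le_sum fun v _ => ?_
    by_cases huv : u = v
    · simp [huv]
    have := neg_nonneg.2 (hL.offDiag u v huv)
    rw [mul_left_comm]
    refine mul_le_mul_of_nonneg_left ?_ this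
    split_ifs
    · nlinarith [sq_nonneg (w (φ u) - w (φ v))]
    · nlinarith [sq_nonneg ((w (φ u) - w o) - (w o - w (φ v)))]
  simp only [← Finset.mul_sum] at h4
  linarith

end Contraction

/-- A family of short intervals cannot cover a long one; some interval remains whose interior meets
none of them. -/
theorem exists_gap {ι : Type*} [Fintype ι] (l r : ι → ℝ) {ρ p q : ℝ} (hlr : ∀ i, l i ≤ r i)
    (hρ : ∀ i, r i - l i ≤ ρ)
    (hρ0 : 0 ≤ ρ) (hpq : Fintype.card ι * ρ < q - p) :
    ∃ a b, p ≤ a ∧ a < b ∧ b ≤ q ∧ ∀ i, r i ≤ a ∨ b ≤ l i := by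
  set U : Set ℝ := Set.Ioo p q \ ⋃ i, Set.Icc (l i) (r i) with hU
  have hopen : IsOpen U := isOpen_Ioo.sdiff (isClosed_iUnion_of_finite fun i => isClosed_Icc)
  have hne : U.Nonempty := by
    by_contra h
    rw [Set.not_nonempty_iff_eq_empty, hU, Set.sdiff_eq_empty] at h
    have h1 := MeasureTheory.measure_mono (μ := MeasureTheory.volume) h
    have h2 : MeasureTheory.volume (⋃ i, Set.Icc (l i) (r i)) ≤ Fintype.card ι * ENNReal.ofReal
        ρ := by
      refine (MeasureTheory.measure_iUnion_fintype_le _ _).trans ?_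
      calc ∑ i, MeasureTheory.volume (Set.Icc (l i) (r i)) ≤ ∑ _i : ι, ENNReal.ofReal ρ :=
            Finset.sum_le_sum fun i _ => by
              rw [Real.volume_Icc]; exact ENNReal.ofReal_le_ofReal (hρ i)
        _ = _ := by simp
    have h3 := h1.trans h2
    rw [Real.volume_Ioo] at h3
    have h4 : (Fintype.card ι : ENNReal) * ENNReal.ofReal ρ
        = ENNReal.ofReal (Fintype.card ι * ρ) := by
      rw [ENNReal.ofReal_mul (by positivity), ENNReal.ofReal_natCast]
    rw [h4, ENNReal.ofReal_le_ofReal_iff (by positivity)] at h3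
    linarith
  obtain ⟨x, hx⟩ := hne
  obtain ⟨ε, hε, hball⟩ := Metric.isOpen_iff.1 hopen x hx
  have hmem : ∀ y, x ≤ y → y < x + ε → y ∈ U := fun y h1 h2 =>
    hball (by rw [Metric.mem_ball, Real.dist_eq, abs_lt]; constructor <;> linarith)
  refine ⟨x, x + ε / 2, (hx.1.1).le, by linarith,
      ((hmem (x + ε / 2) (by linarith) (by linarith)).1.2).le,
    fun i => ?_⟩
  by_contra h
  push Not at h
  obtain ⟨h1, h2⟩ := h
  rcases le_total (l i) x with h3 | h3
  · exact hx.2 (Set.mem_iUnion.2 ⟨i, h3, h1.le⟩)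
  · exact (hmem (l i) h3 (by linarith)).2 (Set.mem_iUnion.2 ⟨i, le_rfl, hlr i⟩)

/-- In a network with total injected current `β`, an edge of weight `w` sees a potential difference
of at most `2 β / w`. -/
theorem IsEulerianLaplacian.drop_le {V : Type*} [Fintype V] {L : Matrix V V ℝ}
    (hL : IsEulerianLaplacian L) {y : V → ℝ} {β : ℝ}
    (hβ : ∀ (f : V → ℝ) (a b : ℝ), (∀ v, a ≤ f v) → (∀ v, f v ≤ b) → form L f y ≤ (b - a) * β)
    {w : ℝ} {u v : V} (hw : ∀ f : V → ℝ, w * (f u - f v) ^ 2 ≤ 2 * form L f f) :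
    w * |y u - y v| ≤ 2 * β := by
  have hβ0 : 0 ≤ β := by
    have := hβ 0 0 1 (fun _ => le_rfl) (fun _ => zero_le_one)
    simpa [form] using this
  have key : ∀ u v : V, (∀ f : V → ℝ, w * (f u - f v) ^ 2 ≤ 2 * form L f f) → y v ≤ y u →
      w * |y u - y v| ≤ 2 * β := by
    intro u v hw h
    rw [abs_of_nonneg (sub_nonneg.2 h)]
    rcases h.eq_or_lt with h' | h'
    · rw [h', sub_self, mul_zero]; positivity
    have h1 := hL.form_clamp_le y h
    have h2 := hβ (fun i => max (y v) (min (y u) (y i))) (y v) (y u) (fun i => le_max_left _ _)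
      (fun i => max_le h (min_le_left _ _))
    have h3 := hw (fun i => max (y v) (min (y u) (y i)))
    simp only [min_self, max_eq_right h, min_eq_right h, max_self] at h3
    have h4 : (y u - y v) * (w * (y u - y v)) ≤ (y u - y v) * (2 * β) := by nlinarith
    exact le_of_mul_le_mul_left h4 (sub_pos.2 h')
  rcases le_total (y v) (y u) with h | h
  · exact key u v hw h
  · rw [abs_sub_comm]
    exact key v u (fun f => by rw [← neg_sub, neg_sq]; exact hw f) h

/-! ### One weight scale -/

section Level

variable {ν : ℕ} {L : Matrix (Fin ν) (Fin ν) ℝ} {o : Fin ν} {s t₁ s' : ℝ}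

/-- The vertex map of a scale: the clusters at the upper threshold `σ` are contracted to their
representatives, and those of them that contain a representative of a cluster at the lower
threshold `σ'` become the ground `o`. -/
def phi (L : Matrix (Fin ν) (Fin ν) ℝ) (o : Fin ν) (σ σ' : ℝ) (u : Fin ν) : Fin ν :=
  if rep L σ' (rep L σ u) = rep L σ u then o else rep L σ u

/-- The system of a scale: the contraction of `L` along `phi`, in which the edges between different
clusters at the lower threshold are cut, and contracted vertices are attached by edges whose weight
is the lower threshold. -/
def scaleMat (L : Matrix (Fin ν) (Fin ν) ℝ) (o : Fin ν) (σ σ' : ℝ) : Matrix (Fin ν) (Fin ν) ℝ :=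
  contraction L o (phi L o σ σ') (rep L σ') σ'

/-- The image of a demand `g` under a vertex map. -/
def push (φ : Fin ν → Fin ν) (g : Fin ν → ℝ) (j : Fin ν) : ℝ := ∑ u, if φ u = j then g u else 0

theorem dot_push (φ : Fin ν → Fin ν) (f g : Fin ν → ℝ) : f ⬝ᵥ push φ g = ∑ u, g u * f (φ u) := by
  simp only [dotProduct, push, Finset.mul_sum]
  rw [Finset.sum_comm]
  refine Finset.sum_congr rfl fun u _ => ?_
  simp [mul_comm]

theorem phi_eq_of_rep_eq {σ σ' : ℝ} {u v : Fin ν} (h : rep L σ u = rep L σ v) :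
    phi L o σ σ' u = phi L o σ σ' v := by simp only [phi, h]

theorem phi_rep_low {σ σ' : ℝ} (h : σ' ≤ σ) (u : Fin ν) :
    phi L o σ σ' (rep L σ' u) = o := by
  rw [phi, rep_rep_of_ge h, if_pos (rep_rep u)]

/-- Functions that are constant on contracted clusters and vanish at grounded vertices factor
through the vertex map. -/
theorem comp_phi (ho : ∀ v, o ≤ v) {σ σ' : ℝ} {z : Fin ν → ℝ}
    (hz : ∀ u, z (rep L σ u) = z u) (hz0 : ∀ u, z (rep L σ' u) = 0) (u : Fin ν) :
    z (phi L o σ σ' u) = z u := by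
  rw [phi]
  split_ifs with h
  · rw [← hz u, ← h, hz0, ← rep_least (L := L) (τ := σ') ho, hz0]
  · exact hz u

theorem scaleMat_eulerian (hL : IsEulerianLaplacian L) {σ σ' : ℝ} (h : 0 ≤ σ') :
    IsEulerianLaplacian (scaleMat L o σ σ') := hL.contraction h

/-- Only the constants have energy zero in the system of a scale: every cluster at the lower
threshold contains its own representative, which is mapped to the ground. -/
theorem scaleMat_const_of_form (hL : IsEulerianLaplacian L) {σ σ' : ℝ}
    (hσ' : 0 < σ') (h : σ' ≤ σ) {w : Fin ν → ℝ} (hw : form (scaleMat L o σ σ') w w = 0)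
    (i : Fin ν) : w i = w o := by
  have h1 : w i = w (phi L o σ σ' i) := by
    have := hL.contraction_attach_le (o := o) (φ := phi L o σ σ') (q := rep L σ') hσ'.le w i
    rw [← scaleMat, hw] at this
    have h2 : (w i - w (phi L o σ σ' i)) ^ 2 ≤ 0 := by
      by_contra h3
      push Not at h3
      nlinarith [mul_pos hσ' h3]
    have := pow_eq_zero_iff (two_ne_zero) |>.1 (le_antisymm h2 (sq_nonneg _))
    linarith
  have key : ∀ u v, σ' < -L u v → rep L σ' u = rep L σ' v →
      w (phi L o σ σ' u) = w (phi L o σ σ' v) := by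
    intro u v huv hq
    have := hL.contraction_edge_le (o := o) (φ := phi L o σ σ') (q := rep L σ') hσ'.le w hq
    rw [← scaleMat, hw] at this
    have h2 : (w (phi L o σ σ' u) - w (phi L o σ σ' v)) ^ 2 ≤ 0 := by
      by_contra h3
      push Not at h3
      nlinarith [mul_pos (hσ'.trans huv) h3]
    have := pow_eq_zero_iff (two_ne_zero) |>.1 (le_antisymm h2 (sq_nonneg _))
    linarith
  have h3 := abs_sub_le_of_reachable (G := heavy L σ') (z := fun u => w (phi L o σ σ' u)) (D := 0)
    le_rfl ?_ (reachable_rep L σ' i)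
  · simp only [phi_rep_low h, mul_zero] at h3
    have := abs_nonpos_iff.1 h3
    linarith
  · rintro a b ⟨hab, h | h⟩
    · rw [key a b h (rep_eq_of_reachable (SimpleGraph.Adj.reachable ⟨hab, Or.inl h⟩))]; simp
    · rw [key b a h (rep_eq_of_reachable (SimpleGraph.Adj.reachable ⟨hab.symm, Or.inl h⟩))]; simp

/-- The system of a scale is solvable for every demand that sums to zero. -/
theorem scaleMat_solve (hL : IsEulerianLaplacian L) {σ σ' : ℝ}
    (hσ' : 0 < σ') (h : σ' ≤ σ) {g : Fin ν → ℝ} (hg : ∑ u, g u = 0) :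
    scaleMat L o σ σ' *ᵥ (pinv (scaleMat L o σ σ') *ᵥ push (phi L o σ σ') g)
      = push (phi L o σ σ') g := by
  refine mulVec_pinv_mulVec _ _ fun w hw => ?_
  rw [dotProduct_comm, dot_push]
  simp only [fun i => scaleMat_const_of_form hL hσ' h hw i, ← Finset.sum_mul, hg, zero_mul]

theorem sum_mul_le_of_mem_Icc {g f : Fin ν → ℝ} {a b β : ℝ} (hg : ∑ u, g u = 0)
    (hβ : ∑ u, |g u| ≤ β) (ha : ∀ v, a ≤ f v) (hb : ∀ v, f v ≤ b) (hab : a ≤ b) :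
    ∑ u, g u * f u ≤ (b - a) * β := by
  calc ∑ u, g u * f u = ∑ u, g u * (f u - a) := by
        simp only [mul_sub, Finset.sum_sub_distrib, ← Finset.sum_mul, hg]; ring
    _ ≤ ∑ u, |g u| * (b - a) := Finset.sum_le_sum fun u _ =>
        mul_le_mul (le_abs_self _) (by linarith [hb u]) (by linarith [ha u]) (abs_nonneg _)
    _ ≤ (b - a) * β := by
        rw [← Finset.sum_mul, mul_comm]
        exact mul_le_mul_of_nonneg_left hβ (by linarith)

theorem abs_le_of_mul_le {w t x β : ℝ} (ht : 0 < t) (h : t < w) (h' : w * |x| ≤ β) :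
    |x| ≤ β / t := by
  rw [le_div_iff₀ ht]
  nlinarith [abs_nonneg x]

/-- The potentials of the contracted system are bounded: the currents that are injected into a
cluster at the threshold `t₁ ^ 2` sum to zero, the potential varies little on such a cluster, and
potentials outside the ranges of the clusters would have to carry a net current. -/
theorem scaleMat_potential_le (hL : IsEulerianLaplacian L) (hs' : 0 < s')
    (h1 : s' ≤ t₁) (h2 : t₁ ≤ s) {g : Fin ν → ℝ} {β : ℝ} (hβ : ∑ u, |g u| ≤ β)
    (hg : ∀ w : Fin ν → ℝ, (∀ u, w (rep L (t₁ ^ 2) u) = w u) → ∑ u, g u * w u = 0)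
    {y : Fin ν → ℝ}
    (hy : scaleMat L o (s ^ 2) (s' ^ 2) *ᵥ y = push (phi L o (s ^ 2) (s' ^ 2)) g) (u : Fin ν) :
    |y (phi L o (s ^ 2) (s' ^ 2) u) - y o| ≤ ν * (ν * (2 * β / t₁ ^ 2)) := by
  set φ := phi L o (s ^ 2) (s' ^ 2) with hφ
  set M := scaleMat L o (s ^ 2) (s' ^ 2) with hM
  have ht₁ : 0 < t₁ := hs'.trans_le h1
  have hsq1 : s' ^ 2 ≤ t₁ ^ 2 := pow_le_pow_left₀ hs'.le h1 2
  have hsq2 : t₁ ^ 2 ≤ s ^ 2 := pow_le_pow_left₀ ht₁.le h2 2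
  have hME : IsEulerianLaplacian M := scaleMat_eulerian hL (by positivity)
  have hg0 : ∑ u, g u = 0 := by simpa using hg 1 (fun _ => rfl)
  have hβ0 : 0 ≤ β := (Finset.sum_nonneg fun u _ => abs_nonneg (g u)).trans hβ
  have hform : ∀ f, form M f y = ∑ u, g u * f (φ u) := fun f => by rw [form, hy, dot_push]
  have hdrop : ∀ u v, t₁ ^ 2 < -L u v → |y (φ u) - y (φ v)| ≤ 2 * β / t₁ ^ 2 := by
    intro u v huv
    have huv' : u ≠ v ∨ u = v := ne_or_eq _ _
    rcases huv' with hne | rfl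
    · refine abs_le_of_mul_le (by positivity) huv (hME.drop_le (β := β) ?_ ?_)
      · intro f a b ha hb
        rw [hform]
        exact sum_mul_le_of_mem_Icc hg0 hβ (fun v => ha _) (fun v => hb _) ((ha o).trans (hb o))
      · intro f
        exact hL.contraction_edge_le (by positivity) f (rep_eq_of_reachable
          (SimpleGraph.Adj.reachable ⟨hne, Or.inl (hsq1.trans_lt huv)⟩))
    · simp only [sub_self, abs_zero]; positivity
  set ρ := (ν : ℝ) * (2 * β / t₁ ^ 2) with hρ
  have hρ0 : 0 ≤ ρ := by positivity
  have hosc : ∀ u, |y (φ u) - y (φ (rep L (t₁ ^ 2) u))| ≤ ρ := by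
    intro u
    have := abs_sub_le_of_reachable (G := heavy L (t₁ ^ 2)) (z := fun u => y (φ u))
      (D := 2 * β / t₁ ^ 2) (by positivity) ?_ (reachable_rep L (t₁ ^ 2) u)
    · simpa using this
    · rintro a b ⟨-, h | h⟩
      · exact hdrop a b h
      · rw [abs_sub_comm]; exact hdrop b a h
  -- a long interval of potentials contains one that meets no cluster
  have hgap : ∀ i j, y j - y i ≤ ν * ρ := by
    intro i j
    by_contra hlt
    push Not at hlt
    obtain ⟨a, b, hpa, hab, hbq, hint⟩ := exists_gap
      (fun u => min (y (φ u)) (y (φ (rep L (t₁ ^ 2) u))))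
      (fun u => max (y (φ u)) (y (φ (rep L (t₁ ^ 2) u)))) (p := y i) (q := y j)
      (fun u => min_le_max) (fun u => by rw [max_sub_min_eq_abs, abs_sub_comm]; exact hosc u) hρ0
      (by simpa using hlt)
    have h3 := hME.form_clamp_le y hab.le
    rw [hform] at h3
    have h4 : ∑ u, g u * max a (min b (y (φ u))) = 0 := by
      refine hg (fun u => max a (min b (y (φ u)))) fun u => ?_
      rcases hint u with h | h
      · have e1 := (le_max_left _ _).trans h
        have e2 := (le_max_right _ _).trans h
        rw [max_eq_left ((min_le_right _ _).trans e1), max_eq_left ((min_le_right _ _).trans e2)]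
      · have e1 := h.trans (min_le_left _ _)
        have e2 := h.trans (min_le_right _ _)
        rw [min_eq_left e1, min_eq_left e2]
    rw [h4] at h3
    have h5 := le_antisymm h3 (hME.form_nonneg _)
    have e := fun i => scaleMat_const_of_form hL (by positivity) (hsq1.trans hsq2) h5 i
    have h6 := (e i).trans (e j).symm
    rw [min_eq_right (hpa.trans hab.le), max_eq_left hpa, min_eq_left hbq,
      max_eq_right hab.le] at h6
    linarith
  rw [abs_le]
  constructor <;> linarith [hgap (φ u) o, hgap o (φ u)]

/-- The contracted system is consistent with `L` on functions that are constant on contracted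
clusters. -/
theorem scaleMat_residual_le (hL : IsEulerianLaplacian L) (ho : ∀ v, o ≤ v) (hs' : 0 < s')
    (h1 : s' ≤ t₁) (h2 : t₁ ≤ s) {g : Fin ν → ℝ}
    (hg : ∀ w : Fin ν → ℝ, (∀ u, w (rep L (t₁ ^ 2) u) = w u) → ∑ u, g u * w u = 0)
    {y : Fin ν → ℝ} {h : ℝ}
    (hy : scaleMat L o (s ^ 2) (s' ^ 2) *ᵥ y = push (phi L o (s ^ 2) (s' ^ 2)) g)
    (hh : ∀ u, |y (phi L o (s ^ 2) (s' ^ 2) u) - y o| ≤ h)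
    {z : Fin ν → ℝ} (hz : ∀ u, z (rep L (s ^ 2) u) = z u) :
    |∑ u, g u * z u - form L z (fun u => y (phi L o (s ^ 2) (s' ^ 2) u))|
      ≤ 8 * ν ^ 3 * s' * h * nrm L z := by
  set φ := phi L o (s ^ 2) (s' ^ 2) with hφ
  set M := scaleMat L o (s ^ 2) (s' ^ 2) with hM
  set q := rep L (s' ^ 2) with hq
  have ht₁ : 0 < t₁ := hs'.trans_le h1
  have hsq1 : s' ^ 2 ≤ t₁ ^ 2 := pow_le_pow_left₀ hs'.le h1 2
  have hsq2 : t₁ ^ 2 ≤ s ^ 2 := pow_le_pow_left₀ ht₁.le h2 2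
  have hn0 := nrm_nonneg L z
  set z0 : Fin ν → ℝ := fun u => z u - z (q u) with hz0
  have hh0 : 0 ≤ h := (abs_nonneg _).trans (hh o)
  have hν : (1 : ℝ) ≤ ν := by exact_mod_cast o.pos
  have hz0φ : ∀ u, z0 (φ u) = z0 u := comp_phi ho
    (fun u => by simp only [hz0, hq]; rw [hz, rep_rep_of_le (hsq1.trans hsq2)])
    (fun u => by simp only [hz0, hq]; rw [rep_rep, sub_self])
  have hz0o : z0 o = 0 := by simp only [hz0, hq]; rw [rep_least ho, sub_self]
  set vh : Fin ν → ℝ := fun u => y (φ u) - y o with hvh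
  have hgz : ∑ u, g u * z u = ∑ u, g u * z0 u := by
    have : ∑ u, g u * z (q u) = 0 := hg (fun u => z (q u)) fun u => by
      simp only [hq]; rw [rep_rep_of_le hsq1]
    simp only [hz0, mul_sub, Finset.sum_sub_distrib, this, sub_zero]
  have hMz : ∑ u, g u * z0 u = ∑ u, ∑ v, if q u = q v then L u v * (z0 u * vh v) else 0 := by
    have hME : IsEulerianLaplacian M := scaleMat_eulerian hL (by positivity)
    have e1 : form M z0 y = ∑ u, g u * z0 u := by
      rw [form, hy, dot_push]
      exact Finset.sum_congr rfl fun u _ => by rw [hz0φ]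
    rw [← e1, ← hME.form_sub_const z0 y (y o), hM, scaleMat, form_contraction]
    have e2 : ∑ i, (z0 i - z0 (φ i)) * (y i - y o - (y (φ i) - y o)) = 0 :=
      Finset.sum_eq_zero fun i _ => by rw [hz0φ, sub_self, zero_mul]
    rw [← hφ, e2, mul_zero, add_zero]
    refine Finset.sum_congr rfl fun u _ => Finset.sum_congr rfl fun v _ => ?_
    rw [hz0φ, hz0o]
    split_ifs
    · rfl
    · simp
  have hBz : form L z (fun u => y (φ u)) = ∑ u, ∑ v, L u v * (z0 u * vh v)
      + ∑ u, ∑ v, -L u v * ((z (q v) - z (q u)) * vh v) := by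
    rw [← hL.form_sub_const z _ (y o), ← hL.form_col (fun u => z (q u)) vh, ← form_eq_sum,
      ← form_add_left]
    congr 1
    ext u
    simp [hz0]
  have hz0b : ∀ u, |z0 u| ≤ ν * (2 * nrm L z / s') := fun u => hL.abs_sub_rep_le hs' z u
  have hterm : ∀ u v, |(if q u = q v then L u v * (z0 u * vh v) else 0)
      - (L u v * (z0 u * vh v) + -L u v * ((z (q v) - z (q u)) * vh v))|
      ≤ 8 * ν * s' * h * nrm L z := by
    intro u v
    by_cases hquv : q u = q v
    · rw [if_pos hquv, hquv]
      simp only [sub_self, zero_mul, mul_zero, add_zero, abs_zero]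
      positivity
    have huv : u ≠ v := fun h => hquv (h ▸ rfl)
    have hc := le_of_rep_ne hquv
    have hc0 : 0 ≤ -L u v := neg_nonneg.2 (hL.offDiag u v huv)
    rw [if_neg hquv]
    have e1 : 0 - (L u v * (z0 u * vh v) + -L u v * ((z (q v) - z (q u)) * vh v))
        = (-L u v * (z u - z v) + -L u v * z0 v) * vh v := by
      simp only [hz0]; ring
    have e2 : -L u v * |z u - z v| ≤ 2 * s' * nrm L z := hL.light_edge hs' huv hc z
    have e3 : -L u v * |z0 v| ≤ 2 * ν * s' * nrm L z := by
      calc -L u v * |z0 v| ≤ s' ^ 2 * (ν * (2 * nrm L z / s')) :=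
            mul_le_mul hc (hz0b v) (abs_nonneg _) (by positivity)
        _ = _ := by field_simp
    rw [e1, abs_mul]
    have e4 : |(-L u v * (z u - z v) + -L u v * z0 v)| ≤ 8 * ν * s' * nrm L z := by
      refine (abs_add_le _ _).trans ?_
      rw [abs_mul, abs_mul, abs_of_nonneg hc0]
      have : s' * nrm L z ≤ ν * (s' * nrm L z) := le_mul_of_one_le_left (by positivity) hν
      nlinarith
    calc _ ≤ 8 * ν * s' * nrm L z * h := mul_le_mul e4 (hh v) (abs_nonneg _) (by positivity)
      _ = _ := by ring
  rw [hgz, hMz, hBz, ← Finset.sum_add_distrib, ← Finset.sum_sub_distrib]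
  calc _ ≤ ∑ u : Fin ν, ∑ v : Fin ν, 8 * ν * s' * h * nrm L z := by
        refine (Finset.abs_sum_le_sum_abs _ _).trans (Finset.sum_le_sum fun u _ => ?_)
        rw [← Finset.sum_add_distrib, ← Finset.sum_sub_distrib]
        exact (Finset.abs_sum_le_sum_abs _ _).trans (Finset.sum_le_sum fun v _ => hterm u v)
    _ = _ := by simp; ring

/-- A solution of `L y = g` is almost constant on clusters of heavy edges. -/
theorem sub_rep_le (hL : IsEulerianLaplacian L) (hs : 0 < s) {g y : Fin ν → ℝ} {β : ℝ}
    (hβ : ∑ u, |g u| ≤ β) (hg : ∑ u, g u = 0) (hy : L *ᵥ y = g) :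
    (∀ u, |y u - y (rep L (s ^ 2) u)| ≤ ν * (2 * β / s ^ 2)) ∧
    nrm L (fun u => y u - y (rep L (s ^ 2) u)) ≤ 3 * ν ^ 2 * β / s := by
  have hβ0 : 0 ≤ β := (Finset.sum_nonneg fun u _ => abs_nonneg (g u)).trans hβ
  have hdrop : ∀ u v, -L u v * |y u - y v| ≤ 2 * β := by
    intro u v
    refine hL.drop_le (β := β) ?_ (fun f => hL.edge_le u v f)
    intro f a b ha hb
    have : form L f y = ∑ u, g u * f u := by
      rw [form, hy]; exact Finset.sum_congr rfl fun _ _ => mul_comm _ _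
    rw [this]
    exact sum_mul_le_of_mem_Icc hg hβ ha hb ((ha u).trans (hb u))
  have hd : ∀ u, |y u - y (rep L (s ^ 2) u)| ≤ ν * (2 * β / s ^ 2) := by
    intro u
    have := abs_sub_le_of_reachable (G := heavy L (s ^ 2)) (z := y)
      (D := 2 * β / s ^ 2) (by positivity) ?_ (reachable_rep L (s ^ 2) u)
    · simpa using this
    · rintro a b ⟨-, h | h⟩
      · exact abs_le_of_mul_le (by positivity) h (hdrop a b)
      · rw [abs_sub_comm]; exact abs_le_of_mul_le (by positivity) h (hdrop b a)
  refine ⟨hd, ?_⟩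
  set d : Fin ν → ℝ := fun u => y u - y (rep L (s ^ 2) u) with hdd
  have hν0 : (0 : ℝ) ≤ ν := Nat.cast_nonneg _
  have hterm : ∀ u v, -L u v * (d u - d v) ^ 2 ≤ 16 * ν ^ 2 * β ^ 2 / s ^ 2 := by
    intro u v
    have hν : (1 : ℝ) ≤ ν := by exact_mod_cast u.pos
    by_cases huv : u = v
    · rw [huv, sub_self, zero_pow two_ne_zero, mul_zero]; positivity
    have hc0 : 0 ≤ -L u v := neg_nonneg.2 (hL.offDiag u v huv)
    rcases le_or_gt (-L u v) (s ^ 2) with hc | hc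
    · have e : |d u - d v| ≤ 4 * ν * β / s ^ 2 := by
        refine (abs_sub _ _).trans ?_
        calc |d u| + |d v| ≤ ν * (2 * β / s ^ 2) + ν * (2 * β / s ^ 2) := add_le_add (hd u) (hd v)
          _ = _ := by ring
      calc -L u v * (d u - d v) ^ 2 ≤ s ^ 2 * (4 * ν * β / s ^ 2) ^ 2 := by
            rw [← sq_abs (d u - d v)]
            exact mul_le_mul hc (pow_le_pow_left₀ (abs_nonneg _) e 2) (by positivity)
                (by positivity)
        _ = _ := by field_simp; ring
    · have hr : rep L (s ^ 2) u = rep L (s ^ 2) v :=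
        rep_eq_of_reachable (SimpleGraph.Adj.reachable ⟨huv, Or.inl hc⟩)
      have e0 : d u - d v = y u - y v := by simp only [hdd, hr]; ring
      rw [e0, ← sq_abs]
      calc -L u v * |y u - y v| ^ 2 = (-L u v * |y u - y v|) * |y u - y v| := by ring
        _ ≤ (2 * β) * (2 * β / s ^ 2) := mul_le_mul (hdrop u v)
            (abs_le_of_mul_le (by positivity) hc (hdrop u v)) (abs_nonneg _) (by positivity)
        _ = 4 * (1 * β ^ 2) / s ^ 2 := by ring
        _ ≤ 16 * (ν ^ 2 * β ^ 2) / s ^ 2 := by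
            have : (1 : ℝ) ≤ ν ^ 2 := one_le_pow₀ hν
            gcongr
            norm_num
        _ = _ := by ring
  have hE : form L d d ≤ (3 * ν ^ 2 * β / s) ^ 2 := by
    rw [hL.form_self]
    calc _ ≤ 1 / 2 * ∑ u : Fin ν, ∑ v : Fin ν, 16 * (ν : ℝ) ^ 2 * β ^ 2 / s ^ 2 := by
          refine mul_le_mul_of_nonneg_left (Finset.sum_le_sum fun u _ =>
            Finset.sum_le_sum fun v _ => hterm u v) (by norm_num)
      _ = 8 * (ν ^ 4 * β ^ 2 / s ^ 2) := by simp; ring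
      _ ≤ 9 * (ν ^ 4 * β ^ 2 / s ^ 2) := by gcongr; norm_num
      _ = _ := by ring
  rw [nrm]
  exact Real.sqrt_le_iff.2 ⟨by positivity, hE⟩

/-- The error made by answering a demand that lives on one weight scale with an approximate
solution of the system of that scale. -/
theorem level_error (hL : IsEulerianLaplacian L) (ho : ∀ v, o ≤ v) (hs' : 0 < s')
    (h1 : s' ≤ t₁) (h2 : t₁ ≤ s) {g : Fin ν → ℝ} {β ε : ℝ} (hβ : ∑ u, |g u| ≤ β) (hε : 0 ≤ ε)
    (hg : ∀ w : Fin ν → ℝ, (∀ u, w (rep L (t₁ ^ 2) u) = w u) → ∑ u, g u * w u = 0)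
    {x : Fin ν → ℝ}
    (hx : nrm (scaleMat L o (s ^ 2) (s' ^ 2)) (x - pinv (scaleMat L o (s ^ 2) (s' ^ 2)) *ᵥ
        push (phi L o (s ^ 2) (s' ^ 2)) g)
      ≤ ε * nrm (scaleMat L o (s ^ 2) (s' ^ 2)) (pinv (scaleMat L o (s ^ 2) (s' ^ 2)) *ᵥ
        push (phi L o (s ^ 2) (s' ^ 2)) g)) :
    nrm L ((fun u => x (phi L o (s ^ 2) (s' ^ 2) u)) - pinv L *ᵥ g)
      ≤ β * (16 * ν ^ 5 * s' / t₁ ^ 2 + 7 * ν ^ 3 / s + 2 * ν * ε / t₁) := by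
  set φ := phi L o (s ^ 2) (s' ^ 2) with hφ
  set M := scaleMat L o (s ^ 2) (s' ^ 2) with hM
  have ht₁ : 0 < t₁ := hs'.trans_le h1
  have hs : 0 < s := ht₁.trans_le h2
  have hsq1 : s' ^ 2 ≤ t₁ ^ 2 := pow_le_pow_left₀ hs'.le h1 2
  have hsq2 : t₁ ^ 2 ≤ s ^ 2 := pow_le_pow_left₀ ht₁.le h2 2
  have hME : IsEulerianLaplacian M := scaleMat_eulerian hL (by positivity)
  have hg0 : ∑ u, g u = 0 := by simpa using hg 1 (fun _ => rfl)
  have hβ0 : 0 ≤ β := (Finset.sum_nonneg fun u _ => abs_nonneg (g u)).trans hβ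
  have hν : (1 : ℝ) ≤ ν := by exact_mod_cast o.pos
  set yb := pinv M *ᵥ push φ g with hyb
  have hyb' : M *ᵥ yb = push φ g := scaleMat_solve hL (by positivity) (hsq1.trans hsq2) hg0
  set ys := pinv L *ᵥ g with hys
  have hys' : L *ᵥ ys = g := mulVec_pinv_mulVec _ _ fun w hw =>
    hg w (rep_comp_of_form_eq_zero hL (by positivity) hw)
  set h := (ν : ℝ) * (ν * (2 * β / t₁ ^ 2)) with hh
  have hpot : ∀ u, |yb (φ u) - yb o| ≤ h :=
    scaleMat_potential_le hL hs' h1 h2 hβ hg hyb'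
  obtain ⟨hd, hdn⟩ := sub_rep_le hL hs hβ hg0 hys'
  set d : Fin ν → ℝ := fun u => ys u - ys (rep L (s ^ 2) u) with hdd
  -- the part of the error that is constant on contracted clusters
  set z : Fin ν → ℝ := fun u => ys (rep L (s ^ 2) u) - yb (φ u) with hzz
  have hz : ∀ u, z (rep L (s ^ 2) u) = z u := by
    intro u
    simp only [hzz, hφ]
    rw [rep_rep, phi_eq_of_rep_eq (rep_rep u)]
  have hres := scaleMat_residual_le hL ho hs' h1 h2 hg hyb' hpot hz
  have hn0 := nrm_nonneg L z
  have hBd : |form L z d| ≤ 4 * ν ^ 3 * β / s * nrm L z := by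
    rw [hL.form_col]
    have hterm : ∀ u v, |-L u v * ((z v - z u) * d v)| ≤ 4 * ν * β / s * nrm L z := by
      intro u v
      by_cases hr : rep L (s ^ 2) u = rep L (s ^ 2) v
      · have : z u = z v := by rw [← hz u, hr, hz v]
        rw [this, sub_self, zero_mul, mul_zero, abs_zero]
        positivity
      have huv : u ≠ v := fun h => hr (h ▸ rfl)
      have hc0 : 0 ≤ -L u v := neg_nonneg.2 (hL.offDiag u v huv)
      have e := hL.light_edge hs huv (le_of_rep_ne hr) z
      rw [abs_mul, abs_mul, abs_of_nonneg hc0, abs_sub_comm, ← mul_assoc]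
      calc _ ≤ 2 * s * nrm L z * (ν * (2 * β / s ^ 2)) :=
            mul_le_mul e (hd v) (abs_nonneg _) (by positivity)
        _ = _ := by field_simp; ring
    calc _ ≤ ∑ u : Fin ν, ∑ v : Fin ν, 4 * ν * β / s * nrm L z :=
          (Finset.abs_sum_le_sum_abs _ _).trans (Finset.sum_le_sum fun u _ =>
            (Finset.abs_sum_le_sum_abs _ _).trans (Finset.sum_le_sum fun v _ => hterm u v))
      _ = _ := by simp; ring
  have hz_le : nrm L z ≤ β * (16 * ν ^ 5 * s' / t₁ ^ 2 + 4 * ν ^ 3 / s) := by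
    have e1 : z = ys - d - fun u => yb (φ u) := by
      ext u; simp only [hzz, hdd, Pi.sub_apply]; ring
    have e2 : form L z z = ∑ u, g u * z u - form L z (fun u => yb (φ u)) - form L z d := by
      have e0 : form L z z = form L z (ys - d - fun u => yb (φ u)) := congrArg (form L z) e1
      rw [e0, form_sub_right, form_sub_right]
      have : form L z ys = ∑ u, g u * z u := by
        rw [form, hys']; exact Finset.sum_congr rfl fun _ _ => mul_comm _ _
      rw [this]; ring
    have e3 : nrm L z * nrm L z
        ≤ nrm L z * (β * (16 * ν ^ 5 * s' / t₁ ^ 2 + 4 * ν ^ 3 / s)) := by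
      rw [← sq, hL.nrm_sq, e2]
      have := le_abs_self (∑ u, g u * z u - form L z (fun u => yb (φ u)))
      have := neg_abs_le (form L z d)
      have e4 : 8 * (ν : ℝ) ^ 3 * s' * h * nrm L z + 4 * ν ^ 3 * β / s * nrm L z
        = nrm L z * (β * (16 * ν ^ 5 * s' / t₁ ^ 2 + 4 * ν ^ 3 / s)) := by
        rw [hh]; ring
      linarith
    rcases hn0.eq_or_lt with h0 | h0
    · rw [← h0]; positivity
    · exact le_of_mul_le_mul_left e3 h0
  -- the error of the solver
  have hsolve : nrm L (fun u => (x - yb) (φ u)) ≤ β * (2 * ν * ε / t₁) := by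
    have e1 : form M yb yb ≤ 2 * ν ^ 2 * β ^ 2 / t₁ ^ 2 := by
      have : form M yb yb = ∑ u, g u * (yb (φ u) - yb o) := by
        rw [form, hyb', dot_push]
        simp only [mul_sub, Finset.sum_sub_distrib, ← Finset.sum_mul, hg0]
        ring
      rw [this]
      calc _ ≤ ∑ u, |g u| * h := Finset.sum_le_sum fun u _ => (le_abs_self _).trans (by
              rw [abs_mul]; exact mul_le_mul_of_nonneg_left (hpot u) (abs_nonneg _))
        _ ≤ β * h := by
              rw [← Finset.sum_mul]; exact mul_le_mul_of_nonneg_right hβ (by positivity)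
        _ = _ := by rw [hh]; ring
    have e2 : form L (fun u => (x - yb) (φ u)) (fun u => (x - yb) (φ u))
        ≤ (β * (2 * ν * ε / t₁)) ^ 2 := by
      refine (hL.form_comp_le (o := o) (φ := φ) (q := rep L (s' ^ 2)) (ω := s' ^ 2)
        (by positivity) (x - yb)).trans ?_
      have e3 : form M (x - yb) (x - yb) ≤ ε ^ 2 * form M yb yb := by
        rw [← hME.nrm_sq, ← hME.nrm_sq, ← mul_pow]
        exact pow_le_pow_left₀ (nrm_nonneg _ _) hx 2
      calc _ ≤ 2 * (ε ^ 2 * (2 * ν ^ 2 * β ^ 2 / t₁ ^ 2)) :=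
            mul_le_mul_of_nonneg_left (e3.trans
              (mul_le_mul_of_nonneg_left e1 (sq_nonneg _))) (by norm_num)
        _ = _ := by ring
    exact Real.sqrt_le_iff.2 ⟨by positivity, e2⟩
  have e1 : (fun u => x (φ u)) - ys = (fun u => (x - yb) (φ u)) - (z + d) := by
    ext u; simp only [hzz, hdd, Pi.sub_apply, Pi.add_apply]; ring
  rw [e1]
  calc _ ≤ β * (2 * ν * ε / t₁) + (β * (16 * ν ^ 5 * s' / t₁ ^ 2 + 4 * ν ^ 3 / s)
        + 3 * ν ^ 2 * β / s) :=
        (hL.nrm_sub_le _ _).trans (add_le_add hsolve ((hL.nrm_add_le _ _).trans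
          (add_le_add hz_le hdn)))
    _ ≤ β * (2 * ν * ε / t₁) + (β * (16 * ν ^ 5 * s' / t₁ ^ 2 + 4 * ν ^ 3 / s)
        + 3 * ν ^ 3 * β / s) := by
        have : (ν : ℝ) ^ 2 ≤ ν ^ 3 := pow_le_pow_right₀ hν (by norm_num)
        gcongr
    _ = _ := by ring

end Level

/-! ### Splitting a demand into weight scales -/

section Split

variable {ν : ℕ} {L : Matrix (Fin ν) (Fin ν) ℝ} {o : Fin ν}

/-- The part of the demand `b` that lives on the scale of the threshold `τ`: the demands of the
clusters at `τ`, minus the demands of the clusters at `τ / N`. -/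
def demand (L : Matrix (Fin ν) (Fin ν) ℝ) (N : ℝ) (b : Fin ν → ℝ) (τ : ℝ) : Fin ν → ℝ :=
  push (rep L τ) b - push (rep L (τ / N)) b

theorem push_push (φ r : Fin ν → Fin ν) (b : Fin ν → ℝ) :
    push φ (push r b) = push (fun u => φ (r u)) b := by
  ext j
  have e : ∀ (φ : Fin ν → Fin ν) (b : Fin ν → ℝ), push φ b j = Pi.single j (1 : ℝ) ⬝ᵥ push φ b :=
    fun φ b => by simp
  rw [e, e, dot_push, dot_push]
  have := dot_push r (fun u => (Pi.single j (1 : ℝ) : Fin ν → ℝ) (φ u)) b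
  rw [← this]
  exact Finset.sum_congr rfl fun _ _ => mul_comm _ _

theorem push_sub (φ : Fin ν → Fin ν) (b b' : Fin ν → ℝ) :
    push φ (b - b') = push φ b - push φ b' := by
  ext j
  simp only [push, Pi.sub_apply, ← Finset.sum_sub_distrib]
  exact Finset.sum_congr rfl fun _ _ => by split_ifs <;> simp

theorem sum_abs_push_le (φ : Fin ν → Fin ν) (g : Fin ν → ℝ) : ∑ j, |push φ g j| ≤ ∑ u, |g u| := by
  calc ∑ j, |push φ g j| ≤ ∑ j, ∑ u, |if φ u = j then g u else 0| :=
        Finset.sum_le_sum fun j _ => Finset.abs_sum_le_sum_abs _ _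
    _ = ∑ u, |g u| := by
        rw [Finset.sum_comm]
        refine Finset.sum_congr rfl fun u _ => ?_
        rw [Finset.sum_eq_single (φ u)]
        · simp
        · intro j _ hj; rw [if_neg hj.symm, abs_zero]
        · simp

/-- The demand of a scale sums to zero on every cluster of the next threshold. -/
theorem sum_demand_mul {N τ : ℝ} (hτ : τ / N ≤ τ) (b : Fin ν → ℝ) {w : Fin ν → ℝ}
    (hw : ∀ u, w (rep L (τ / N) u) = w u) : ∑ u, demand L N b τ u * w u = 0 := by
  have e : ∀ r : Fin ν → Fin ν, ∑ u, push r b u * w u = ∑ u, b u * w (r u) := fun r => by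
    rw [← dot_push r w b]; exact Finset.sum_congr rfl fun _ _ => mul_comm _ _
  simp only [demand, Pi.sub_apply, sub_mul, Finset.sum_sub_distrib, e, hw]
  have : ∀ u, w (rep L τ u) = w u := fun u => by rw [← hw, rep_rep_of_le hτ, hw]
  simp only [this, sub_self]

/-- The net demand of a cluster is bounded by the energy of the potential that creates it: only
light edges leave the cluster, and the potential varies little inside it. -/
theorem abs_push_rep_le (hL : IsEulerianLaplacian L) {t : ℝ} (ht : 0 < t) {b x : Fin ν → ℝ}
    (hx : L *ᵥ x = b) (j : Fin ν) :
    |push (rep L (t ^ 2)) b j| ≤ 4 * ν ^ 3 * t * nrm L x := by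
  have hν : (1 : ℝ) ≤ ν := by exact_mod_cast j.pos
  have hn0 := nrm_nonneg L x
  by_cases hj : rep L (t ^ 2) j = j
  swap
  · have : push (rep L (t ^ 2)) b j = 0 := Finset.sum_eq_zero fun u _ => by
      rw [if_neg]
      intro h
      exact hj (by rw [← h, rep_rep])
    rw [this, abs_zero]
    positivity
  set z : Fin ν → ℝ := fun u => if rep L (t ^ 2) u = j then 1 else 0 with hz
  have e1 : push (rep L (t ^ 2)) b j = form L z x := by
    rw [form, hx]
    simp only [push, dotProduct, hz]
    exact Finset.sum_congr rfl fun u _ => by split_ifs <;> simp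
  have hX : ∀ u, rep L (t ^ 2) u = j → |x u - x j| ≤ ν * (2 * nrm L x / t) := fun u hu => by
    have := hL.abs_sub_rep_le ht x u
    rwa [hu] at this
  have hterm : ∀ u v, |-L u v * ((z v - z u) * (x v - x j))| ≤ 4 * ν * t * nrm L x := by
    intro u v
    by_cases hr : rep L (t ^ 2) u = rep L (t ^ 2) v
    · have : z u = z v := by simp only [hz, hr]
      rw [this, sub_self, zero_mul, mul_zero, abs_zero]
      positivity
    have huv : u ≠ v := fun h => hr (h ▸ rfl)
    have hc := le_of_rep_ne hr
    have hc0 : 0 ≤ -L u v := neg_nonneg.2 (hL.offDiag u v huv)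
    have hin : ∀ w, rep L (t ^ 2) w = j → -L u v * |x w - x j| ≤ 2 * ν * t * nrm L x := by
      intro w hw
      calc _ ≤ t ^ 2 * (ν * (2 * nrm L x / t)) :=
            mul_le_mul hc (hX w hw) (abs_nonneg _) (by positivity)
        _ = _ := by field_simp
    rw [abs_mul, abs_mul, abs_of_nonneg hc0]
    by_cases hv : rep L (t ^ 2) v = j
    · have hu : rep L (t ^ 2) u ≠ j := fun h => hr (h.trans hv.symm)
      have : |z v - z u| = 1 := by simp [hz, hv, hu]
      rw [this, one_mul]
      have := hin v hv
      have : 0 ≤ ν * t * nrm L x := by positivity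
      linarith
    · by_cases hu : rep L (t ^ 2) u = j
      · have : |z v - z u| = 1 := by simp [hz, hv, hu]
        rw [this, one_mul]
        have e2 := hin u hu
        have e3 := hL.light_edge ht huv hc x
        have e4 : |x v - x j| ≤ |x u - x v| + |x u - x j| := by
          rw [abs_sub_comm (x u) (x v)]; exact abs_sub_le _ _ _
        have e5 := mul_le_mul_of_nonneg_left e4 hc0
        have : t * nrm L x ≤ ν * (t * nrm L x) := le_mul_of_one_le_left (by positivity) hν
        nlinarith
      · have : z v - z u = 0 := by simp [hz, hv, hu]
        rw [this, abs_zero, zero_mul, mul_zero]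
        positivity
  rw [e1, ← hL.form_sub_const z x (x j), hL.form_col]
  calc _ ≤ ∑ u : Fin ν, ∑ v : Fin ν, 4 * ν * t * nrm L x :=
        (Finset.abs_sum_le_sum_abs _ _).trans (Finset.sum_le_sum fun u _ =>
          (Finset.abs_sum_le_sum_abs _ _).trans (Finset.sum_le_sum fun v _ => hterm u v))
    _ = _ := by simp; ring

/-- The demand of a scale is small compared with the energy of the potential that creates the full
demand. -/
theorem sum_abs_demand_le (hL : IsEulerianLaplacian L) {t N : ℝ} (ht : 0 < t)
    (hN : t ^ 2 / N ≤ t ^ 2) {b x : Fin ν → ℝ} (hx : L *ᵥ x = b) :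
    ∑ u, |demand L N b (t ^ 2) u| ≤ 8 * ν ^ 4 * t * nrm L x := by
  have e1 : push (rep L (t ^ 2 / N)) b = push (rep L (t ^ 2 / N)) (push (rep L (t ^ 2)) b) := by
    rw [push_push]
    simp only [rep_rep_of_le hN]
  have e2 : ∑ u, |push (rep L (t ^ 2)) b u| ≤ 4 * ν ^ 4 * t * nrm L x := by
    calc _ ≤ ∑ u : Fin ν, 4 * (ν : ℝ) ^ 3 * t * nrm L x :=
          Finset.sum_le_sum fun u _ => abs_push_rep_le hL ht hx u
      _ = _ := by simp; ring
  calc _ ≤ ∑ u, (|push (rep L (t ^ 2)) b u| + |push (rep L (t ^ 2 / N)) b u|) :=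
        Finset.sum_le_sum fun u _ => abs_sub _ _
    _ ≤ 4 * ν ^ 4 * t * nrm L x + 4 * ν ^ 4 * t * nrm L x := by
        rw [Finset.sum_add_distrib]
        refine add_le_add e2 (le_trans ?_ e2)
        rw [e1]
        exact sum_abs_push_le _ _
    _ = _ := by ring

/-- The number of clusters at a threshold. -/
def clusters (L : Matrix (Fin ν) (Fin ν) ℝ) (τ : ℝ) : ℕ :=
  (Finset.univ.filter fun u => rep L τ u = u).card

theorem clusters_anti {τ τ' : ℝ} (h : τ' ≤ τ) : clusters L τ' ≤ clusters L τ :=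
  Finset.card_le_card fun u hu => by
    simp only [Finset.mem_filter, Finset.mem_univ, true_and] at hu ⊢
    rw [← hu, rep_rep_of_ge h]

/-- If the clusters change from one threshold to a lower one, some of them merge. -/
theorem clusters_lt {τ τ' : ℝ} (h : τ' ≤ τ) (hne : rep L τ ≠ rep L τ') :
    clusters L τ' < clusters L τ := by
  obtain ⟨u, hu⟩ := Function.ne_iff.1 hne
  refine Finset.card_lt_card (Finset.ssubset_iff.2 ⟨rep L τ u, ?_, ?_⟩)
  · simp only [Finset.mem_filter, Finset.mem_univ, true_and, rep_rep_of_le h]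
    exact hu.symm
  · intro v hv
    simp only [Finset.mem_insert, Finset.mem_filter, Finset.mem_univ, true_and] at hv ⊢
    rcases hv with rfl | hv
    · exact rep_rep u
    · rw [← hv, rep_rep_of_ge h]

/-- The error of one scale, charged to the clusters that merge there. -/
theorem scale_error (hL : IsEulerianLaplacian L) (ho : ∀ v, o ≤ v) {τ P : ℝ} (hτ : 0 < τ)
    (hP : 1 ≤ P) {b xs : Fin ν → ℝ} (hxs : L *ᵥ xs = b) {x : Fin ν → ℝ}
    (hx : nrm (scaleMat L o (τ * P ^ 2) (τ / (P ^ 2) ^ 3)) (x -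
        pinv (scaleMat L o (τ * P ^ 2) (τ / (P ^ 2) ^ 3)) *ᵥ
          push (phi L o (τ * P ^ 2) (τ / (P ^ 2) ^ 3)) (demand L (P ^ 2) b τ))
      ≤ 1 / P ^ 2 * nrm (scaleMat L o (τ * P ^ 2) (τ / (P ^ 2) ^ 3))
        (pinv (scaleMat L o (τ * P ^ 2) (τ / (P ^ 2) ^ 3)) *ᵥ
          push (phi L o (τ * P ^ 2) (τ / (P ^ 2) ^ 3)) (demand L (P ^ 2) b τ))) :
    nrm L ((fun u => x (phi L o (τ * P ^ 2) (τ / (P ^ 2) ^ 3) u)) - pinv L *ᵥ demand L (P ^ 2) b τ)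
      ≤ 200 * ν ^ 9 / P * nrm L xs * (clusters L τ - clusters L (τ / P ^ 2)) := by
  obtain ⟨t, ht, rfl⟩ : ∃ t : ℝ, 0 < t ∧ t ^ 2 = τ :=
    ⟨Real.sqrt τ, Real.sqrt_pos.2 hτ, Real.sq_sqrt hτ.le⟩
  have hP0 : 0 < P := by linarith
  have hν : (1 : ℝ) ≤ ν := by exact_mod_cast o.pos
  have e1 : t ^ 2 * P ^ 2 = (t * P) ^ 2 := by ring
  have e2 : t ^ 2 / (P ^ 2) ^ 3 = (t / P ^ 3) ^ 2 := by rw [div_pow]; ring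
  have e3 : t ^ 2 / P ^ 2 = (t / P) ^ 2 := by rw [div_pow]
  have hle : t ^ 2 / P ^ 2 ≤ t ^ 2 := div_le_self (by positivity) (one_le_pow₀ hP)
  have hn0 := nrm_nonneg L xs
  rw [e1, e2] at hx ⊢
  have hlev : ∀ β, ∑ u, |demand L (P ^ 2) b (t ^ 2) u| ≤ β → 0 ≤ β →
      nrm L ((fun u => x (phi L o ((t * P) ^ 2) ((t / P ^ 3) ^ 2) u))
        - pinv L *ᵥ demand L (P ^ 2) b (t ^ 2)) ≤ β * (25 * ν ^ 5 / (t * P)) := by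
    intro β hβ hβ0
    have := level_error (t₁ := t / P) hL ho (by positivity)
      (div_le_div_of_nonneg_left ht.le hP0 (le_self_pow₀ hP (by norm_num)))
      ((div_le_self ht.le hP).trans (le_mul_of_one_le_right ht.le hP)) hβ (by positivity)
      (fun w hw => sum_demand_mul hle b (by rw [e3]; exact hw)) hx
    refine this.trans (mul_le_mul_of_nonneg_left ?_ hβ0)
    have h1 : 16 * (ν : ℝ) ^ 5 * (t / P ^ 3) / (t / P) ^ 2 = 16 * ν ^ 5 / (t * P) := by
      field_simp
    have h2 : 2 * (ν : ℝ) * (1 / P ^ 2) / (t / P) = 2 * ν ^ 1 / (t * P) := by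
      field_simp
    rw [h1, h2, ← add_div, ← add_div]
    have h3 : (ν : ℝ) ^ 3 ≤ ν ^ 5 := pow_le_pow_right₀ hν (by norm_num)
    have h4 : (ν : ℝ) ^ 1 ≤ ν ^ 5 := pow_le_pow_right₀ hν (by norm_num)
    gcongr
    linarith
  by_cases hne : rep L (t ^ 2) = rep L (t ^ 2 / P ^ 2)
  · have h0 : demand L (P ^ 2) b (t ^ 2) = 0 := by rw [demand, hne, sub_self]
    have h1 := hlev 0 (by simp [h0]) le_rfl
    rw [zero_mul] at h1
    refine h1.trans ?_
    have := clusters_anti (L := L) hle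
    have : (0 : ℝ) ≤ clusters L (t ^ 2) - clusters L (t ^ 2 / P ^ 2) := by
      rw [sub_nonneg]; exact_mod_cast this
    positivity
  · have h1 := hlev _ (sum_abs_demand_le hL ht hle hxs) (by positivity)
    have h2 : (1 : ℝ) ≤ clusters L (t ^ 2) - clusters L (t ^ 2 / P ^ 2) := by
      rw [le_sub_iff_add_le, add_comm]
      exact_mod_cast clusters_lt hle hne
    calc _ ≤ 8 * ν ^ 4 * t * nrm L xs * (25 * ν ^ 5 / (t * P)) := h1
      _ = 200 * ν ^ 9 / P * nrm L xs * 1 := by field_simp; ring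
      _ ≤ _ := mul_le_mul_of_nonneg_left h2 (by positivity)

/-- No edge is heavier than `W`, so at this threshold the clusters are single vertices. -/
theorem rep_eq_self {W : ℝ} (hW : ∀ u v, -L u v ≤ W) (u : Fin ν) : rep L W u = u := by
  refine rep_unique (SimpleGraph.Reachable.refl _) fun v hv => ?_
  obtain ⟨p⟩ := hv
  cases p with
  | nil => exact le_rfl
  | cons h _ =>
    exact (lt_irrefl W (h.2.elim (fun h => h.trans_le (hW _ _)) fun h => h.trans_le (hW _ _))).elim

/-- When no edge joins different clusters, the clusters are the connected components, and a demand
in the range of `L` sums to zero on each of them. -/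
theorem push_rep_eq_zero (hL : IsEulerianLaplacian L) {τ : ℝ}
    (hτ : ∀ u v, L u v ≠ 0 → rep L τ u = rep L τ v) {b x : Fin ν → ℝ} (hx : L *ᵥ x = b) :
    push (rep L τ) b = 0 := by
  ext j
  set z : Fin ν → ℝ := fun u => if rep L τ u = j then 1 else 0 with hz
  have e1 : push (rep L τ) b j = form L z x := by
    rw [form, hx]
    simp only [push, dotProduct, hz]
    exact Finset.sum_congr rfl fun u _ => by split_ifs <;> simp
  have e2 : form L z z = 0 := by
    rw [hL.form_self]
    refine mul_eq_zero_of_right _ (Finset.sum_eq_zero fun u _ => Finset.sum_eq_zero fun v _ => ?_)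
    by_cases h : L u v = 0
    · simp [h]
    · simp [hz, hτ u v h]
  rw [e1, ← form_transpose, form, hL.transpose_mulVec_eq_zero_of_form e2, dotProduct_zero,
    Pi.zero_apply]

/-- The sum of the answers for all scales solves the original system up to a small error. The
demands of the scales telescope to the full demand, and the errors to the number of clusters. -/
theorem total_error (hL : IsEulerianLaplacian L) (ho : ∀ v, o ≤ v) {W P : ℝ} (hW0 : 0 < W)
    (hW : ∀ u v, -L u v ≤ W) (hP : 1 ≤ P) {b xs : Fin ν → ℝ} (hxs : L *ᵥ xs = b) {K : ℕ}
    (hK : ∀ u v, L u v ≠ 0 → rep L (W / (P ^ 2) ^ K) u = rep L (W / (P ^ 2) ^ K) v)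
    {τ : ℕ → ℝ} (hτ : ∀ k, τ k = W / (P ^ 2) ^ k) {x : ℕ → Fin ν → ℝ}
    (hx : ∀ k < K, nrm (scaleMat L o (τ k * P ^ 2) (τ k / (P ^ 2) ^ 3)) (x k -
        pinv (scaleMat L o (τ k * P ^ 2) (τ k / (P ^ 2) ^ 3)) *ᵥ
          push (phi L o (τ k * P ^ 2) (τ k / (P ^ 2) ^ 3)) (demand L (P ^ 2) b (τ k)))
      ≤ 1 / P ^ 2 * nrm (scaleMat L o (τ k * P ^ 2) (τ k / (P ^ 2) ^ 3))
        (pinv (scaleMat L o (τ k * P ^ 2) (τ k / (P ^ 2) ^ 3)) *ᵥ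
          push (phi L o (τ k * P ^ 2) (τ k / (P ^ 2) ^ 3)) (demand L (P ^ 2) b (τ k)))) :
    nrm L ((fun u => ∑ k ∈ Finset.range K, x k (phi L o (τ k * P ^ 2) (τ k / (P ^ 2) ^ 3) u)) - xs)
      ≤ 200 * ν ^ 10 / P * nrm L xs := by
  have hP0 : 0 < P := by linarith
  have hτ0 : ∀ k, 0 < τ k := fun k => by rw [hτ]; positivity
  have hτs : ∀ k, τ k / P ^ 2 = τ (k + 1) := fun k => by
    rw [hτ, hτ, pow_succ (P ^ 2) k, div_div]
  have hτle : ∀ k, τ k / P ^ 2 ≤ τ k := fun k => div_le_self (hτ0 k).le (one_le_pow₀ hP)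
  have hn0 := nrm_nonneg L xs
  set ys : ℕ → Fin ν → ℝ := fun k => pinv L *ᵥ demand L (P ^ 2) b (τ k) with hys
  have hsum : ∑ k ∈ Finset.range K, demand L (P ^ 2) b (τ k) = b := by
    simp only [demand, hτs]
    have hid : push (rep L (τ 0)) b = b := by
      ext j
      have : rep L (τ 0) = id := funext fun u => rep_eq_self (by simpa [hτ] using hW) u
      simp [push, this]
    rw [Finset.sum_range_sub', hτ K, push_rep_eq_zero hL hK hxs, sub_zero, hid]
  have hker : nrm L (∑ k ∈ Finset.range K, ys k - xs) = 0 := by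
    have h1 : ∀ k, L *ᵥ ys k = demand L (P ^ 2) b (τ k) := fun k =>
      mulVec_pinv_mulVec _ _ fun w hw => sum_demand_mul (hτle k) b
        (rep_comp_of_form_eq_zero hL (div_pos (hτ0 k) (by positivity)).le hw)
    have h2 : L *ᵥ (∑ k ∈ Finset.range K, ys k - xs) = 0 := by
      rw [mulVec_sub, hxs, mulVec_sum]
      simp only [h1, hsum, sub_self]
    rw [nrm, form, h2, dotProduct_zero, Real.sqrt_zero]
  have hsplit : (fun u => ∑ k ∈ Finset.range K, x k (phi L o (τ k * P ^ 2) (τ k / (P ^ 2) ^ 3) u))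
      - xs
      = ∑ k ∈ Finset.range K, ((fun u => x k (phi L o (τ k * P ^ 2) (τ k / (P ^ 2) ^ 3) u)) - ys k)
        + (∑ k ∈ Finset.range K, ys k - xs) := by
    ext u
    simp [Finset.sum_apply]
  rw [hsplit]
  calc _ ≤ ∑ k ∈ Finset.range K, nrm L ((fun u => x k (phi L o (τ k * P ^ 2) (τ k / (P ^ 2) ^ 3) u))
          - ys k) + 0 := by
        refine (hL.nrm_add_le _ _).trans (add_le_add (hL.nrm_sum_le _ _) hker.le)
    _ ≤ ∑ k ∈ Finset.range K, 200 * ν ^ 9 / P * nrm L xs *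
        (clusters L (τ k) - clusters L (τ (k + 1))) := by
        rw [add_zero]
        refine Finset.sum_le_sum fun k hk => ?_
        have := scale_error hL ho (hτ0 k) hP hxs (hx k (Finset.mem_range.1 hk))
        rwa [hτs] at this
    _ = 200 * ν ^ 9 / P * nrm L xs * (clusters L (τ 0) - clusters L (τ K)) := by
        rw [← Finset.mul_sum, Finset.sum_range_sub' fun k => (clusters L (τ k) : ℝ)]
    _ ≤ 200 * ν ^ 9 / P * nrm L xs * ν := by
        refine mul_le_mul_of_nonneg_left ?_ (by positivity)
        have h1 : (clusters L (τ 0) : ℝ) ≤ ν := by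
          have : clusters L (τ 0) ≤ ν := by
            simpa [clusters] using Finset.card_filter_le (Finset.univ : Finset (Fin ν)) _
          exact_mod_cast this
        have : (0 : ℝ) ≤ clusters L (τ K) := Nat.cast_nonneg _
        linarith
    _ = _ := by ring

end Split

/-! ### Condition numbers -/

section Spectral

variable {V : Type*} [Fintype V]

theorem norm_toLp_sq (x : V → ℝ) : ‖WithLp.toLp 2 x‖ ^ 2 = x ⬝ᵥ x := by
  rw [EuclideanSpace.real_norm_sq_eq]
  exact Finset.sum_congr rfl fun _ _ => sq _

theorem dot_sq_le (x y : V → ℝ) : (x ⬝ᵥ y) ^ 2 ≤ (x ⬝ᵥ x) * (y ⬝ᵥ y) := by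
  have := Finset.sum_mul_sq_le_sq_mul_sq Finset.univ x y
  simpa [dotProduct, sq] using this

theorem dot_self_nonneg (x : V → ℝ) : 0 ≤ x ⬝ᵥ x :=
  Finset.sum_nonneg fun _ _ => mul_self_nonneg _

theorem form_add_transpose (L : Matrix V V ℝ) (x : V → ℝ) :
    form (L + Lᵀ) x x = 2 * form L x x := by
  rw [form_add_mat, form_transpose]; ring

variable [DecidableEq V]

theorem specNorm_nonneg (A : Matrix V V ℝ) : 0 ≤ specNorm A := norm_nonneg _

theorem specNorm_le {A : Matrix V V ℝ} {B : ℝ} (hB : 0 ≤ B)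
    (h : ∀ x, (A *ᵥ x) ⬝ᵥ (A *ᵥ x) ≤ B ^ 2 * (x ⬝ᵥ x)) : specNorm A ≤ B := by
  refine ContinuousLinearMap.opNorm_le_bound _ hB fun x => ?_
  refine abs_le_of_sq_le_sq' ?_ (by positivity) |>.2
  have e : Matrix.toEuclideanCLM (n := V) (𝕜 := ℝ) A x = WithLp.toLp 2 (A *ᵥ x.ofLp) := by
    rw [← Matrix.toEuclideanCLM_toLp]
  rw [e, norm_toLp_sq, mul_pow]
  have : ‖x‖ ^ 2 = x.ofLp ⬝ᵥ x.ofLp := norm_toLp_sq x.ofLp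
  rw [this]
  exact h _

theorem mulVec_dot_le (A : Matrix V V ℝ) (x : V → ℝ) :
    (A *ᵥ x) ⬝ᵥ (A *ᵥ x) ≤ specNorm A ^ 2 * (x ⬝ᵥ x) := by
  have h := (Matrix.toEuclideanCLM (n := V) (𝕜 := ℝ) A).le_opNorm (WithLp.toLp 2 x)
  rw [Matrix.toEuclideanCLM_toLp] at h
  rw [← norm_toLp_sq, ← norm_toLp_sq, ← mul_pow]
  exact pow_le_pow_left₀ (norm_nonneg _) h 2

theorem specNorm_le_of_entries {A : Matrix V V ℝ} {r : ℝ} (hr : 0 ≤ r) (h : ∀ i j, |A i j| ≤ r) :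
    specNorm A ≤ Fintype.card V * r := by
  refine specNorm_le (by positivity) fun x => ?_
  have hx : ∀ i, (A *ᵥ x) i * (A *ᵥ x) i ≤ r ^ 2 * (Fintype.card V * (x ⬝ᵥ x)) := by
    intro i
    have e1 : |(A *ᵥ x) i| ≤ r * ∑ j, |x j| := by
      rw [Finset.mul_sum]
      refine (Finset.abs_sum_le_sum_abs _ _).trans (Finset.sum_le_sum fun j _ => ?_)
      rw [abs_mul]
      exact mul_le_mul_of_nonneg_right (h i j) (abs_nonneg _)
    have e2 : (∑ j, |x j|) ^ 2 ≤ Fintype.card V * (x ⬝ᵥ x) := by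
      have := sq_sum_le_card_mul_sum_sq (s := Finset.univ) (f := fun j => |x j|)
      simpa [dotProduct, ← sq] using this
    calc (A *ᵥ x) i * (A *ᵥ x) i = |(A *ᵥ x) i| ^ 2 := by rw [sq_abs, sq]
      _ ≤ (r * ∑ j, |x j|) ^ 2 := pow_le_pow_left₀ (abs_nonneg _) e1 2
      _ ≤ _ := by rw [mul_pow]; exact mul_le_mul_of_nonneg_left e2 (sq_nonneg _)
  calc _ ≤ ∑ _i : V, r ^ 2 * (Fintype.card V * (x ⬝ᵥ x)) := Finset.sum_le_sum fun i _ => hx i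
    _ = _ := by simp; ring

theorem one_le_condNumber {A : Matrix V V ℝ} (hA : A ≠ 0) : 1 ≤ condNumber A := by
  have hpos : 0 < specNorm A := by
    rw [specNorm, norm_pos_iff]
    exact (map_ne_zero_iff _ (Matrix.toEuclideanCLM (n := V) (𝕜 := ℝ)).injective).2 hA
  have h : specNorm A ≤ condNumber A * specNorm A := by
    conv_lhs => rw [← (pinv_spec A).mul_mul_self]
    rw [specNorm, map_mul, map_mul]
    exact (norm_mul_le _ _).trans (mul_le_mul_of_nonneg_right (norm_mul_le _ _) (norm_nonneg _))
  nlinarith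

theorem diag_le_specNorm (A : Matrix V V ℝ) (u : V) : A u u ≤ specNorm A := by
  refine abs_le_of_sq_le_sq' ?_ (specNorm_nonneg A) |>.2
  have h := mulVec_dot_le A (Pi.single u 1)
  have h2 := Finset.single_le_sum (f := fun i => (A *ᵥ Pi.single u 1) i * (A *ᵥ Pi.single u 1) i)
    (fun i _ => mul_self_nonneg _) (Finset.mem_univ u)
  have h3 : (A *ᵥ Pi.single u 1) u = A u u := by simp
  have h4 : (Pi.single u (1 : ℝ) : V → ℝ) ⬝ᵥ Pi.single u 1 = 1 := by simp
  rw [h4, mul_one] at h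
  rw [h3] at h2
  rw [sq]
  exact h2.trans h

variable {L : Matrix V V ℝ}

/-- A cluster that is left only by light edges forces a large condition number. -/
theorem IsEulerianLaplacian.trace_le (hL : IsEulerianLaplacian L) {Q : V → Prop} {τ : ℝ}
    (hτ0 : 0 ≤ τ) (hτ : ∀ a b, (Q a ↔ ¬ Q b) → -L a b ≤ τ) {u v : V} (huv : L u v ≠ 0)
    (hQ : Q u ↔ ¬ Q v) :
    ∑ a, L a a ≤ 2 * (Fintype.card V : ℝ) ^ 3 * τ * condNumber (L + Lᵀ) := by
  classical
  set n : ℝ := (Fintype.card V : ℝ) with hn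
  have hn1 : 1 ≤ n := by
    rw [hn]; exact_mod_cast Fintype.card_pos_iff.2 ⟨u⟩
  set A := L + Lᵀ with hA
  have hAs : Aᵀ = A := by rw [hA, transpose_add, transpose_transpose, add_comm]
  have hrow : ∀ a, ∑ b, A a b = 0 := fun a => by
    simp only [hA, Matrix.add_apply, transpose_apply, Finset.sum_add_distrib, hL.row, hL.col,
      add_zero]
  have h1 : ∑ a, L a a ≤ n * (specNorm A / 2) := by
    calc ∑ a, L a a ≤ ∑ _a : V, specNorm A / 2 := Finset.sum_le_sum fun a _ => by
          have := diag_le_specNorm A a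
          simp only [hA, Matrix.add_apply, transpose_apply] at this ⊢
          linarith
      _ = _ := by simp [hn]
  -- a lower bound for the pseudoinverse, by testing it on the crossing edge
  set z : V → ℝ := fun a => if Q a then 1 else 0 with hz
  set w : V → ℝ := Pi.single u 1 - Pi.single v 1 with hw
  have hw1 : A *ᵥ (pinv A *ᵥ w) = w := by
    refine mulVec_pinv_mulVec _ _ fun y hy => ?_
    have : form L y y = 0 := by
      rw [hA, form_add_transpose] at hy; linarith
    have := hL.const_of_form_eq_zero this huv
    simp [hw, sub_dotProduct, this]
  have hzw : (z ⬝ᵥ w) ^ 2 = 1 := by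
    have : z ⬝ᵥ w = z u - z v := by simp [hw, dotProduct_sub]
    rw [this]
    by_cases hu : Q u <;> by_cases hv : Q v <;> simp_all
  have hww : w ⬝ᵥ w ≤ 2 := by
    have huv' : u ≠ v := by
      rintro rfl
      by_cases hu : Q u <;> simp_all
    have : w ⬝ᵥ w = w u - w v := by simp [hw]
    rw [this]
    simp [hw, huv', huv'.symm]
    norm_num
  have hAz : (A *ᵥ z) ⬝ᵥ (A *ᵥ z) ≤ n * (2 * n * τ) ^ 2 := by
    have : ∀ a, (A *ᵥ z) a * (A *ᵥ z) a ≤ (2 * n * τ) ^ 2 := by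
      intro a
      have e1 : (A *ᵥ z) a = ∑ b, A a b * (z b - z a) := by
        simp only [mul_sub, Finset.sum_sub_distrib, ← Finset.sum_mul, hrow, zero_mul, sub_zero]
        rfl
      have e2 : |(A *ᵥ z) a| ≤ 2 * n * τ := by
        rw [e1]
        calc _ ≤ ∑ _b : V, 2 * τ := (Finset.abs_sum_le_sum_abs _ _).trans
              (Finset.sum_le_sum fun b _ => ?_)
          _ = _ := by simp [hn]; ring
        by_cases hab : Q a ↔ ¬ Q b
        · have e3 := hτ a b hab
          have e4 := hτ b a (by tauto)
          have hne : a ≠ b := by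
            rintro rfl
            exact iff_not_self hab
          have e5 := hL.offDiag a b hne
          have e6 := hL.offDiag b a hne.symm
          have e7 : |z b - z a| = 1 := by
            by_cases hu : Q a <;> by_cases hv : Q b <;> simp [hz, hu, hv] at hab ⊢
          rw [abs_mul, e7, mul_one, abs_le]
          simp only [hA, Matrix.add_apply, transpose_apply]
          constructor <;> linarith
        · have e7 : z b - z a = 0 := by
            by_cases hu : Q a <;> by_cases hv : Q b <;> simp [hz, hu, hv] at hab ⊢
          rw [e7, mul_zero, abs_zero]
          positivity
      rw [← sq, ← sq_abs]
      exact pow_le_pow_left₀ (abs_nonneg _) e2 2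
    calc _ ≤ ∑ _a : V, (2 * n * τ) ^ 2 := Finset.sum_le_sum fun a _ => this a
      _ = _ := by simp [hn]
  have h2 : 1 ≤ 3 * n ^ 2 * τ * specNorm (pinv A) := by
    have e1 : z ⬝ᵥ w = (A *ᵥ z) ⬝ᵥ (pinv A *ᵥ w) := by
      conv_lhs => rw [← hw1, dotProduct_mulVec, ← mulVec_transpose, hAs]
    have e2 := dot_sq_le (A *ᵥ z) (pinv A *ᵥ w)
    rw [← e1, hzw] at e2
    have e3 : (pinv A *ᵥ w) ⬝ᵥ (pinv A *ᵥ w) ≤ specNorm (pinv A) ^ 2 * 2 :=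
      (mulVec_dot_le _ _).trans (mul_le_mul_of_nonneg_left hww (sq_nonneg _))
    have e4 := e2.trans (mul_le_mul hAz e3 (dot_self_nonneg _) (by positivity))
    have hp := specNorm_nonneg (pinv A)
    have e5 : n * (2 * n * τ) ^ 2 * (specNorm (pinv A) ^ 2 * 2)
        ≤ (3 * n ^ 2 * τ * specNorm (pinv A)) ^ 2 := by
      have : n ^ 3 ≤ n ^ 4 := pow_le_pow_right₀ hn1 (by norm_num)
      have h0 : 0 ≤ (τ * specNorm (pinv A)) ^ 2 := sq_nonneg _
      have h1 : 8 * n ^ 3 ≤ 9 * n ^ 4 := by nlinarith [pow_pos (by linarith : 0 < n) 4]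
      nlinarith [mul_le_mul_of_nonneg_right h1 h0]
    exact (one_le_sq_iff₀ (by positivity)).1 (e4.trans e5)
  have hs := specNorm_nonneg A
  calc ∑ a, L a a ≤ n * (specNorm A / 2) * 1 := by linarith
    _ ≤ n * (specNorm A / 2) * (3 * n ^ 2 * τ * specNorm (pinv A)) :=
        mul_le_mul_of_nonneg_left h2 (by positivity)
    _ = 3 / 2 * (n ^ 3 * τ * condNumber A) := by rw [condNumber]; ring
    _ ≤ 2 * (n ^ 3 * τ * condNumber A) := by
        have := specNorm_nonneg (pinv A)
        have : 0 ≤ n ^ 3 * τ * condNumber A := by rw [condNumber]; positivity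
        linarith
    _ = _ := by ring

/-- A Poincaré inequality on the vectors of mean zero bounds the pseudoinverse. -/
theorem specNorm_pinv_le {A : Matrix V V ℝ} (hA1 : A *ᵥ 1 = 0) {c : ℝ} (hc : 0 < c)
    (h : ∀ x : V → ℝ, ∑ i, x i = 0 → x ⬝ᵥ x ≤ c * form A x x) : specNorm (pinv A) ≤ c := by
  have hp := pinv_spec A
  refine specNorm_le hc.le fun w => ?_
  set x := pinv A *ᵥ w with hx
  have hx1 : ∑ i, x i = 0 := by
    have e1 : x = (pinv A * A) *ᵥ x := by
      rw [hx, mulVec_mulVec, hp.mul_mul_inv]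
    have e2 : ∑ i, x i = (1 : V → ℝ) ⬝ᵥ x := (one_dotProduct x).symm
    rw [e2, e1, dotProduct_mulVec, ← mulVec_transpose, hp.symm_right, ← mulVec_mulVec, hA1]
    simp
  have h1 := h x hx1
  have h2 : (A *ᵥ x) ⬝ᵥ (A *ᵥ x) ≤ w ⬝ᵥ w := by
    have e0 : A *ᵥ x = (A * pinv A) *ᵥ w := by rw [hx, mulVec_mulVec]
    have e1 : (A *ᵥ x) ⬝ᵥ (A *ᵥ x) = w ⬝ᵥ (A *ᵥ x) := by
      rw [e0]
      have : ((A * pinv A) *ᵥ w) ⬝ᵥ ((A * pinv A) *ᵥ w)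
          = w ⬝ᵥ ((A * pinv A) *ᵥ ((A * pinv A) *ᵥ w)) := by
        rw [dotProduct_mulVec w, ← mulVec_transpose, hp.symm_left]
      rw [this, mulVec_mulVec, ← Matrix.mul_assoc, hp.mul_mul_self]
    have e2 := dot_sq_le w (A *ᵥ x)
    rw [← e1] at e2
    rcases (dot_self_nonneg (A *ᵥ x)).eq_or_lt with h0 | h0
    · rw [← h0]; exact dot_self_nonneg _
    · rw [sq] at e2
      exact le_of_mul_le_mul_right e2 h0
  have h3 := dot_sq_le x (A *ᵥ x)
  have h4 : form A x x ^ 2 ≤ (x ⬝ᵥ x) * (w ⬝ᵥ w) :=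
    h3.trans (mul_le_mul_of_nonneg_left h2 (dot_self_nonneg _))
  have h5 : (x ⬝ᵥ x) * (x ⬝ᵥ x) ≤ (x ⬝ᵥ x) * (c ^ 2 * (w ⬝ᵥ w)) := by
    calc (x ⬝ᵥ x) * (x ⬝ᵥ x) ≤ (c * form A x x) ^ 2 := by
          rw [sq]; exact mul_self_le_mul_self (dot_self_nonneg _) h1
      _ ≤ _ := by rw [mul_pow]; nlinarith [sq_nonneg c]
  rcases (dot_self_nonneg x).eq_or_lt with h0 | h0
  · rw [← h0]; have := dot_self_nonneg w; positivity
  · exact le_of_mul_le_mul_left h5 h0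

/-- The diagonal dominates the entries of its row. -/
theorem IsEulerianLaplacian.abs_apply_le (hL : IsEulerianLaplacian L) (i j : V) :
    |L i j| ≤ L i i := by
  have hnn : ∀ k, k ≠ i → 0 ≤ -L i k := fun k hk => neg_nonneg.2 (hL.offDiag i k hk.symm)
  have hsum : L i i = ∑ k ∈ Finset.univ.erase i, -L i k := by
    rw [Finset.sum_neg_distrib, eq_neg_iff_add_eq_zero,
        Finset.add_sum_erase _ _ (Finset.mem_univ i),
      hL.row]
  by_cases h : i = j
  · subst h
    rw [abs_of_nonneg]
    rw [hsum]
    exact Finset.sum_nonneg fun k hk => hnn k (Finset.ne_of_mem_erase hk)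
  · rw [abs_of_nonpos (hL.offDiag i j h), hsum]
    exact Finset.single_le_sum (f := fun k => -L i k)
        (fun k hk => hnn k (Finset.ne_of_mem_erase hk))
      (Finset.mem_erase.2 ⟨Ne.symm h, Finset.mem_univ j⟩)

theorem form_single (L : Matrix V V ℝ) (i : V) :
    form L (Pi.single i 1) (Pi.single i 1) = L i i := by
  simp [form]

end Spectral

section ScaleCond

variable {ν : ℕ} {L : Matrix (Fin ν) (Fin ν) ℝ} {o : Fin ν}

theorem scaleMat_diag_le (hL : IsEulerianLaplacian L) {σ σ' : ℝ} (hσ' : 0 < σ') (h : σ' ≤ σ)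
    (i : Fin ν) : scaleMat L o σ σ' i i ≤ 2 * ν ^ 2 * σ := by
  have hν : (1 : ℝ) ≤ ν := by exact_mod_cast i.pos
  have hσ : 0 < σ := hσ'.trans_le h
  rw [← form_single (scaleMat L o σ σ') i, scaleMat, hL.form_contraction_self]
  set w : Fin ν → ℝ := Pi.single i 1 with hw
  have hw01 : ∀ a b, (w a - w b) ^ 2 ≤ 1 := by
    intro a b
    simp only [hw, Pi.single_apply]
    split_ifs <;> norm_num
  have h1 : ∀ u v, -L u v * (if rep L σ' u = rep L σ' v
      then (w (phi L o σ σ' u) - w (phi L o σ σ' v)) ^ 2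
      else (w (phi L o σ σ' u) - w o) ^ 2 + (w o - w (phi L o σ σ' v)) ^ 2) ≤ 2 * σ := by
    intro u v
    by_cases hr : rep L σ u = rep L σ v
    · have hr' : rep L σ' u = rep L σ' v := by
        rw [← rep_rep_of_le h u, hr, rep_rep_of_le h]
      rw [if_pos hr', phi_eq_of_rep_eq hr, sub_self]
      simp only [ne_eq, OfNat.ofNat_ne_zero, not_false_eq_true, zero_pow, mul_zero]
      positivity
    have huv : u ≠ v := fun h => hr (h ▸ rfl)
    have hc0 : 0 ≤ -L u v := neg_nonneg.2 (hL.offDiag u v huv)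
    have hc := le_of_rep_ne hr
    rw [mul_comm 2]
    refine mul_le_mul hc ?_ (by split_ifs <;> positivity) hσ.le
    split_ifs
    · linarith [hw01 (phi L o σ σ' u) (phi L o σ σ' v)]
    · linarith [hw01 (phi L o σ σ' u) o, hw01 o (phi L o σ σ' v)]
  calc _ ≤ 1 / 2 * ∑ _u : Fin ν, ∑ _v : Fin ν, 2 * σ + σ' * ∑ _i : Fin ν, 1 := by
        refine add_le_add (mul_le_mul_of_nonneg_left (Finset.sum_le_sum fun u _ =>
          Finset.sum_le_sum fun v _ => h1 u v) (by norm_num))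
          (mul_le_mul_of_nonneg_left (Finset.sum_le_sum fun i _ => hw01 _ _) hσ'.le)
    _ = ν ^ 2 * σ + σ' * ν := by simp; ring
    _ ≤ 2 * ν ^ 2 * σ := by
        have : σ' * ν ≤ σ * ν ^ 2 := mul_le_mul h (le_self_pow₀ hν (by norm_num)) (by positivity)
          hσ.le
        linarith

/-- The Poincaré inequality for the system of a scale: every vertex is joined to the ground by a
path of edges of weight at least the lower threshold `σ'`. -/
theorem scaleMat_poincare (hL : IsEulerianLaplacian L) {σ σ' : ℝ} (hσ' : 0 < σ') (h : σ' ≤ σ)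
    {x : Fin ν → ℝ} (hx : ∑ i, x i = 0) :
    x ⬝ᵥ x ≤ 8 * ν ^ 3 / σ' * form (scaleMat L o σ σ') x x := by
  have hν : (1 : ℝ) ≤ ν := by exact_mod_cast o.pos
  set E := form (scaleMat L o σ σ') x x with hE
  have hE0 : 0 ≤ E := (scaleMat_eulerian hL hσ'.le).form_nonneg _
  set D := Real.sqrt (2 * E / σ') with hD
  have hD0 : 0 ≤ D := Real.sqrt_nonneg _
  have hD2 : D ^ 2 = 2 * E / σ' := Real.sq_sqrt (by positivity)
  have key : ∀ a c : ℝ, σ' ≤ c → c * a ^ 2 ≤ 2 * E → |a| ≤ D := by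
    intro a c hc ha
    refine Real.le_sqrt_of_sq_le ?_
    rw [sq_abs, le_div_iff₀ hσ']
    nlinarith [sq_nonneg a]
  have h1 : ∀ i, |x i - x (phi L o σ σ' i)| ≤ D := fun i =>
    key _ σ' le_rfl (by
      have := hL.contraction_attach_le (o := o) (φ := phi L o σ σ') (q := rep L σ') hσ'.le x i
      rw [← scaleMat, ← hE] at this
      linarith)
  have h2 : ∀ u v, u ≠ v → σ' < -L u v → |x (phi L o σ σ' u) - x (phi L o σ σ' v)| ≤ D :=
    fun u v huv hc => key _ _ hc.le (by
      have := hL.contraction_edge_le (o := o) (φ := phi L o σ σ') (q := rep L σ') hσ'.le x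
        (rep_eq_of_reachable (SimpleGraph.Adj.reachable ⟨huv, Or.inl hc⟩))
      rwa [← scaleMat, ← hE] at this)
  have h3 : ∀ i, |x (phi L o σ σ' i) - x o| ≤ ν * D := by
    intro i
    have := abs_sub_le_of_reachable (G := heavy L σ') (z := fun u => x (phi L o σ σ' u)) (D := D)
      hD0 ?_ (reachable_rep L σ' i)
    · simpa [phi_rep_low h] using this
    · rintro a b ⟨hab, hc | hc⟩
      · exact h2 a b hab hc
      · rw [abs_sub_comm]; exact h2 b a hab.symm hc
  have h4 : ∀ i, (x i - x o) ^ 2 ≤ (2 * ν * D) ^ 2 := by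
    intro i
    rw [← sq_abs]
    refine pow_le_pow_left₀ (abs_nonneg _) ?_ 2
    have := abs_sub_le (x i) (x (phi L o σ σ' i)) (x o)
    have := h1 i
    have := h3 i
    nlinarith
  calc x ⬝ᵥ x ≤ x ⬝ᵥ x + ν * x o ^ 2 := by
        have : 0 ≤ (ν : ℝ) * x o ^ 2 := by positivity
        linarith
    _ = ∑ i, (x i - x o) ^ 2 := by
        simp only [sub_sq, Finset.sum_add_distrib, Finset.sum_sub_distrib, ← Finset.sum_mul,
          ← Finset.mul_sum, hx, dotProduct]
        simp [sq]
    _ ≤ ∑ _i : Fin ν, (2 * ν * D) ^ 2 := Finset.sum_le_sum fun i _ => h4 i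
    _ = _ := by simp [mul_pow, hD2]; ring

/-- The condition number of the system of a scale is governed by the ratio of the thresholds between
which it resolves the weights, whatever the weights outside of that range are. -/
theorem scaleMat_condNumber_le (hL : IsEulerianLaplacian L) {σ σ' : ℝ} (hσ' : 0 < σ')
    (h : σ' ≤ σ) :
    condNumber (scaleMat L o σ σ' + (scaleMat L o σ σ')ᵀ) ≤ 16 * ν ^ 6 * (σ / σ') := by
  have hν : (1 : ℝ) ≤ ν := by exact_mod_cast o.pos
  have hσ : 0 < σ := hσ'.trans_le h
  set M := scaleMat L o σ σ' with hM
  have hME : IsEulerianLaplacian M := scaleMat_eulerian hL hσ'.le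
  have h1 : specNorm (M + Mᵀ) ≤ 4 * ν ^ 3 * σ := by
    have := specNorm_le_of_entries (A := M + Mᵀ) (r := 4 * ν ^ 2 * σ) (by positivity) fun i j => by
      rw [Matrix.add_apply, transpose_apply]
      have e1 := hME.abs_apply_le i j
      have e2 := hME.abs_apply_le j i
      have e3 := scaleMat_diag_le (o := o) hL hσ' h i
      have e4 := scaleMat_diag_le (o := o) hL hσ' h j
      have := abs_add_le (M i j) (M j i)
      linarith
    refine this.trans (le_of_eq ?_)
    rw [Fintype.card_fin]; ring
  have h2 : specNorm (pinv (M + Mᵀ)) ≤ 4 * ν ^ 3 / σ' := by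
    refine specNorm_pinv_le ?_ (by positivity) fun x hx => ?_
    · rw [add_mulVec, hME.rowSum, hME.transpose.rowSum, add_zero]
    · rw [form_add_transpose]
      refine (scaleMat_poincare (o := o) hL hσ' h hx).trans (le_of_eq ?_)
      ring
  calc _ ≤ 4 * ν ^ 3 * σ * (4 * ν ^ 3 / σ') :=
        mul_le_mul h1 h2 (specNorm_nonneg _) (by positivity)
    _ = _ := by ring

theorem scaleMat_connected (hL : IsEulerianLaplacian L) {σ σ' : ℝ} (hσ' : 0 < σ') (h : σ' ≤ σ) :
    IsConnectedLaplacian (scaleMat L o σ σ') := by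
  intro y hy
  exact ⟨y o, scaleMat_const_of_form hL hσ' h (by rw [form, hy, dotProduct_zero])⟩

end ScaleCond

/-! ### Isolated vertices -/

section Restrict

/-- A vertex with diagonal entry zero is isolated. -/
theorem IsEulerianLaplacian.apply_eq_zero {V : Type*} [Fintype V] [DecidableEq V]
    {L : Matrix V V ℝ} (hL : IsEulerianLaplacian L) {u : V} (hu : L u u = 0) (v : V) :
    L u v = 0 ∧ L v u = 0 := by
  constructor
  · have := hL.abs_apply_le u v
    rw [hu] at this
    exact abs_nonpos_iff.1 this
  · have := hL.transpose.abs_apply_le u v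
    rw [transpose_apply, transpose_apply, hu] at this
    exact abs_nonpos_iff.1 this

/-- The demand `b`, made to sum to zero on every connected component. -/
def center {ν : ℕ} (L : Matrix (Fin ν) (Fin ν) ℝ) (b : Fin ν → ℝ) (i : Fin ν) : ℝ :=
  b i - push (rep L 0) b (rep L 0 i) / push (rep L 0) 1 (rep L 0 i)

theorem push_one_rep_pos {ν : ℕ} (L : Matrix (Fin ν) (Fin ν) ℝ) (i : Fin ν) :
    0 < push (rep L 0) 1 (rep L 0 i) := by
  refine Finset.sum_pos' (fun u _ => by split_ifs <;> simp) ⟨i, Finset.mem_univ _, by simp⟩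

/-- The centered demand is orthogonal to the functions that are constant on connected components. -/
theorem sum_center_mul {ν : ℕ} {L : Matrix (Fin ν) (Fin ν) ℝ} (b : Fin ν → ℝ) {w : Fin ν → ℝ}
    (hw : ∀ u, w (rep L 0 u) = w u) : ∑ i, center L b i * w i = 0 := by
  have h1 : ∑ i, push (rep L 0) b (rep L 0 i) / push (rep L 0) 1 (rep L 0 i) * w i
      = ∑ i, b i * w i := by
    set f : Fin ν → ℝ := fun j => push (rep L 0) b j / push (rep L 0) 1 j * w j with hf
    have e1 : ∀ i, push (rep L 0) b (rep L 0 i) / push (rep L 0) 1 (rep L 0 i) * w i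
        = (1 : Fin ν → ℝ) i * f (rep L 0 i) := fun i => by
      simp only [hf, hw, Pi.one_apply, one_mul]
    simp only [e1]
    rw [← dot_push, dotProduct]
    have e2 : ∀ j, f j * push (rep L 0) 1 j = w j * push (rep L 0) b j := by
      intro j
      by_cases hj : ∃ i, rep L 0 i = j
      · obtain ⟨i, rfl⟩ := hj
        have := push_one_rep_pos L i
        simp only [hf]
        field_simp
      · have : ∀ g : Fin ν → ℝ, push (rep L 0) g j = 0 := fun g =>
          Finset.sum_eq_zero fun u _ => if_neg fun h => hj ⟨u, h⟩
        rw [this, this, mul_zero, mul_zero]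
    simp only [e2]
    have := dot_push (rep L 0) w b
    rw [dotProduct] at this
    rw [this]
    simp only [hw]
  simp only [center, sub_mul, Finset.sum_sub_distrib, h1, sub_self]

variable {n ν : ℕ} {L : Matrix (Fin n) (Fin n) ℝ} {orig : Fin ν → Fin n}

theorem sum_eq_sum_orig (ho : Function.Injective orig) (f : Fin n → ℝ)
    (hf : ∀ u, u ∉ Set.range orig → f u = 0) : ∑ u, f u = ∑ i, f (orig i) :=
  (Fintype.sum_of_injective orig ho _ _ hf fun _ => rfl).symm

theorem IsEulerianLaplacian.submatrix (hL : IsEulerianLaplacian L)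
    (ho : Function.Injective orig) (hr : ∀ u, L u u ≠ 0 → u ∈ Set.range orig) :
    IsEulerianLaplacian (L.submatrix orig orig) where
  offDiag i j h := hL.offDiag _ _ fun h' => h (ho h')
  colSum := by
    ext j
    have := hL.col (orig j)
    rw [sum_eq_sum_orig ho _ fun u hu => (hL.apply_eq_zero (not_not.1 fun h => hu (hr u h)) _).1] at this
    simpa [vecMul, dotProduct] using this
  rowSum := by
    ext j
    have := hL.row (orig j)
    rw [sum_eq_sum_orig ho _ fun u hu => (hL.apply_eq_zero (not_not.1 fun h => hu (hr u h)) _).2] at this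
    simpa [mulVec, dotProduct] using this

theorem IsEulerianLaplacian.mulVec_orig (hL : IsEulerianLaplacian L)
    (ho : Function.Injective orig) (hr : ∀ u, L u u ≠ 0 → u ∈ Set.range orig) (x : Fin n → ℝ)
    (i : Fin ν) : (L.submatrix orig orig *ᵥ fun i => x (orig i)) i = (L *ᵥ x) (orig i) := by
  simp only [mulVec, dotProduct, submatrix_apply]
  rw [sum_eq_sum_orig ho _ fun u hu => by
    rw [(hL.apply_eq_zero (not_not.1 fun h => hu (hr u h)) _).2, zero_mul]]

theorem IsEulerianLaplacian.form_orig (hL : IsEulerianLaplacian L)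
    (ho : Function.Injective orig) (hr : ∀ u, L u u ≠ 0 → u ∈ Set.range orig) (x y : Fin n → ℝ) :
    form (L.submatrix orig orig) (fun i => x (orig i)) (fun i => y (orig i)) = form L x y := by
  simp only [form, dotProduct, hL.mulVec_orig ho hr]
  rw [sum_eq_sum_orig ho _ fun u hu => ?_]
  have : ∑ v, L u v * y v = 0 := Finset.sum_eq_zero fun v _ => by
    rw [(hL.apply_eq_zero (not_not.1 fun h => hu (hr u h)) _).1, zero_mul]
  change x u * ∑ v, L u v * y v = 0
  rw [this, mul_zero]

theorem IsEulerianLaplacian.nrm_orig (hL : IsEulerianLaplacian L)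
    (ho : Function.Injective orig) (hr : ∀ u, L u u ≠ 0 → u ∈ Set.range orig) (x : Fin n → ℝ) :
    nrm (L.submatrix orig orig) (fun i => x (orig i)) = nrm L x := by
  rw [nrm, nrm, hL.form_orig ho hr]

/-- The pseudoinverse first projects the right-hand side to the demands that sum to zero on the
connected components. -/
theorem IsEulerianLaplacian.mulVec_pinv_orig (hL : IsEulerianLaplacian L)
    (ho : Function.Injective orig) (hr : ∀ u, L u u ≠ 0 ↔ u ∈ Set.range orig) (b : Fin n → ℝ) :
    L.submatrix orig orig *ᵥ (fun i => (pinv L *ᵥ b) (orig i))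
      = center (L.submatrix orig orig) (fun i => b (orig i)) := by
  classical
  have hr' := fun u => (hr u).1
  have hL' := hL.submatrix ho hr'
  set L' := L.submatrix orig orig with hL'def
  -- the projected demand, extended by zero to the isolated vertices
  set c : Fin n → ℝ := fun u => if h : u ∈ Set.range orig then
    center L' (fun i => b (orig i)) h.choose else 0 with hc
  have hco : ∀ i, c (orig i) = center L' (fun i => b (orig i)) i := by
    intro i
    have h : orig i ∈ Set.range orig := ⟨i, rfl⟩
    simp only [hc, dif_pos h]
    rw [ho h.choose_spec]
  have hcz : ∀ u, u ∉ Set.range orig → c u = 0 := fun u hu => dif_neg hu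
  have hp := pinv_spec L
  have h1 : L *ᵥ (pinv L *ᵥ c) = c := by
    refine mulVec_pinv_mulVec _ _ fun w hw => ?_
    rw [dotProduct, sum_eq_sum_orig ho _ fun u hu => by rw [hcz u hu, zero_mul]]
    simp only [hco]
    rw [← hL.form_orig ho hr'] at hw
    exact sum_center_mul _ fun u =>
      rep_comp_of_form_eq_zero hL' le_rfl (w := fun i => w (orig i)) hw u
  have h2 : L *ᵥ (pinv L *ᵥ (b - c)) = 0 := by
    have e : ∀ i, (b - c) (orig i) = push (rep L' 0) (fun i => b (orig i)) (rep L' 0 i)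
        / push (rep L' 0) 1 (rep L' 0 i) := fun i => by
      rw [Pi.sub_apply, hco, center]; ring
    have h3 : form L (b - c) (b - c) = 0 := by
      rw [← hL.form_orig ho hr', hL'.form_self]
      refine mul_eq_zero_of_right _ (Finset.sum_eq_zero fun i _ => Finset.sum_eq_zero fun j _ => ?_)
      by_cases hij : rep L' 0 i = rep L' 0 j
      · rw [e, e, hij, sub_self]; simp
      · have h4 := le_of_rep_ne hij
        have h5 : i ≠ j := fun h => hij (h ▸ rfl)
        have h6 := hL'.offDiag i j h5
        have : L' i j = 0 := by linarith
        rw [this]; simp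
    rw [mulVec_mulVec, ← hp.symm_left, transpose_mul, ← mulVec_mulVec,
      hL.transpose_mulVec_eq_zero_of_form h3, mulVec_zero]
  ext i
  rw [hL.mulVec_orig ho hr', ← hco, ← congrFun h1 (orig i)]
  have : pinv L *ᵥ b = pinv L *ᵥ (b - c) + pinv L *ᵥ c := by rw [← mulVec_add, sub_add_cancel]
  rw [this, mulVec_add, h2, zero_add]

end Restrict

/-! ### Program logic -/

/-- The part of a state that is visible to a program, and the calls: everything but the time. -/
structure Mem where
  nat : ℕ → ℕ → ℕ
  real : ℕ → ℕ → ℝ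
  calls : List Call

namespace Mem

/-- The state with memory `μ` at time `t`. -/
def toState (μ : Mem) (t : ℕ) : State := ⟨μ.nat, μ.real, t, μ.calls⟩

/-- Writing `v` to cell `i` of the array `a` of naturals. -/
def setN (μ : Mem) (a i v : ℕ) : Mem :=
  { μ with nat := Function.update μ.nat a (Function.update (μ.nat a) i v) }

/-- Writing `v` to cell `i` of the array `a` of reals. -/
def setR (μ : Mem) (a i : ℕ) (v : ℝ) : Mem :=
  { μ with real := Function.update μ.real a (Function.update (μ.real a) i v) }

/-- The memory after a call to the solver. -/
def solved (O : Solver) (μ : Mem) : Mem :=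
  ⟨μ.nat, ((μ.toState 0).afterSolve O).real, ((μ.toState 0).afterSolve O).calls⟩

@[simp] theorem setN_nat (μ : Mem) (a i v b k : ℕ) :
    (μ.setN a i v).nat b k = if b = a then if k = i then v else μ.nat b k else μ.nat b k := by
  by_cases h : b = a
  · subst h
    by_cases h' : k = i <;> simp [setN, h']
  · simp [setN, h]

@[simp] theorem setN_real (μ : Mem) (a i v : ℕ) : (μ.setN a i v).real = μ.real := rfl

@[simp] theorem setN_calls (μ : Mem) (a i v : ℕ) : (μ.setN a i v).calls = μ.calls := rfl

@[simp] theorem setR_nat (μ : Mem) (a i : ℕ) (v : ℝ) : (μ.setR a i v).nat = μ.nat := rfl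

@[simp] theorem setR_calls (μ : Mem) (a i : ℕ) (v : ℝ) : (μ.setR a i v).calls = μ.calls := rfl

@[simp] theorem setR_real (μ : Mem) (a i : ℕ) (v : ℝ) (b k : ℕ) :
    (μ.setR a i v).real b k = if b = a then if k = i then v else μ.real b k else μ.real b k := by
  by_cases h : b = a
  · subst h
    by_cases h' : k = i <;> simp [setR, h']
  · simp [setR, h]

end Mem

/-- The value of an index expression. -/
@[simp] def NExp.val (μ : Mem) : NExp → ℕ
  | .lit k => k
  | .get a i => μ.nat a (i.val μ)
  | .add e f => e.val μ + f.val μ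
  | .sub e f => e.val μ - f.val μ

/-- The value of a real expression. -/
@[simp] def RExp.val (μ : Mem) : RExp → ℝ
  | .ofNat e => (e.val μ : ℝ)
  | .get a i => μ.real a (i.val μ)
  | .add e f => e.val μ + f.val μ
  | .sub e f => e.val μ - f.val μ
  | .mul e f => e.val μ * f.val μ
  | .div e f => e.val μ / f.val μ

/-- The truth of a test. -/
@[simp] def Test.sat (μ : Mem) : Test → Prop
  | .natLt e f => e.val μ < f.val μ
  | .natEq e f => e.val μ = f.val μ
  | .realLt e f => e.val μ < f.val μ
  | .realEq e f => e.val μ = f.val μ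
  | .not t => ¬ t.sat μ
  | .and t u => t.sat μ ∧ u.sat μ

theorem NExp.eval_toState (μ : Mem) (t : ℕ) (e : NExp) : e.eval (μ.toState t) = e.val μ := by
  induction e with
  | lit k => rfl
  | get a i ih => simp only [NExp.eval, NExp.val, ih]; rfl
  | add e f he hf => simp only [NExp.eval, NExp.val, he, hf]
  | sub e f he hf => simp only [NExp.eval, NExp.val, he, hf]

theorem RExp.eval_toState (μ : Mem) (t : ℕ) (e : RExp) : e.eval (μ.toState t) = e.val μ := by
  induction e with
  | ofNat e => simp only [RExp.eval, RExp.val, NExp.eval_toState]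
  | get a i => simp only [RExp.eval, RExp.val, NExp.eval_toState]; rfl
  | add e f he hf => simp only [RExp.eval, RExp.val, he, hf]
  | sub e f he hf => simp only [RExp.eval, RExp.val, he, hf]
  | mul e f he hf => simp only [RExp.eval, RExp.val, he, hf]
  | div e f he hf => simp only [RExp.eval, RExp.val, he, hf]

theorem Test.holds_toState (μ : Mem) (t : ℕ) (e : Test) : e.Holds (μ.toState t) ↔ e.sat μ := by
  induction e with
  | natLt e f => simp only [Test.Holds, Test.sat, NExp.eval_toState]
  | natEq e f => simp only [Test.Holds, Test.sat, NExp.eval_toState]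
  | realLt e f => simp only [Test.Holds, Test.sat, RExp.eval_toState]
  | realEq e f => simp only [Test.Holds, Test.sat, RExp.eval_toState]
  | not t ih => simp only [Test.Holds, Test.sat, ih]
  | and t u ht hu => simp only [Test.Holds, Test.sat, ht, hu]

namespace Program

open Classical in
/-- The effect of a loop-free program (loops are ignored). -/
@[simp] def run (O : Solver) : Program → Mem → Mem
  | skip, μ => μ
  | setNat a i e, μ => μ.setN a (i.val μ) (e.val μ)
  | setReal a i e, μ => μ.setR a (i.val μ) (e.val μ)
  | seq c d, μ => d.run O (c.run O μ)
  | ite t c d, μ => if t.sat μ then c.run O μ else d.run O μ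
  | loop _ _, μ => μ
  | solve, μ => μ.solved O

/-- Loop-free programs. -/
def straight : Program → Bool
  | seq c d => c.straight && d.straight
  | ite _ c d => c.straight && d.straight
  | loop _ _ => false
  | _ => true

/-- A bound for the number of steps of a loop-free program. -/
def cost : Program → ℕ
  | skip => 0
  | seq c d => c.cost + d.cost
  | ite _ c d => 1 + c.cost + d.cost
  | loop _ _ => 0
  | _ => 1

/-- The arrays of naturals that a program may write. -/
def modN : Program → List ℕ
  | setNat a _ _ => [a]
  | seq c d => c.modN ++ d.modN
  | ite _ c d => c.modN ++ d.modN
  | loop _ c => c.modN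
  | _ => []

/-- The arrays of reals that a program may write. -/
def modR : Program → List ℕ
  | setReal a _ _ => [a]
  | seq c d => c.modR ++ d.modR
  | ite _ c d => c.modR ++ d.modR
  | loop _ c => c.modR
  | solve => [6]
  | _ => []

/-- Whether a program may call the solver. -/
def solves : Program → Bool
  | seq c d => c.solves || d.solves
  | ite _ c d => c.solves || d.solves
  | loop _ c => c.solves
  | solve => true
  | _ => false

end Program

/-- `μ` and `μ'` agree on everything that the program `c` cannot change. -/
structure Frame (c : Program) (μ μ' : Mem) : Prop where
  nat : ∀ a, a ∉ c.modN → μ'.nat a = μ.nat a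
  real : ∀ a, a ∉ c.modR → μ'.real a = μ.real a
  calls : c.solves = false → μ'.calls = μ.calls

theorem Frame.refl (c : Program) (μ : Mem) : Frame c μ μ :=
  ⟨fun _ _ => rfl, fun _ _ => rfl, fun _ => rfl⟩

theorem Frame.trans {c : Program} {μ μ' μ'' : Mem} (h : Frame c μ μ') (h' : Frame c μ' μ'') :
    Frame c μ μ'' :=
  ⟨fun a ha => (h'.nat a ha).trans (h.nat a ha), fun a ha => (h'.real a ha).trans (h.real a ha),
    fun hc => (h'.calls hc).trans (h.calls hc)⟩

theorem Frame.mono {c d : Program} {μ μ' : Mem} (h : Frame c μ μ') (h1 : c.modN ⊆ d.modN)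
    (h2 : c.modR ⊆ d.modR) (h3 : d.solves = false → c.solves = false) : Frame d μ μ' :=
  ⟨fun a ha => h.nat a fun h' => ha (h1 h'), fun a ha => h.real a fun h' => ha (h2 h'),
    fun hc => h.calls (h3 hc)⟩

/-- A run leaves unchanged whatever the text of the program does not mention as a target. -/
theorem Exec.frame {O : Solver} {c : Program} {s s' : State} (h : Exec O c s s') :
    Frame c ⟨s.nat, s.real, s.calls⟩ ⟨s'.nat, s'.real, s'.calls⟩ := by
  induction h with
  | skip => exact Frame.refl _ _
  | setNat a i e s =>
    refine ⟨fun b hb => ?_, fun _ _ => rfl, fun _ => rfl⟩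
    simp only [Program.modN, List.mem_singleton] at hb
    simp [State.writeNat, State.tick, hb]
  | setReal a i e s =>
    refine ⟨fun _ _ => rfl, fun b hb => ?_, fun _ => rfl⟩
    simp only [Program.modR, List.mem_singleton] at hb
    simp [State.writeReal, State.tick, hb]
  | seq _ _ ih1 ih2 =>
    refine (ih1.mono ?_ ?_ ?_).trans (ih2.mono ?_ ?_ ?_) <;>
      simp +contextual [Program.modN, Program.modR, Program.solves]
  | iteTrue _ _ ih =>
    refine Frame.mono (c := _) ih ?_ ?_ ?_ <;>
      simp +contextual [Program.modN, Program.modR, Program.solves]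
  | iteFalse _ _ ih =>
    refine Frame.mono (c := _) ih ?_ ?_ ?_ <;>
      simp +contextual [Program.modN, Program.modR, Program.solves]
  | loopDone => exact ⟨fun _ _ => rfl, fun _ _ => rfl, fun _ => rfl⟩
  | loopStep _ _ _ ih1 ih2 =>
    refine Frame.trans (μ' := _) (ih1.mono ?_ ?_ ?_) ih2 <;>
      simp [Program.modN, Program.modR, Program.solves]
  | solve s =>
    refine ⟨fun _ _ => rfl, fun b hb => ?_, fun h => by simp [Program.solves] at h⟩
    simp only [Program.modR, List.mem_singleton] at hb
    simp [State.afterSolve, State.tick, hb]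

/-- Loop-free programs terminate, with the expected effect and within their cost. -/
theorem exec_run (O : Solver) : ∀ (c : Program), c.straight = true → ∀ (μ : Mem) (t : ℕ),
    ∃ t', t' ≤ t + c.cost ∧ Exec O c (μ.toState t) ((c.run O μ).toState t') := by
  intro c
  induction c with
  | skip => exact fun _ μ t => ⟨t, le_rfl, .skip _⟩
  | setNat a i e =>
    intro _ μ t
    refine ⟨t + 1, le_rfl, ?_⟩
    have := Exec.setNat (O := O) a i e (μ.toState t)
    rw [NExp.eval_toState, NExp.eval_toState] at this
    exact this
  | setReal a i e =>
    intro _ μ t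
    refine ⟨t + 1, le_rfl, ?_⟩
    have := Exec.setReal (O := O) a i e (μ.toState t)
    rw [NExp.eval_toState, RExp.eval_toState] at this
    exact this
  | seq c d ihc ihd =>
    intro h μ t
    simp only [Program.straight, Bool.and_eq_true] at h
    obtain ⟨t1, h1, e1⟩ := ihc h.1 μ t
    obtain ⟨t2, h2, e2⟩ := ihd h.2 (c.run O μ) t1
    exact ⟨t2, by simp only [Program.cost]; omega, .seq e1 e2⟩
  | ite b c d ihc ihd =>
    intro h μ t
    simp only [Program.straight, Bool.and_eq_true] at h
    by_cases hb : b.sat μ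
    · obtain ⟨t1, h1, e1⟩ := ihc h.1 μ (t + 1)
      refine ⟨t1, by simp only [Program.cost]; omega, ?_⟩
      rw [Program.run, if_pos hb]
      exact .iteTrue ((Test.holds_toState μ t b).2 hb) e1
    · obtain ⟨t1, h1, e1⟩ := ihd h.2 μ (t + 1)
      refine ⟨t1, by simp only [Program.cost]; omega, ?_⟩
      rw [Program.run, if_neg hb]
      exact .iteFalse (fun h' => hb ((Test.holds_toState μ t b).1 h')) e1
  | loop b c ih => intro h; simp [Program.straight] at h
  | solve => exact fun _ μ t => ⟨t + 1, le_rfl, .solve _⟩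

theorem frame_run (O : Solver) {c : Program} (hc : c.straight = true) (μ : Mem) :
    Frame c μ (c.run O μ) := by
  obtain ⟨t', -, h⟩ := exec_run O c hc μ 0
  exact h.frame

/-- Total correctness with a time bound: started with memory `μ`, the program `c` terminates
within `T` steps with a memory that satisfies `Q`. -/
def WP (O : Solver) (c : Program) (T : ℕ) (μ : Mem) (Q : Mem → Prop) : Prop :=
  ∀ t, ∃ μ' t', Exec O c (μ.toState t) (μ'.toState t') ∧ t' ≤ t + T ∧ Q μ'

namespace WP

variable {O : Solver} {c d : Program} {T T' : ℕ} {μ : Mem} {Q R : Mem → Prop}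

theorem mono (h : WP O c T μ Q) (hT : T ≤ T') (hQ : ∀ μ', Q μ' → R μ') : WP O c T' μ R :=
    fun t => by
  obtain ⟨μ', t', h1, h2, h3⟩ := h t
  exact ⟨μ', t', h1, by omega, hQ _ h3⟩

theorem frame (h : WP O c T μ Q) : WP O c T μ fun μ' => Frame c μ μ' ∧ Q μ' := fun t => by
  obtain ⟨μ', t', h1, h2, h3⟩ := h t
  exact ⟨μ', t', h1, h2, h1.frame, h3⟩

theorem seq (h : WP O c T μ R) (h' : ∀ μ', R μ' → WP O d T' μ' Q) :
    WP O (c.seq d) (T + T') μ Q := fun t => by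
  obtain ⟨μ1, t1, e1, l1, r1⟩ := h t
  obtain ⟨μ2, t2, e2, l2, r2⟩ := h' μ1 r1 t1
  exact ⟨μ2, t2, .seq e1 e2, by omega, r2⟩

theorem straight (hc : c.straight = true) (h : Q (c.run O μ)) : WP O c c.cost μ Q := fun t => by
  obtain ⟨t', h1, h2⟩ := exec_run O c hc μ t
  exact ⟨_, t', h2, h1, h⟩

/-- The rule for loops with a variant: `Inv k` says that at most `k` iterations remain. -/
theorem loop {b : Test} {Inv : ℕ → Mem → Prop} (h0 : ∀ μ, Inv 0 μ → ¬ b.sat μ)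
    (hstep : ∀ k μ, Inv (k + 1) μ → b.sat μ → WP O c T μ (Inv k))
    (hexit : ∀ k μ, Inv k μ → ¬ b.sat μ → Q μ) :
    ∀ (k : ℕ) (μ : Mem), Inv k μ → WP O (.loop b c) ((T + 1) * k + 1) μ Q := by
  intro k
  induction k with
  | zero =>
    intro μ hμ t
    exact ⟨μ, t + 1, .loopDone fun h => h0 μ hμ ((Test.holds_toState μ t b).1 h), by omega,
      hexit 0 μ hμ (h0 μ hμ)⟩
  | succ k ih =>
    intro μ hμ t
    by_cases hb : b.sat μ
    · obtain ⟨μ1, t1, e1, l1, r1⟩ := hstep k μ hμ hb (t + 1)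
      obtain ⟨μ2, t2, e2, l2, r2⟩ := ih μ1 r1 t1
      refine ⟨μ2, t2, .loopStep ((Test.holds_toState μ t b).2 hb) e1 e2, ?_, r2⟩
      have : (T + 1) * (k + 1) = (T + 1) * k + T + 1 := by ring
      omega
    · refine ⟨μ, t + 1, .loopDone fun h => hb ((Test.holds_toState μ t b).1 h), ?_, hexit _ μ hμ hb⟩
      have : (T + 1) * (k + 1) = (T + 1) * k + T + 1 := by ring
      omega

end WP

/-- `for v = 0, …, bound - 1 do c`, with the loop variable in cell `0` of the array `v`. -/
def forP (v : ℕ) (bound : NExp) (c : Program) : Program :=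
  .seq (.setNat v (.lit 0) (.lit 0))
    (.loop (.natLt (.get v (.lit 0)) bound)
      (.seq c (.setNat v (.lit 0) (.add (.get v (.lit 0)) (.lit 1)))))

/-- The rule for counting loops with a loop-free body: `Inv j` holds before iteration `j`, and does
not depend on the loop variable. -/
theorem WP.forP {O : Solver} {v : ℕ} {bound : NExp} {c : Program} (hc : c.straight = true)
    (hv : v ∉ c.modN) (n : ℕ) {μ₀ : Mem} (Inv : ℕ → Mem → Prop)
    (hb : ∀ μ, Frame (forP v bound c) μ₀ μ → bound.val μ = n)
    (hset : ∀ j μ x, Inv j μ → Inv j (μ.setN v 0 x)) (h0 : Inv 0 μ₀)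
    (hstep : ∀ j < n, ∀ μ, Frame (IllCond.forP v bound c) μ₀ μ → μ.nat v 0 = j → Inv j μ →
      Inv (j + 1) (c.run O μ)) :
    WP O (IllCond.forP v bound c) ((c.cost + 2) * n + 2) μ₀
      fun μ => Frame (IllCond.forP v bound c) μ₀ μ ∧ Inv n μ := by
  have hvmod : ∀ (μ : Mem) (x : ℕ), Frame (IllCond.forP v bound c) μ (μ.setN v 0 x) := fun μ x =>
    ⟨fun a ha => by
      have : a ≠ v := fun h => ha (by simp [IllCond.forP, Program.modN, h])
      funext k
      simp [this], fun _ _ => rfl, fun _ => rfl⟩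
  have hcmod : ∀ μ, Frame (IllCond.forP v bound c) μ (c.run O μ) := fun μ =>
    (frame_run O hc μ).mono (by simp [IllCond.forP, Program.modN])
      (by simp [IllCond.forP, Program.modR]) (by simp [IllCond.forP, Program.solves])
  have hT : (c.cost + 2) * n + 2 = 1 + ((c.cost + 1 + 1) * n + 1) := by ring
  rw [hT]
  refine WP.seq (R := fun μ => μ = μ₀.setN v 0 0) (WP.straight rfl rfl) ?_
  rintro μ rfl
  refine WP.loop
    (Inv := fun k μ => Frame (IllCond.forP v bound c) μ₀ μ ∧ μ.nat v 0 + k = n ∧ Inv (μ.nat v 0) μ)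
    ?_ ?_ ?_ n _ ?_
  · rintro μ ⟨hf, hk, -⟩
    simp only [Test.sat, NExp.val, hb μ hf]
    omega
  · rintro k μ ⟨hf, hk, hi⟩ -
    refine WP.straight (c := c.seq _) (by simp [Program.straight, hc]) ?_
    have h1 := hstep (μ.nat v 0) (by omega) μ hf rfl hi
    have h2 : (c.run O μ).nat v = μ.nat v := (frame_run O hc μ).nat v hv
    refine ⟨(hf.trans (hcmod μ)).trans (hvmod _ _), ?_, ?_⟩
    · simp [h2]; omega
    · simp only [Program.run, NExp.val, h2]
      have : ((c.run O μ).setN v 0 (μ.nat v 0 + 1)).nat v 0 = μ.nat v 0 + 1 := by simp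
      rw [this]
      exact hset _ _ _ h1
  · rintro k μ ⟨hf, hk, hi⟩ hlt
    simp only [Test.sat, NExp.val, hb μ hf, not_lt] at hlt
    have : μ.nat v 0 = n := by omega
    exact ⟨hf, this ▸ hi⟩
  · refine ⟨hvmod _ _, by simp, ?_⟩
    have : (μ₀.setN v 0 0).nat v 0 = 0 := by simp
    rw [this]
    exact hset _ _ _ h0

/-! ### The program -/

/- Use of the arrays. Cell `0` serves as a scalar variable where no index is mentioned.

Naturals:
* `0` sizes, `1` and `2` rows and columns of the input; `3`, `4`, `5` the system handed over;
* `10` number of vertices that are not isolated, `11` and `12` renumbering, `13` and `14` renumbered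
  rows and columns;
* `15` and `16` sources and targets of half-edges, `17` and `18` linked lists of half-edges;
* `20` loop variable, `21` to `26` breadth-first search;
* `30` connected components, `31` to `34` clusters at the four thresholds of a scale;
* `35` vertex map of a scale, `36` flag of the main loop, `37` targets of listed entries.

Reals:
* `0` values of the entries, `1` demand, `2` output; `3`, `4`, `5` values, right-hand side and error
  parameter handed over, `6` answer;
* `7` values of the cut entries;
* `10` threshold, initially the trace, `11` ratio of successive thresholds;
* `12` weights of half-edges, `13` and `14` sizes and demands of components, `15` centered demand,
  `16` threshold of the search. -/

/-- Cell `0` of an array of naturals, used as a scalar variable. -/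
abbrev nvar (a : ℕ) : NExp := .get a (.lit 0)

/-- Cell `0` of an array of reals, used as a scalar variable. -/
abbrev rvar (a : ℕ) : RExp := .get a (.lit 0)

/-- The variable of all counting loops. -/
abbrev ivar : NExp := nvar 20

/-- The number of entries of the input matrix. -/
abbrev mvar : NExp := .get 0 (.lit 1)

/-- The number of vertices that are not isolated. -/
abbrev nuvar : NExp := nvar 10

/-- Numbering of the vertices that are not isolated, by their diagonal entries: array `11` maps a
vertex to its number, array `12` maps a number to the vertex. -/
def compactBody : Program :=
  .ite (.natEq (.get 1 ivar) (.get 2 ivar))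
    (.seq (.setNat 11 (.get 1 ivar) nuvar)
      (.seq (.setNat 12 nuvar (.get 1 ivar)) (.setNat 10 (.lit 0) (.add nuvar (.lit 1)))))
    .skip

/-- The renumbered entries (arrays `13`, `14`), the trace (real array `10`), and every entry as two
half-edges `k + 1` and `m + (k + 1)`, with sources, targets and weights in the arrays `15`, `16`
and the real array `12`. -/
def entryBody : Program :=
  .seq (.setNat 13 ivar (.get 11 (.get 1 ivar)))
  (.seq (.setNat 14 ivar (.get 11 (.get 2 ivar)))
  (.seq (.setNat 15 (.add ivar (.lit 1)) (.get 13 ivar))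
  (.seq (.setNat 16 (.add ivar (.lit 1)) (.get 14 ivar))
  (.seq (.setReal 12 (.add ivar (.lit 1)) (.sub (.ofNat (.lit 0)) (.get 0 ivar)))
  (.seq (.setNat 15 (.add mvar (.add ivar (.lit 1))) (.get 14 ivar))
  (.seq (.setNat 16 (.add mvar (.add ivar (.lit 1))) (.get 13 ivar))
  (.seq (.setReal 12 (.add mvar (.add ivar (.lit 1))) (.sub (.ofNat (.lit 0)) (.get 0 ivar)))
    (.ite (.natEq (.get 13 ivar) (.get 14 ivar))
      (.setReal 10 (.lit 0) (.add (rvar 10) (.get 0 ivar))) .skip))))))))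

/-- Linked lists of the half-edges with a given source: heads in the array `18`, successors in the
array `17`, end of list `0`. -/
def linkBody : Program :=
  .seq (.setNat 17 (.add ivar (.lit 1)) (.get 18 (.get 15 (.add ivar (.lit 1)))))
    (.setNat 18 (.get 15 (.add ivar (.lit 1))) (.add ivar (.lit 1)))

/-- One step of a breadth-first search through the half-edges heavier than the real variable `16`:
scan the half-edge `26`, or else take the next vertex from the queue `22` (between the positions
`23` and `24`), or else try the next root `25`. Array `21` holds the labels, `0` if none. -/
def bfsBody : Program :=
  .ite (.not (.natEq (nvar 26) (.lit 0)))
    (.seq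
      (.ite (.and (.realLt (rvar 16) (.get 12 (nvar 26)))
          (.natEq (.get 21 (.get 16 (nvar 26))) (.lit 0)))
        (.seq (.setNat 21 (.get 16 (nvar 26)) (.get 21 (.get 15 (nvar 26))))
          (.seq (.setNat 22 (nvar 24) (.get 16 (nvar 26)))
            (.setNat 24 (.lit 0) (.add (nvar 24) (.lit 1)))))
        .skip)
      (.setNat 26 (.lit 0) (.get 17 (nvar 26))))
    (.ite (.natLt (nvar 23) (nvar 24))
      (.seq (.setNat 26 (.lit 0) (.get 18 (.get 22 (nvar 23))))
        (.setNat 23 (.lit 0) (.add (nvar 23) (.lit 1))))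
      (.ite (.natLt (nvar 25) nuvar)
        (.seq
          (.ite (.natEq (.get 21 (nvar 25)) (.lit 0))
            (.seq (.setNat 21 (nvar 25) (.add (nvar 25) (.lit 1)))
              (.seq (.setNat 22 (nvar 24) (nvar 25))
                (.setNat 24 (.lit 0) (.add (nvar 24) (.lit 1)))))
            .skip)
          (.setNat 25 (.lit 0) (.add (nvar 25) (.lit 1))))
        .skip))

/-- The representatives of the clusters at the threshold `thr` are stored in the array `tgt`. -/
def cluster (thr : RExp) (tgt : ℕ) : Program :=
  .seq (forP 20 nuvar (.setNat 21 ivar (.lit 0)))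
  (.seq (.seq (.setReal 16 (.lit 0) thr)
    (.seq (.setNat 23 (.lit 0) (.lit 0)) (.seq (.setNat 24 (.lit 0) (.lit 0))
      (.seq (.setNat 25 (.lit 0) (.lit 0)) (.setNat 26 (.lit 0) (.lit 0))))))
  (.seq (forP 20 (.add (.add mvar mvar) (.add nuvar nuvar)) bfsBody)
    (forP 20 nuvar (.setNat tgt ivar (.sub (.get 21 ivar) (.lit 1))))))

/-! ### Breadth-first search -/

section Search

variable {ν : ℕ} {O : Solver}

/-- The half-edges `1, …, M` with sources `sF`, targets `dF` and weights `wF` are stored in the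
memory, together with the linked lists of the half-edges with a given source. -/
structure Lists (M : ℕ) (sF dF : ℕ → Fin ν) (wF : ℕ → ℝ) (μ : Mem) : Prop where
  src : ∀ q, 1 ≤ q → q ≤ M → μ.nat 15 q = sF q
  dst : ∀ q, 1 ≤ q → q ≤ M → μ.nat 16 q = dF q
  wt : ∀ q, 1 ≤ q → q ≤ M → μ.real 12 q = wF q
  head_src : ∀ u : Fin ν, μ.nat 18 u ≠ 0 → μ.nat 18 u ≤ M ∧ sF (μ.nat 18 u) = u
  head_le : ∀ u : Fin ν, ∀ q, 1 ≤ q → q ≤ M → sF q = u → q ≤ μ.nat 18 u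
  next_lt : ∀ q, 1 ≤ q → q ≤ M → μ.nat 17 q < q
  next_src : ∀ q, 1 ≤ q → q ≤ M → μ.nat 17 q ≠ 0 → sF (μ.nat 17 q) = sF q
  next_le : ∀ q, 1 ≤ q → q ≤ M → ∀ q', 1 ≤ q' → q' < q → sF q' = sF q → q' ≤ μ.nat 17 q

theorem Lists.congr {M : ℕ} {sF dF : ℕ → Fin ν} {wF : ℕ → ℝ} {μ μ' : Mem}
    (h : Lists M sF dF wF μ) (h15 : μ'.nat 15 = μ.nat 15) (h16 : μ'.nat 16 = μ.nat 16)
    (h17 : μ'.nat 17 = μ.nat 17) (h18 : μ'.nat 18 = μ.nat 18) (h12 : μ'.real 12 = μ.real 12) :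
    Lists M sF dF wF μ' := by
  obtain ⟨h1, h2, h3, h4, h5, h6, h7, h8⟩ := h
  constructor <;> simpa only [h15, h16, h17, h18, h12]

/-- The half-edges that the search has yet to scan: those whose source is not among the first `h`
vertices of the queue `qu`, and those that remain in the list of the current vertex. -/
def unscanned (M : ℕ) (sF : ℕ → Fin ν) (qu : ℕ → ℕ) (h p : ℕ) : Finset ℕ :=
  letI := Classical.decPred fun q => ∀ i < h, (sF q : ℕ) = qu i → i + 1 = h ∧ q ≤ p
  (Finset.Icc 1 M).filter fun q => ∀ i < h, (sF q : ℕ) = qu i → i + 1 = h ∧ q ≤ p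

theorem mem_unscanned {M : ℕ} {sF : ℕ → Fin ν} {qu : ℕ → ℕ} {h p q : ℕ} :
    q ∈ unscanned M sF qu h p ↔ (1 ≤ q ∧ q ≤ M) ∧
      ∀ i < h, (sF q : ℕ) = qu i → i + 1 = h ∧ q ≤ p := by
  simp only [unscanned, Finset.mem_filter, Finset.mem_Icc]

/-- The invariant of the search, for labels `lab`, queue `qu`, queue positions `h ≤ tl`, next root
`sd` and current half-edge `p`. -/
structure Search (M : ℕ) (sF dF : ℕ → Fin ν) (wF : ℕ → ℝ) (τ : ℝ) (r : Fin ν → Fin ν)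
    (lab qu : ℕ → ℕ) (h tl sd p : ℕ) : Prop where
  h_le : h ≤ tl
  sd_le : sd ≤ ν
  qu_lt : ∀ i < tl, qu i < ν
  qu_lab : ∀ i < tl, lab (qu i) ≠ 0
  qu_inj : ∀ i < tl, ∀ j < tl, qu i = qu j → i = j
  lab_qu : ∀ v : Fin ν, lab v ≠ 0 → ∃ i < tl, qu i = v
  lab_eq : ∀ v : Fin ν, lab v ≠ 0 → lab v = r v + 1
  lab_sd : ∀ v < sd, lab v ≠ 0
  closed : ∀ i < h, ∀ q, 1 ≤ q → q ≤ M → (sF q : ℕ) = qu i → τ < wF q →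
    lab (dF q) ≠ 0 ∨ (i + 1 = h ∧ q ≤ p)
  cur : p ≠ 0 → p ≤ M ∧ 0 < h ∧ (sF p : ℕ) = qu (h - 1)

/-- What the search computes depends only on the graph. -/
structure SearchGraph (M : ℕ) (sF dF : ℕ → Fin ν) (wF : ℕ → ℝ) (τ : ℝ)
    (G : SimpleGraph (Fin ν)) (r : Fin ν → Fin ν) : Prop where
  reach : ∀ q, 1 ≤ q → q ≤ M → τ < wF q → r (sF q) = r (dF q)
  edge : ∀ u v, G.Adj u v → ∃ q, 1 ≤ q ∧ q ≤ M ∧ sF q = u ∧ dF q = v ∧ τ < wF q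
  rep_reach : ∀ u, G.Reachable (r u) u
  rep_le : ∀ u, r u ≤ u

variable {M : ℕ} {sF dF : ℕ → Fin ν} {wF : ℕ → ℝ} {τ : ℝ} {r : Fin ν → Fin ν}
  {lab qu : ℕ → ℕ} {h tl sd p : ℕ} {G : SimpleGraph (Fin ν)}

theorem Search.tl_le (S : Search M sF dF wF τ r lab qu h tl sd p) : tl ≤ ν := by
  have := Fintype.card_le_of_injective (fun i : Fin tl => (⟨qu i, S.qu_lt i i.2⟩ : Fin ν))
    fun i j hij => Fin.ext (S.qu_inj i i.2 j j.2 (by simpa using hij))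
  simpa using this

/-- The number of steps that the search may still take. -/
def searchMeasure (ν M : ℕ) (sF : ℕ → Fin ν) (qu : ℕ → ℕ) (h sd p : ℕ) : ℕ :=
  (unscanned M sF qu h p).card + (ν - h) + (ν - sd)

theorem unscanned_congr {qu' : ℕ → ℕ} (hq : ∀ i < h, qu' i = qu i) :
    unscanned M sF qu' h p = unscanned M sF qu h p := by
  ext q
  simp only [mem_unscanned]
  refine and_congr_right fun _ => forall₂_congr fun i hi => ?_
  rw [hq i hi]

/-- Enqueueing an unlabelled vertex. -/
theorem Search.push (S : Search M sF dF wF τ r lab qu h tl sd p) {v : Fin ν} (hv : lab v = 0) :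
    Search M sF dF wF τ r (Function.update lab v (r v + 1)) (Function.update qu tl v) h (tl + 1) sd
        p := by
  have hq : ∀ i < tl, Function.update qu tl (v : ℕ) i = qu i := fun i hi => by
    rw [Function.update_of_ne (by omega)]
  have hne : ∀ i < tl, qu i ≠ v := fun i hi hiv => S.qu_lab i hi (hiv ▸ hv)
  have hlab : ∀ k, lab k ≠ 0 → Function.update lab (v : ℕ) (r v + 1) k ≠ 0 := fun k hk => by
    by_cases hkv : k = v
    · simp [hkv]
    · rwa [Function.update_of_ne hkv]
  have hlt := S.h_le
  refine ⟨by omega, S.sd_le, ?_, ?_, ?_, ?_, ?_, fun k hk => hlab k (S.lab_sd k hk), ?_, ?_⟩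
  · intro i hi
    rcases Nat.lt_succ_iff_lt_or_eq.1 hi with hi | rfl
    · rw [hq i hi]; exact S.qu_lt i hi
    · simp
  · intro i hi
    rcases Nat.lt_succ_iff_lt_or_eq.1 hi with hi | rfl
    · rw [hq i hi]; exact hlab _ (S.qu_lab i hi)
    · simp
  · intro i hi j hj hij
    rcases Nat.lt_succ_iff_lt_or_eq.1 hi with hi | rfl <;>
      rcases Nat.lt_succ_iff_lt_or_eq.1 hj with hj | rfl
    · rw [hq i hi, hq j hj] at hij; exact S.qu_inj i hi j hj hij
    · rw [hq i hi] at hij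
      exact (hne i hi (by simpa using hij)).elim
    · rw [hq j hj] at hij
      exact (hne j hj (by simpa using hij.symm)).elim
    · rfl
  · intro w hw
    by_cases hwv : w = v
    · exact ⟨tl, by omega, by simp [hwv]⟩
    · rw [Function.update_of_ne (fun h => hwv (Fin.ext h))] at hw
      obtain ⟨i, hi, hiw⟩ := S.lab_qu w hw
      exact ⟨i, by omega, by rw [hq i hi, hiw]⟩
  · intro w hw
    by_cases hwv : w = v
    · simp [hwv]
    · rw [Function.update_of_ne (fun h => hwv (Fin.ext h))] at hw ⊢
      exact S.lab_eq w hw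
  · intro i hi q h1 h2 h3 h4
    rw [hq i (by omega)] at h3
    exact (S.closed i hi q h1 h2 h3 h4).imp_left (hlab _)
  · intro hp
    obtain ⟨h1, h2, h3⟩ := S.cur hp
    exact ⟨h1, h2, by rw [hq _ (by omega), h3]⟩

/-- Passing to the next half-edge in the list of the current vertex. -/
theorem Search.next (S : Search M sF dF wF τ r lab qu h tl sd p) (hp : p ≠ 0)
    (hlab : τ < wF p → lab (dF p) ≠ 0) {p' : ℕ} (hp' : p' < p) (hs : p' ≠ 0 → sF p' = sF p)
    (hle : ∀ q', 1 ≤ q' → q' < p → sF q' = sF p → q' ≤ p') :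
    Search M sF dF wF τ r lab qu h tl sd p' ∧
      searchMeasure ν M sF qu h sd p' < searchMeasure ν M sF qu h sd p := by
  obtain ⟨h1, h2, h3⟩ := S.cur hp
  refine ⟨⟨S.h_le, S.sd_le, S.qu_lt, S.qu_lab, S.qu_inj, S.lab_qu, S.lab_eq, S.lab_sd, ?_, ?_⟩, ?_⟩
  · intro i hi q hq1 hq2 hq3 hq4
    rcases S.closed i hi q hq1 hq2 hq3 hq4 with hl | ⟨hi1, hqp⟩
    · exact Or.inl hl
    · rcases hqp.eq_or_lt with rfl | hlt
      · exact Or.inl (hlab hq4)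
      · have hi2 : i = h - 1 := by omega
        exact Or.inr ⟨hi1, hle q hq1 hlt (Fin.ext (by rw [hq3, h3, hi2]))⟩
  · intro h0
    exact ⟨by omega, h2, by rw [hs h0, h3]⟩
  · have : unscanned M sF qu h p' ⊂ unscanned M sF qu h p := by
      refine (Finset.ssubset_iff_of_subset ?_).2 ⟨p, ?_, ?_⟩
      · intro q hq
        rw [mem_unscanned] at hq ⊢
        refine ⟨hq.1, fun i hi he => ?_⟩
        obtain ⟨a, b⟩ := hq.2 i hi he
        exact ⟨a, by omega⟩
      · rw [mem_unscanned]
        refine ⟨⟨by omega, h1⟩, fun i hi he => ⟨?_, le_rfl⟩⟩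
        have hl := S.h_le
        have := S.qu_inj i (by omega) (h - 1) (by omega) (by rw [← he, h3])
        omega
      · rw [mem_unscanned]
        intro hq
        have := (hq.2 (h - 1) (by omega) h3).2
        omega
    have := Finset.card_lt_card this
    simp only [searchMeasure]
    omega

/-- Taking the next vertex from the queue. -/
theorem Search.dequeue (S : Search M sF dF wF τ r lab qu h tl sd 0) (hlt : h < tl) {p' : ℕ}
    (hs : p' ≠ 0 → p' ≤ M ∧ (sF p' : ℕ) = qu h)
    (hle : ∀ q', 1 ≤ q' → q' ≤ M → (sF q' : ℕ) = qu h → q' ≤ p') :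
    Search M sF dF wF τ r lab qu (h + 1) tl sd p' ∧
      searchMeasure ν M sF qu (h + 1) sd p' < searchMeasure ν M sF qu h sd 0 := by
  have htl := S.tl_le
  refine ⟨⟨hlt, S.sd_le, S.qu_lt, S.qu_lab, S.qu_inj, S.lab_qu, S.lab_eq, S.lab_sd, ?_, ?_⟩, ?_⟩
  · intro i hi q hq1 hq2 hq3 hq4
    rcases Nat.lt_succ_iff_lt_or_eq.1 hi with hi | rfl
    · rcases S.closed i hi q hq1 hq2 hq3 hq4 with h | ⟨-, h'⟩
      · exact Or.inl h
      · omega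
    · exact Or.inr ⟨rfl, hle q hq1 hq2 hq3⟩
  · intro h0
    obtain ⟨a, b⟩ := hs h0
    exact ⟨a, by omega, by simpa using b⟩
  · have : unscanned M sF qu (h + 1) p' ⊆ unscanned M sF qu h 0 := by
      intro q hq
      rw [mem_unscanned] at hq ⊢
      refine ⟨hq.1, fun i hi he => ?_⟩
      obtain ⟨a, b⟩ := hq.2 i (by omega) he
      omega
    have := Finset.card_le_card this
    simp only [searchMeasure]
    omega

/-- When nothing remains to be scanned, the labelled vertices form a union of clusters. -/
theorem Search.labelled_of_reachable (S : Search M sF dF wF τ r lab qu tl tl sd 0)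
    (hG : SearchGraph M sF dF wF τ G r) {u v : Fin ν} (huv : G.Reachable u v) (hu : lab u ≠ 0) :
    lab v ≠ 0 := by
  obtain ⟨w⟩ := huv
  induction w with
  | nil => exact hu
  | @cons a b c hab w ih =>
    refine ih ?_
    obtain ⟨q, h1, h2, h3, h4, h5⟩ := hG.edge a b hab
    obtain ⟨i, hi, hia⟩ := S.lab_qu a hu
    rcases S.closed i hi q h1 h2 (by rw [h3, hia]) h5 with h | ⟨-, h⟩
    · rwa [h4] at h
    · omega

/-- An unlabelled root is the least vertex of its cluster. -/
theorem Search.root (S : Search M sF dF wF τ r lab qu tl tl sd 0)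
    (hG : SearchGraph M sF dF wF τ G r) {v : Fin ν} (hv : (v : ℕ) = sd) (h0 : lab v = 0) :
    r v = v := by
  refine le_antisymm (hG.rep_le v) ?_
  by_contra hlt
  push Not at hlt
  exact S.labelled_of_reachable hG (hG.rep_reach v) (S.lab_sd _ (hv ▸ hlt)) h0

/-- Passing to the next root. -/
theorem Search.seed (S : Search M sF dF wF τ r lab qu h tl sd p) (hsd : sd < ν)
    (hlab : lab sd ≠ 0) :
    Search M sF dF wF τ r lab qu h tl (sd + 1) p ∧
      searchMeasure ν M sF qu h (sd + 1) p < searchMeasure ν M sF qu h sd p := by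
  refine ⟨⟨S.h_le, hsd, S.qu_lt, S.qu_lab, S.qu_inj, S.lab_qu, S.lab_eq, ?_, S.closed, S.cur⟩, ?_⟩
  · intro v hv
    rcases Nat.lt_succ_iff_lt_or_eq.1 hv with hv | rfl
    · exact S.lab_sd v hv
    · exact hlab
  · simp only [searchMeasure]
    omega

theorem Search.finished (S : Search M sF dF wF τ r lab qu h tl sd p)
    (hm : searchMeasure ν M sF qu h sd p = 0) : p = 0 ∧ h = tl ∧ sd = ν := by
  have htl := S.tl_le
  have hh := S.h_le
  have hsd := S.sd_le
  simp only [searchMeasure] at hm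
  refine ⟨?_, by omega, by omega⟩
  by_contra hp
  obtain ⟨h1, h2, h3⟩ := S.cur hp
  have : p ∈ unscanned M sF qu h p := by
    rw [mem_unscanned]
    refine ⟨⟨by omega, h1⟩, fun i hi he => ⟨?_, le_rfl⟩⟩
    have := S.qu_inj i (by omega) (h - 1) (by omega) (by rw [← he, h3])
    omega
  have := Finset.card_pos.2 ⟨p, this⟩
  omega

end Search

/-! ### Running the search -/

section SearchProgram

variable {ν : ℕ} {O : Solver} {M : ℕ} {sF dF : ℕ → Fin ν} {wF : ℕ → ℝ} {τ : ℝ}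
  {r : Fin ν → Fin ν} {G : SimpleGraph (Fin ν)}

theorem Mem.setN_nat_eq (μ : Mem) (a i v b : ℕ) :
    (μ.setN a i v).nat b = if b = a then Function.update (μ.nat a) i v else μ.nat b := by
  funext k
  by_cases h : b = a
  · subst h; simp [Mem.setN]
  · simp [h]

/-- The invariant of the search, read off from the memory. -/
def SearchMem (M : ℕ) (sF dF : ℕ → Fin ν) (wF : ℕ → ℝ) (τ : ℝ) (r : Fin ν → Fin ν) (μ : Mem) :
    Prop :=
  Search M sF dF wF τ r (μ.nat 21) (μ.nat 22) (μ.nat 23 0) (μ.nat 24 0) (μ.nat 25 0) (μ.nat 26 0)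

/-- The number of steps that the search may still take, read off from the memory. -/
def memMeasure (ν M : ℕ) (sF : ℕ → Fin ν) (μ : Mem) : ℕ :=
  searchMeasure ν M sF (μ.nat 22) (μ.nat 23 0) (μ.nat 25 0) (μ.nat 26 0)

/-- The search has ended: no half-edge is being scanned, the queue is empty, and all roots have been
tried. -/
def SearchDone (ν : ℕ) (μ : Mem) : Prop :=
  μ.nat 26 0 = 0 ∧ μ.nat 23 0 = μ.nat 24 0 ∧ μ.nat 25 0 = ν

/-- A step of the search keeps the invariant, and makes progress unless the search has ended. -/
theorem search_step (hG : SearchGraph M sF dF wF τ G r) {μ : Mem} (hl : Lists M sF dF wF μ)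
    (hν : μ.nat 10 0 = ν) (hτ : μ.real 16 0 = τ) (S : SearchMem M sF dF wF τ r μ) :
    SearchMem M sF dF wF τ r (bfsBody.run O μ) ∧
      (memMeasure ν M sF (bfsBody.run O μ) < memMeasure ν M sF μ ∨
        SearchDone ν (bfsBody.run O μ)) := by
  unfold SearchMem at S
  by_cases hp : μ.nat 26 0 = 0
  · by_cases hq : μ.nat 23 0 < μ.nat 24 0
    · have hu := S.qu_lt _ hq
      have hrun : bfsBody.run O μ = (μ.setN 26 0 (μ.nat 18 (μ.nat 22 (μ.nat 23 0)))).setN 23 0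
          (μ.nat 23 0 + 1) := by
        simp [bfsBody, hp, hq]
      rw [hp] at S
      have := S.dequeue hq (p' := μ.nat 18 (μ.nat 22 (μ.nat 23 0)))
        (fun h => by
          obtain ⟨h1, h2⟩ := hl.head_src ⟨_, hu⟩ h
          refine ⟨h1, ?_⟩
          simp only at h2
          rw [h2])
        (fun q h1 h2 h3 => hl.head_le ⟨_, hu⟩ q h1 h2 (Fin.ext h3))
      rw [hrun]
      simp only [SearchMem, memMeasure, Mem.setN_nat_eq]
      rw [hp]
      exact ⟨by simpa using this.1, Or.inl (by simpa using this.2)⟩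
    · have hq' : μ.nat 23 0 = μ.nat 24 0 := le_antisymm S.h_le (not_lt.1 hq)
      by_cases hs : μ.nat 25 0 < ν
      · by_cases hlab : μ.nat 21 (μ.nat 25 0) = 0
        · have hrun : bfsBody.run O μ = (((μ.setN 21 (μ.nat 25 0) (μ.nat 25 0 + 1)).setN 22
              (μ.nat 24 0) (μ.nat 25 0)).setN 24 0 (μ.nat 24 0 + 1)).setN 25 0
                  (μ.nat 25 0 + 1) := by
            simp [bfsBody, hp, hq, hν, hs, hlab]
          have hroot : r ⟨_, hs⟩ = ⟨_, hs⟩ := by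
            have S' := S
            rw [hq', hp] at S'
            exact S'.root hG rfl hlab
          have h1 := S.push (v := ⟨_, hs⟩) hlab
          rw [hroot] at h1
          have h2 := h1.seed hs (by simp)
          rw [hrun]
          simp only [SearchMem, memMeasure, Mem.setN_nat_eq]
          refine ⟨by simpa using h2.1, Or.inl ?_⟩
          have h3 : searchMeasure ν M sF (Function.update (μ.nat 22) (μ.nat 24 0) (μ.nat 25 0))
              (μ.nat 23 0) (μ.nat 25 0) (μ.nat 26 0)
              = searchMeasure ν M sF (μ.nat 22) (μ.nat 23 0) (μ.nat 25 0) (μ.nat 26 0) := by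
            simp only [searchMeasure]
            rw [unscanned_congr]
            intro i hi
            rw [Function.update_of_ne (by omega)]
          rw [← h3]
          simpa using h2.2
        · have hrun : bfsBody.run O μ = μ.setN 25 0 (μ.nat 25 0 + 1) := by
            simp [bfsBody, hp, hq, hν, hs, hlab]
          have h2 := S.seed hs hlab
          rw [hrun]
          simp only [SearchMem, memMeasure, Mem.setN_nat_eq]
          exact ⟨by simpa using h2.1, Or.inl (by simpa using h2.2)⟩
      · have hrun : bfsBody.run O μ = μ := by
          simp [bfsBody, hp, hq, hν, hs]
        rw [hrun]
        exact ⟨S, Or.inr ⟨hp, hq', le_antisymm S.sd_le (not_lt.1 hs)⟩⟩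
  · obtain ⟨hpM, hh, hsrc⟩ := S.cur hp
    have hp1 : 1 ≤ μ.nat 26 0 := Nat.one_le_iff_ne_zero.2 hp
    have e15 := hl.src _ hp1 hpM
    have e16 := hl.dst _ hp1 hpM
    have e12 := hl.wt _ hp1 hpM
    by_cases hc : τ < wF (μ.nat 26 0) ∧ μ.nat 21 (dF (μ.nat 26 0)) = 0
    · have hrun : bfsBody.run O μ = (((μ.setN 21 (dF (μ.nat 26 0))
        (μ.nat 21 (sF (μ.nat 26 0)))).setN 22
              (μ.nat 24 0) (dF (μ.nat 26 0))).setN 24 0 (μ.nat 24 0 + 1)).setN 26 0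
              (μ.nat 17 (μ.nat 26 0)) := by
        simp [bfsBody, hp, hτ, e15, e16, e12, hc]
      have hslab : μ.nat 21 (sF (μ.nat 26 0)) ≠ 0 := by
        rw [hsrc]
        have := S.h_le
        exact S.qu_lab _ (by omega)
      have e : μ.nat 21 (sF (μ.nat 26 0)) = r (dF (μ.nat 26 0)) + 1 := by
        rw [S.lab_eq _ hslab, hG.reach _ hp1 hpM hc.1]
      have h1 := S.push hc.2
      have h2 := h1.next hp (fun _ => by simp) (hl.next_lt _ hp1 hpM) (hl.next_src _ hp1 hpM)
        (hl.next_le _ hp1 hpM)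
      rw [hrun, e]
      simp only [SearchMem, memMeasure, Mem.setN_nat_eq]
      refine ⟨by simpa using h2.1, Or.inl ?_⟩
      have hle := S.h_le
      have h3 : searchMeasure ν M sF (Function.update (μ.nat 22) (μ.nat 24 0) (dF (μ.nat 26 0)))
          (μ.nat 23 0) (μ.nat 25 0) (μ.nat 26 0)
          = searchMeasure ν M sF (μ.nat 22) (μ.nat 23 0) (μ.nat 25 0) (μ.nat 26 0) := by
        simp only [searchMeasure]
        rw [unscanned_congr]
        intro i hi
        rw [Function.update_of_ne (by omega)]
      rw [← h3]
      simpa using h2.2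
    · have hrun : bfsBody.run O μ = μ.setN 26 0 (μ.nat 17 (μ.nat 26 0)) := by
        simp [bfsBody, hp, hτ, e16, e12, hc]
      have h2 := S.next hp (fun h => not_and.1 hc h) (hl.next_lt _ hp1 hpM)
        (hl.next_src _ hp1 hpM) (hl.next_le _ hp1 hpM)
      rw [hrun]
      simp only [SearchMem, memMeasure, Mem.setN_nat_eq]
      exact ⟨by simpa using h2.1, Or.inl (by simpa using h2.2)⟩

/-- The program `cluster` computes the representatives in linear time. The search is a single
counting loop, whose number of iterations bounds the measure at the start; iterations after the end
of the search have no effect. -/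
theorem WP.cluster {thr : RExp} {tgt : ℕ} {m : ℕ} {μ₀ : Mem}
    (hG : SearchGraph (2 * m) sF dF wF (thr.val μ₀) G r) (hl : Lists (2 * m) sF dF wF μ₀)
    (hm : μ₀.nat 0 1 = m) (hν : μ₀.nat 10 0 = ν)
    (hthr : ∀ μ, (∀ a, a ≠ 20 → a ≠ 21 → μ.nat a = μ₀.nat a) → μ.real = μ₀.real →
      thr.val μ = thr.val μ₀)
    (ht : 28 ≤ tgt) :
    WP O (IllCond.cluster thr tgt) (60 * (m + ν) + 20) μ₀
      fun μ => Frame (IllCond.cluster thr tgt) μ₀ μ ∧ ∀ i : Fin ν, μ.nat tgt i = r i := by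
  refine WP.frame ?_
  set τ := thr.val μ₀ with hτdef
  refine WP.mono (WP.seq (R := fun μ => Frame (IllCond.forP 20 nuvar (.setNat 21 ivar (.lit 0))) μ₀
      μ ∧
      ∀ i < ν, μ.nat 21 i = 0) ?_ ?_) (T := (1 + 2) * ν + 2 +
          (5 + ((15 + 2) * (2 * m + 2 * ν) + 2 + ((1 + 2) * ν + 2)))) (by omega) fun μ h => h
  · refine WP.forP (by decide) (by decide) ν (fun j μ => ∀ i < j, μ.nat 21 i = 0) ?_ ?_ ?_ ?_
    · intro μ hf
      simp only [NExp.val]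
      rw [hf.nat 10 (by decide), hν]
    · intro j μ x h i hi
      simp [h i hi]
    · intro i hi
      omega
    · intro j hj μ hf hi h i hij
      simp only [Program.run, NExp.val, hi, Mem.setN_nat]
      rcases Nat.lt_succ_iff_lt_or_eq.1 hij with hij | rfl
      · simp [h i hij]
      · simp
  rintro μ1 ⟨hf1, hlab1⟩
  have hl1 : Lists (2 * m) sF dF wF μ1 := hl.congr (hf1.nat _ (by decide)) (hf1.nat _ (by decide))
    (hf1.nat _ (by decide)) (hf1.nat _ (by decide)) (hf1.real _ (by decide))
  have hthr1 : thr.val μ1 = τ := hthr μ1 (fun a h20 h21 => hf1.nat a (by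
      simp [IllCond.forP, Program.modN, h20, h21])) (funext fun a => hf1.real a (by
      simp [IllCond.forP, Program.modR]))
  refine WP.seq (T := 5) (R := fun μ => Lists (2 * m) sF dF wF μ ∧ μ.nat 10 0 = ν ∧ μ.nat 0 1 = m ∧
    μ.real 16 0 = τ ∧ SearchMem (2 * m) sF dF wF τ r μ ∧ μ.nat 23 0 = 0 ∧ μ.nat 25 0 = 0)
    (WP.straight rfl ?_) ?_
  · have e0 : μ1.nat 0 = μ₀.nat 0 := hf1.nat _ (by decide)
    have e10 : μ1.nat 10 = μ₀.nat 10 := hf1.nat _ (by decide)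
    refine ⟨hl1.congr ?_ ?_ ?_ ?_ ?_, ?_, ?_, ?_, ?_, ?_, ?_⟩
    · funext k; simp
    · funext k; simp
    · funext k; simp
    · funext k; simp
    · funext k; simp
    · simp [e10, hν]
    · simp [e0, hm]
    · simp [hthr1]
    · simp only [SearchMem, Program.run, Mem.setN_nat_eq, NExp.val, Mem.setR_nat]
      constructor <;> simp
      · exact fun v => hlab1 v v.2
      · exact fun v hv => (hv (hlab1 v v.2)).elim
    · simp
    · simp
  rintro μ2 ⟨hl2, hν2, hm2, hτ2, hS2, h232, h252⟩
  -- after `j` iterations the search has ended, or the measure has dropped by `j`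
  refine WP.seq (R := fun μ => Frame (IllCond.forP 20 (.add (.add mvar mvar) (.add nuvar nuvar))
      bfsBody) μ2 μ ∧
      SearchMem (2 * m) sF dF wF τ r μ ∧ (SearchDone ν μ ∨
        memMeasure ν (2 * m) sF μ + (2 * m + 2 * ν) ≤ 2 * m + 2 * ν)) ?_ ?_
  · refine WP.forP (v := 20) (c := bfsBody) (by decide) (by decide) (2 * m + 2 * ν) (fun j μ =>
      SearchMem (2 * m) sF dF wF τ r μ ∧ (SearchDone ν μ ∨
        memMeasure ν (2 * m) sF μ + j ≤ 2 * m + 2 * ν)) ?_ ?_ ?_ ?_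
    · intro μ hf
      simp only [NExp.val]
      rw [hf.nat 10 (by decide), hf.nat 0 (by decide), hν2, hm2]
      omega
    · intro j μ x h
      simpa only [SearchMem, memMeasure, SearchDone, Mem.setN_nat_eq, Nat.reduceEqDiff, if_false]
          using h
    · refine ⟨hS2, Or.inr ?_⟩
      have : (unscanned (2 * m) sF (μ2.nat 22) 0 (μ2.nat 26 0)).card ≤ 2 * m := by
        have h := Finset.card_le_card (s := unscanned (2 * m) sF (μ2.nat 22) 0 (μ2.nat 26 0))
          (t := Finset.Icc 1 (2 * m)) fun q hq => Finset.mem_Icc.2 (mem_unscanned.1 hq).1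
        simpa using h
      simp only [memMeasure, searchMeasure, h232, h252]
      omega
    · intro j hj μ hf hi ⟨hS, hd⟩
      have hl' : Lists (2 * m) sF dF wF μ := hl2.congr (hf.nat _ (by decide)) (hf.nat _ (by decide))
        (hf.nat _ (by decide)) (hf.nat _ (by decide)) (hf.real _ (by decide))
      have hν' : μ.nat 10 0 = ν := by rw [hf.nat 10 (by decide), hν2]
      have hτ' : μ.real 16 0 = τ := by rw [hf.real 16 (by decide), hτ2]
      have hstep := search_step (O := O) hG hl' hν' hτ' hS
      refine ⟨hstep.1, ?_⟩
      rcases hd with ⟨hd1, hd2, hd3⟩ | hd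
      · left
        have hrun : bfsBody.run O μ = μ := by
          simp [bfsBody, hd1, hd2, hd3, hν']
        rw [hrun]
        exact ⟨hd1, hd2, hd3⟩
      · rcases hstep.2 with h | h
        · exact Or.inr (by omega)
        · exact Or.inl h
  rintro μ3 ⟨hf3, hS3, hd3⟩
  have hν3 : μ3.nat 10 0 = ν := by rw [hf3.nat 10 (by decide), hν2]
  have hdone : SearchDone ν μ3 := by
    rcases hd3 with h | h
    · exact h
    · exact Search.finished hS3 (by simp only [memMeasure] at h; omega)
  have hlab3 : ∀ v : Fin ν, μ3.nat 21 v = r v + 1 := fun v =>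
    hS3.lab_eq v (hS3.lab_sd v (by rw [hdone.2.2]; exact v.2))
  -- labels are representatives plus one, as `0` stands for unlabelled
  refine WP.mono (WP.forP (c := .setNat tgt ivar (.sub (.get 21 ivar) (.lit 1))) rfl ?_ ν
    (fun j μ => ∀ i : Fin ν, (i : ℕ) < j → μ.nat tgt i = r i) ?_ ?_ ?_ ?_) (le_of_eq ?_)
    fun μ h i => h.2 i i.2
  · simp only [Program.modN, List.mem_singleton]; omega
  · intro μ hf
    simp only [NExp.val]
    rw [hf.nat 10 (by
      simp only [IllCond.forP, Program.modN, List.mem_append, List.mem_singleton]; omega), hν3]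
  · intro j μ x h i hi
    have : tgt ≠ 20 := by omega
    simp [h i hi, this]
  · intro i hi
    omega
  · intro j hj μ hf hi h i hij
    have e21 : μ.nat 21 = μ3.nat 21 := hf.nat 21 (by
      simp only [IllCond.forP, Program.modN, List.mem_append, List.mem_singleton]; omega)
    simp only [Program.run, NExp.val, hi, Mem.setN_nat, if_true]
    by_cases hij' : (i : ℕ) = j
    · rw [if_pos hij', ← hij', e21, hlab3]
      rfl
    · rw [if_neg hij']
      exact h i (by omega)
  · rfl

end SearchProgram

/-! ### The compacted system in memory -/

/-- The system on the `ν` vertices that are not isolated in the input: vertex `i` of the system is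
vertex `orig i` of the input, and the `k`-th listed nonzero is `val k`, at `(row k, col k)`. -/
structure Setup (n m : ℕ) where
  ν : ℕ
  L : Matrix (Fin ν) (Fin ν) ℝ
  o : Fin ν
  orig : Fin ν → Fin n
  row : ℕ → Fin ν
  col : ℕ → Fin ν
  val : ℕ → ℝ
  o_val : (o : ℕ) = 0
  orig_inj : Function.Injective orig
  mat_eq : ∀ k < m, L (row k) (col k) = val k
  val_ne : ∀ k < m, val k ≠ 0
  surj : ∀ u v, L u v ≠ 0 → ∃ k < m, row k = u ∧ col k = v
  inj : ∀ k < m, ∀ k' < m, row k = row k' → col k = col k' → k = k'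

namespace Setup

variable {n m : ℕ} (S : Setup n m)

theorem o_le (v : Fin S.ν) : S.o ≤ v := by
  rw [Fin.le_def, S.o_val]
  exact Nat.zero_le _

theorem sum_eq (f : Fin S.ν → Fin S.ν → ℝ) :
    ∑ u, ∑ v, S.L u v * f u v = ∑ k ∈ Finset.range m, S.val k * f (S.row k) (S.col k) := by
  rw [← Fintype.sum_prod_type' (f := fun u v => S.L u v * f u v)]
  symm
  refine Finset.sum_of_injOn (fun k => (S.row k, S.col k)) ?_ ?_ ?_ ?_
  · intro k hk k' hk' h
    simp only [Finset.coe_range, Set.mem_Iio] at hk hk'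
    simp only [Prod.mk.injEq] at h
    exact S.inj k hk k' hk' h.1 h.2
  · intro k _
    simp
  · rintro ⟨u, v⟩ - h
    by_contra h0
    obtain ⟨k, hk, h1, h2⟩ := S.surj u v fun h' => h0 (by simp [h'])
    exact h ⟨k, by simpa using hk, by simp [h1, h2]⟩
  · intro k hk
    simp only [S.mat_eq k (Finset.mem_range.1 hk)]

/-- The sources of the half-edges: every listed entry gives one half-edge in each direction. -/
def src (q : ℕ) : Fin S.ν := if q ≤ m then S.row (q - 1) else S.col (q - m - 1)

/-- The targets of the half-edges. -/
def dst (q : ℕ) : Fin S.ν := if q ≤ m then S.col (q - 1) else S.row (q - m - 1)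

/-- The weights of the half-edges. -/
def wt (q : ℕ) : ℝ := if q ≤ m then -S.val (q - 1) else -S.val (q - m - 1)

theorem searchGraph {τ : ℝ} (hτ : 0 ≤ τ) :
    SearchGraph (2 * m) S.src S.dst S.wt τ (heavy S.L τ) (rep S.L τ) where
  reach q h1 h2 h := by
    have key : ∀ k < m, τ < -S.val k → rep S.L τ (S.row k) = rep S.L τ (S.col k) := by
      intro k hk h
      by_contra hne
      have := le_of_rep_ne hne
      rw [S.mat_eq k hk] at this
      linarith
    unfold src dst
    unfold wt at h
    split_ifs at h ⊢
    · exact key _ (by omega) h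
    · exact (key _ (by omega) h).symm
  edge u v := by
    rintro ⟨-, h | h⟩
    · obtain ⟨k, hk, h1, h2⟩ := S.surj u v fun h0 => by rw [h0] at h; linarith
      have h3 := S.mat_eq k hk
      rw [h1, h2] at h3
      exact ⟨k + 1, by omega, by omega, by simp [src, show k + 1 ≤ m from hk, h1],
        by simp [dst, show k + 1 ≤ m from hk, h2],
        by simpa [wt, show k + 1 ≤ m from hk, ← h3] using h⟩
    · obtain ⟨k, hk, h1, h2⟩ := S.surj v u fun h0 => by rw [h0] at h; linarith
      have h3 := S.mat_eq k hk
      rw [h1, h2] at h3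
      have e1 : ¬ m + k + 1 ≤ m := by omega
      have e2 : m + k + 1 - m - 1 = k := by omega
      exact ⟨m + k + 1, by omega, by omega, by simp only [src, e1, e2, h2, if_false],
        by simp only [dst, e1, e2, h1, if_false], by simpa only [wt, e1, e2, ← h3, if_false] using
            h⟩
  rep_reach u := (reachable_rep S.L τ u).symm
  rep_le u := IllCond.rep_le (SimpleGraph.Reachable.refl u)

/-- The system and its lists of half-edges are stored in the memory. -/
structure Static (μ : Mem) : Prop where
  n_eq : μ.nat 0 0 = n
  m_eq : μ.nat 0 1 = m
  ν_eq : μ.nat 10 0 = S.ν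
  orig_eq : ∀ i : Fin S.ν, μ.nat 12 i = S.orig i
  row_eq : ∀ k < m, μ.nat 13 k = S.row k
  col_eq : ∀ k < m, μ.nat 14 k = S.col k
  val_eq : ∀ k < m, μ.real 0 k = S.val k
  lists : Lists (2 * m) S.src S.dst S.wt μ

variable {S}

theorem Static.congr {μ μ' : Mem} (h : S.Static μ)
    (hn : ∀ a ∈ [0, 10, 12, 13, 14, 15, 16, 17, 18], μ'.nat a = μ.nat a)
    (hr : ∀ a ∈ [0, 12], μ'.real a = μ.real a) : S.Static μ' := by
  simp only [List.forall_mem_cons, List.not_mem_nil, false_imp_iff, implies_true, and_true] at hn hr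
  obtain ⟨h0, h10, h12, h13, h14, h15, h16, h17, h18⟩ := hn
  obtain ⟨g0, g12⟩ := hr
  obtain ⟨a1, a2, a3, a4, a5, a6, a7, a8⟩ := h
  exact ⟨by rw [h0, a1], by rw [h0, a2], by rw [h10, a3], by rwa [h12], by rwa [h13], by rwa [h14],
    by rwa [g0], a8.congr h15 h16 h17 h18 g12⟩

theorem Static.frame {c : Program} {μ μ' : Mem} (h : S.Static μ) (hf : Frame c μ μ')
    (hn : ∀ a ∈ [0, 10, 12, 13, 14, 15, 16, 17, 18], a ∉ c.modN)
    (hr : ∀ a ∈ [0, 12], a ∉ c.modR) : S.Static μ' :=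
  h.congr (fun a ha => hf.nat a (hn a ha)) fun a ha => hf.real a (hr a ha)

theorem Static.cluster {O : Solver} {μ : Mem} (h : S.Static μ) {thr : RExp} {tgt : ℕ} {τ : ℝ}
    (hτ : thr.val μ = τ) (h0 : 0 ≤ τ)
    (hthr : ∀ μ', μ'.real = μ.real → thr.val μ' = thr.val μ) (ht : 28 ≤ tgt) :
    WP O (IllCond.cluster thr tgt) (60 * (m + S.ν) + 20) μ
      fun μ' => Frame (IllCond.cluster thr tgt) μ μ' ∧ ∀ i : Fin S.ν,
          μ'.nat tgt i = rep S.L τ i := by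
  subst hτ
  exact WP.cluster (S.searchGraph h0) h.lists h.m_eq h.ν_eq (fun μ' _ => hthr μ') ht

end Setup

/-! ### Reading the input -/

theorem exists_count_eq {p : ℕ → Prop} [DecidablePred p] {i : ℕ} :
    ∀ {m : ℕ}, i < Nat.count p m → ∃ k < m, p k ∧ Nat.count p k = i
  | 0, h => by simp at h
  | m + 1, h => by
    by_cases hi : i < Nat.count p m
    · obtain ⟨k, hk, h1, h2⟩ := exists_count_eq hi
      exact ⟨k, by omega, h1, h2⟩
    · rw [Nat.count_succ] at h
      split_ifs at h with hp
      · exact ⟨m, by omega, hp, by omega⟩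
      · omega

/-- The memory at the start. -/
def inputMem {n m : ℕ} (L : Matrix (Fin n) (Fin n) ℝ)
    (e : Fin m ≃ {p : Fin n × Fin n // L p.1 p.2 ≠ 0}) (b : Fin n → ℝ) : Mem :=
  ⟨(inputState L e b).nat, (inputState L e b).real, []⟩

section Input

variable {n m : ℕ} {L : Matrix (Fin n) (Fin n) ℝ}

/-- The listed entry `k` is on the diagonal. -/
def IsDiag (e : Fin m ≃ {p : Fin n × Fin n // L p.1 p.2 ≠ 0}) (k : ℕ) : Prop :=
  ∃ h : k < m, (e ⟨k, h⟩).1.1 = (e ⟨k, h⟩).1.2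

open Classical in
/-- `S` describes the listed input: its vertices are those with a nonzero diagonal entry, in the
order in which these entries are listed. -/
structure Setup.Reads (S : Setup n m) (L : Matrix (Fin n) (Fin n) ℝ)
    (e : Fin m ≃ {p : Fin n × Fin n // L p.1 p.2 ≠ 0}) : Prop where
  mat : S.L = L.submatrix S.orig S.orig
  range : ∀ u, L u u ≠ 0 ↔ u ∈ Set.range S.orig
  count : S.ν = Nat.count (IsDiag e) m
  diag : ∀ i : Fin S.ν, ∃ k : Fin m, IsDiag e k ∧ Nat.count (IsDiag e) k = i ∧ (e k).1.1 = S.orig i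
  row : ∀ k : Fin m, S.orig (S.row k) = (e k).1.1
  col : ∀ k : Fin m, S.orig (S.col k) = (e k).1.2

open Classical in
/-- The vertices that are not isolated, numbered in the order of their diagonal entries. -/
theorem exists_setup (hL : IsEulerianLaplacian L) (h0 : L ≠ 0)
    (e : Fin m ≃ {p : Fin n × Fin n // L p.1 p.2 ≠ 0}) :
    ∃ S : Setup n m, S.Reads L e := by
  set p := IsDiag e with hp
  have h1 : ∀ i : Fin (Nat.count p m), ∃ k : Fin m, p k ∧ Nat.count p k = i := fun i => by
    obtain ⟨k, hk, h1, h2⟩ := exists_count_eq i.2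
    exact ⟨⟨k, hk⟩, h1, h2⟩
  choose kk hk1 hk2 using h1
  have hidx : ∀ u, L u u ≠ 0 → ∃ i, (e (kk i)).1.1 = u := by
    intro u hu
    set k := e.symm ⟨(u, u), hu⟩ with hk
    have hek : e k = ⟨(u, u), hu⟩ := by simp [hk]
    have hpk : p k := ⟨k.2, by simp [hek]⟩
    have hlt : Nat.count p k < Nat.count p m := Nat.count_strict_mono hpk k.2
    refine ⟨⟨_, hlt⟩, ?_⟩
    have := Nat.count_injective (hk1 ⟨_, hlt⟩) hpk (hk2 ⟨_, hlt⟩)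
    rw [Fin.ext this, hek]
  have hdiag : ∀ u v, L u v ≠ 0 → L u u ≠ 0 ∧ L v v ≠ 0 := fun u v h =>
    ⟨fun h' => h (hL.apply_eq_zero h' v).1, fun h' => h (hL.apply_eq_zero h' u).2⟩
  have hrow : ∀ k : Fin m, ∃ i, (e (kk i)).1.1 = (e k).1.1 := fun k => hidx _ (hdiag _ _ (e k).2).1
  have hcol : ∀ k : Fin m, ∃ i, (e (kk i)).1.1 = (e k).1.2 := fun k => hidx _ (hdiag _ _ (e k).2).2
  choose row hrow using hrow
  choose col hcol using hcol
  obtain ⟨u, v, huv⟩ : ∃ u v, L u v ≠ 0 := by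
    by_contra h
    push Not at h
    exact h0 (by ext u v; exact h u v)
  have hpos : 0 < Nat.count p m := (hidx u (hdiag u v huv).1).choose.pos
  set orig : Fin (Nat.count p m) → Fin n := fun i => (e (kk i)).1.1 with horig
  have horig_inj : Function.Injective orig := by
    intro i j hij
    obtain ⟨_, hi⟩ := hk1 i
    obtain ⟨_, hj⟩ := hk1 j
    have : kk i = kk j := e.injective (Subtype.ext (Prod.ext hij (by rw [← hi, ← hj]; exact hij)))
    exact Fin.ext (by rw [← hk2 i, ← hk2 j, this])
  set row' : ℕ → Fin (Nat.count p m) := fun k =>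
      if h : k < m then row ⟨k, h⟩ else ⟨0, hpos⟩ with hrow'
  set col' : ℕ → Fin (Nat.count p m) := fun k =>
      if h : k < m then col ⟨k, h⟩ else ⟨0, hpos⟩ with hcol'
  have hr : ∀ k : Fin m, orig (row' k) = (e k).1.1 := fun k => by simp [hrow', horig, hrow]
  have hc : ∀ k : Fin m, orig (col' k) = (e k).1.2 := fun k => by simp [hcol', horig, hcol]
  refine ⟨⟨_, L.submatrix orig orig, ⟨0, hpos⟩, orig, row', col',
    fun k => L (orig (row' k)) (orig (col' k)), rfl, horig_inj, fun k _ => rfl, fun k hk => ?_,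
    fun u v huv => ?_, fun k hk k' hk' h1 h2 => ?_⟩, ?_⟩
  · have := (e ⟨k, hk⟩).2
    rw [← hr ⟨k, hk⟩, ← hc ⟨k, hk⟩] at this
    exact this
  · set k := e.symm ⟨(orig u, orig v), huv⟩ with hk
    have hek : e k = ⟨(orig u, orig v), huv⟩ := by simp [hk]
    refine ⟨k, k.2, horig_inj ?_, horig_inj ?_⟩
    · rw [hr k, hek]
    · rw [hc k, hek]
  · have : (⟨k, hk⟩ : Fin m) = ⟨k', hk'⟩ := e.injective (Subtype.ext (Prod.ext
      (by rw [← hr ⟨k, hk⟩, ← hr ⟨k', hk'⟩]; exact congrArg orig h1)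
      (by rw [← hc ⟨k, hk⟩, ← hc ⟨k', hk'⟩]; exact congrArg orig h2)))
    exact congrArg Fin.val this
  · refine ⟨rfl, fun u => ⟨hidx u, ?_⟩, rfl, fun i => ⟨kk i, hk1 i, hk2 i, rfl⟩, hr, hc⟩
    rintro ⟨i, rfl⟩
    obtain ⟨_, hi⟩ := hk1 i
    have := (e (kk i)).2
    rw [← hi] at this
    exact this

end Input

/-- The input is read in three passes: vertices, entries, linked lists. -/
def readP : Program :=
  .seq (forP 20 mvar compactBody) (.seq (forP 20 mvar entryBody)
      (forP 20 (.add mvar mvar) linkBody))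

section Read

variable {n m : ℕ} {S : Setup n m} {L : Matrix (Fin n) (Fin n) ℝ}
  {e : Fin m ≃ {p : Fin n × Fin n // L p.1 p.2 ≠ 0}} {O : Solver} {μ₀ : Mem}

open Classical in
/-- The counter in array `10` runs through `Nat.count`: the diagonal entry `k` belongs to the vertex
whose number is the number of diagonal entries listed before it. -/
theorem WP.compact (hS : S.Reads L e) (hm : μ₀.nat 0 1 = m)
    (h1 : ∀ k : Fin m, μ₀.nat 1 k = (e k).1.1)
    (h2 : ∀ k : Fin m, μ₀.nat 2 k = (e k).1.2) (h10 : μ₀.nat 10 0 = 0) :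
    WP O (IllCond.forP 20 mvar compactBody) (6 * m + 2) μ₀ fun μ =>
      Frame (IllCond.forP 20 mvar compactBody) μ₀ μ ∧ μ.nat 10 0 = S.ν ∧
      (∀ i : Fin S.ν, μ.nat 12 i = S.orig i) ∧ ∀ i : Fin S.ν, μ.nat 11 (S.orig i) = i := by
  refine WP.mono (WP.forP (c := compactBody) rfl (by decide) m (fun j μ =>
    μ.nat 10 0 = Nat.count (IsDiag e) j ∧ ∀ k : Fin m, (k : ℕ) < j → IsDiag e k →
      μ.nat 12 (Nat.count (IsDiag e) k) = (e k).1.1 ∧ μ.nat 11 (e k).1.1 = Nat.count (IsDiag e) k)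
      ?_ ?_ ?_ ?_) (le_of_eq rfl) ?_
  · intro μ hf
    simp only [NExp.val]
    rw [hf.nat 0 (by decide), hm]
  · rintro j μ x ⟨ha, hb⟩
    exact ⟨by simp [ha], fun k hk hd => by simpa using hb k hk hd⟩
  · exact ⟨by simp [h10], fun k hk => by omega⟩
  · rintro j hj μ hf hv ⟨ha, hb⟩
    have e1 : μ.nat 1 j = (e ⟨j, hj⟩).1.1 := by rw [hf.nat 1 (by decide)]; exact h1 ⟨j, hj⟩
    have e2 : μ.nat 2 j = (e ⟨j, hj⟩).1.2 := by rw [hf.nat 2 (by decide)]; exact h2 ⟨j, hj⟩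
    have hd : IsDiag e j ↔ (μ.nat 1 j = μ.nat 2 j) := by
      rw [e1, e2]
      exact ⟨fun h => congrArg Fin.val h.2, fun h => ⟨hj, Fin.ext h⟩⟩
    by_cases hc : μ.nat 1 j = μ.nat 2 j
    · have hrun : compactBody.run O μ = ((μ.setN 11 (μ.nat 1 j) (Nat.count (IsDiag e) j)).setN 12
          (Nat.count (IsDiag e) j) (μ.nat 1 j)).setN 10 0 (Nat.count (IsDiag e) j + 1) := by
        simp [compactBody, hv, hc, ha]
      rw [hrun]
      have hdj := hd.2 hc
      refine ⟨by simp [Nat.count_succ, hdj], fun k hk hkd => ?_⟩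
      rcases Nat.lt_succ_iff_lt_or_eq.1 hk with hk | rfl
      · have hlt : Nat.count (IsDiag e) k < Nat.count (IsDiag e) j := Nat.count_strict_mono hkd hk
        have hne : ((e k).1.1 : ℕ) ≠ (e ⟨j, hj⟩).1.1 := by
          intro h
          obtain ⟨_, h3⟩ := hkd
          obtain ⟨_, h4⟩ := hdj
          have h5 := Fin.ext h
          have : k = ⟨j, hj⟩ := e.injective (Subtype.ext
              (Prod.ext h5 (by rw [← h3, ← h4]; exact h5)))
          rw [this] at hk
          exact lt_irrefl _ hk
        simpa [e1, hne, hlt.ne] using hb k hk hkd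
      · simp [e1]
    · have hrun : compactBody.run O μ = μ := by
        simp [compactBody, hv, hc]
      rw [hrun]
      refine ⟨by simp [Nat.count_succ, hd, hc, ha], fun k hk hkd => ?_⟩
      rcases Nat.lt_succ_iff_lt_or_eq.1 hk with hk | rfl
      · exact hb k hk hkd
      · exact (hc (hd.1 hkd)).elim
  · rintro μ ⟨hf, ha, hb⟩
    refine ⟨hf, by rw [ha, hS.count], fun i => ?_, fun i => ?_⟩ <;>
    · obtain ⟨k, hk1, hk2, hk3⟩ := hS.diag i
      have := hb k k.2 hk1
      rw [hk2, hk3] at this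
      first | exact this.1 | exact this.2

/-- The trace is summed up on the way: it is the total value of the entries whose row and column
agree. -/
theorem WP.entries (hS : S.Reads L e) (hm : μ₀.nat 0 1 = m)
    (h1 : ∀ k : Fin m, μ₀.nat 1 k = (e k).1.1)
    (h2 : ∀ k : Fin m, μ₀.nat 2 k = (e k).1.2)
    (hval : ∀ k < m, μ₀.real 0 k = S.val k)
    (h11 : ∀ i : Fin S.ν, μ₀.nat 11 (S.orig i) = i) (hW : μ₀.real 10 0 = 0) :
    WP O (IllCond.forP 20 mvar entryBody) (12 * m + 2) μ₀ fun μ =>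
      Frame (IllCond.forP 20 mvar entryBody) μ₀ μ ∧ 
      (∀ k < m, μ.nat 13 k = S.row k) ∧ (∀ k < m, μ.nat 14 k = S.col k) ∧
      (∀ q, 1 ≤ q → q ≤ 2 * m → μ.nat 15 q = S.src q) ∧
      (∀ q, 1 ≤ q → q ≤ 2 * m → μ.nat 16 q = S.dst q) ∧
      (∀ q, 1 ≤ q → q ≤ 2 * m → μ.real 12 q = S.wt q) ∧ μ.real 10 0 = ∑ u, S.L u u := by
  refine WP.mono (WP.forP (c := entryBody) rfl (by decide) m (fun j μ =>
    (∀ k < j, μ.nat 13 k = S.row k ∧ μ.nat 14 k = S.col k ∧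
      μ.nat 15 (k + 1) = S.row k ∧ μ.nat 16 (k + 1) = S.col k ∧ μ.real 12 (k + 1) = -S.val k ∧
      μ.nat 15 (m + (k + 1)) = S.col k ∧ μ.nat 16 (m + (k + 1)) = S.row k ∧
      μ.real 12 (m + (k + 1)) = -S.val k) ∧
      μ.real 10 0 = ∑ k ∈ Finset.range j, S.val k * if S.row k = S.col k then 1 else 0)
      ?_ ?_ ?_ ?_) (le_of_eq rfl) ?_
  · intro μ hf
    simp only [NExp.val]
    rw [hf.nat 0 (by decide), hm]
  · rintro j μ x ⟨ha, hb⟩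
    exact ⟨fun k hk => by simpa using ha k hk, by simpa using hb⟩
  · exact ⟨fun k hk => by omega, by simp [hW]⟩
  · rintro j hj μ hf hv ⟨ha, hb⟩
    have e1 : μ.nat 11 (μ.nat 1 j) = S.row j := by
      rw [hf.nat 1 (by decide), h1 ⟨j, hj⟩, ← hS.row ⟨j, hj⟩, hf.nat 11 (by decide), h11]
    have e2 : μ.nat 11 (μ.nat 2 j) = S.col j := by
      rw [hf.nat 2 (by decide), h2 ⟨j, hj⟩, ← hS.col ⟨j, hj⟩, hf.nat 11 (by decide), h11]
    have e0 : μ.nat 0 1 = m := by rw [hf.nat 0 (by decide), hm]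
    have e3 : μ.real 0 j = S.val j := by rw [hf.real 0 (by decide), hval j hj]
    refine ⟨fun k hk => ?_, ?_⟩
    · have hk' : k = j ∨ (k < j ∧ k ≠ j ∧ k + 1 ≠ m + (j + 1) ∧ m + (k + 1) ≠ j + 1) := by omega
      by_cases hc : S.row j = S.col j
      · rcases hk' with rfl | ⟨hk, hk', h3, h4⟩
        · simp [entryBody, hv, e1, e2, e0, e3, hc]
        · simpa [entryBody, hv, e1, e2, e0, e3, hc, hk', h3, h4] using ha k hk
      · have hc' : (S.row j : ℕ) ≠ S.col j := fun h => hc (Fin.ext h)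
        rcases hk' with rfl | ⟨hk, hk', h3, h4⟩
        · have h5 : m ≠ 0 := by omega
          simp [entryBody, hv, e1, e2, e0, e3, hc', h5]
        · simpa [entryBody, hv, e1, e2, e0, e3, hc', hk', h3, h4] using ha k hk
    · rw [Finset.sum_range_succ]
      by_cases hc : S.row j = S.col j
      · simp [entryBody, hv, e1, e2, e0, e3, hc, hb]
      · have hc' : (S.row j : ℕ) ≠ S.col j := fun h => hc (Fin.ext h)
        simp [entryBody, hv, e1, e2, e0, e3, hc', hc, hb]
  · rintro μ ⟨hf, ha, hb⟩
    refine ⟨hf, fun k hk => (ha k hk).1, fun k hk => (ha k hk).2.1, fun q h3 h4 => ?_,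
      fun q h3 h4 => ?_, fun q h3 h4 => ?_, ?_⟩
    iterate 3
      · by_cases hq : q ≤ m
        · have h := ha (q - 1) (by omega)
          rw [show q - 1 + 1 = q by omega] at h
          simp [Setup.src, Setup.dst, Setup.wt, hq, h]
        · have h := ha (q - m - 1) (by omega)
          rw [show m + (q - m - 1 + 1) = q by omega] at h
          simp [Setup.src, Setup.dst, Setup.wt, hq, h]
    · rw [hb, ← S.sum_eq (fun u v => if u = v then 1 else 0)]
      simp

/-- The half-edges are inserted in the order of their numbers, so the head of a list is its largest
element and the successors decrease. -/
theorem WP.link {ν : ℕ} {M : ℕ} {sF dF : ℕ → Fin ν} {wF : ℕ → ℝ} (hm : μ₀.nat 0 1 + μ₀.nat 0 1 = M)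
    (h1 : ∀ q, 1 ≤ q → q ≤ M → μ₀.nat 15 q = sF q) (h2 : ∀ q, 1 ≤ q → q ≤ M → μ₀.nat 16 q = dF q)
    (h3 : ∀ q, 1 ≤ q → q ≤ M → μ₀.real 12 q = wF q) (h18 : ∀ k, μ₀.nat 18 k = 0) :
    WP O (IllCond.forP 20 (.add mvar mvar) linkBody) (4 * M + 2) μ₀ fun μ =>
      Frame (IllCond.forP 20 (.add mvar mvar) linkBody) μ₀ μ ∧ Lists M sF dF wF μ := by
  refine WP.mono (WP.forP (c := linkBody) rfl (by decide) M (fun j μ => Lists j sF dF wF μ)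
      ?_ ?_ ?_ ?_) (le_of_eq rfl) fun _ h => h
  · intro μ hf
    simp only [NExp.val]
    rw [hf.nat 0 (by decide), hm]
  · intro j μ x h
    refine h.congr ?_ ?_ ?_ ?_ rfl <;> simp [Mem.setN_nat_eq]
  · constructor <;> intros <;> first | omega | (exact absurd (h18 _) ‹_›)
  · intro j hj μ hf hv h
    have e15 : μ.nat 15 = μ₀.nat 15 := hf.nat 15 (by decide)
    have e16 : μ.nat 16 = μ₀.nat 16 := hf.nat 16 (by decide)
    have e12 : μ.real 12 = μ₀.real 12 := hf.real 12 (by decide)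
    have es : μ.nat 15 (j + 1) = sF (j + 1) := by rw [e15, h1 _ (by omega) (by omega)]
    have hrun : linkBody.run O μ = (μ.setN 17 (j + 1) (μ.nat 18 (sF (j + 1)))).setN 18 (sF (j + 1))
        (j + 1) := by simp [linkBody, hv, es]
    rw [hrun]
    have hh : μ.nat 18 (sF (j + 1)) ≤ j := by
      by_contra hc
      have := (h.head_src (sF (j + 1)) (by omega)).1
      omega
    refine ⟨?_, ?_, ?_, ?_, ?_, ?_, ?_, ?_⟩
    · intro q hq1 hq2
      simpa [e15] using h1 q hq1 (by omega)
    · intro q hq1 hq2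
      simpa [e16] using h2 q hq1 (by omega)
    · intro q hq1 hq2
      simpa [e12] using h3 q hq1 (by omega)
    · intro u hu
      by_cases hc : u = sF (j + 1)
      · subst hc
        simp
      · have hc' : (u : ℕ) ≠ sF (j + 1) := fun h => hc (Fin.ext h)
        simp [hc'] at hu ⊢
        have := h.head_src u hu
        exact ⟨by omega, this.2⟩
    · intro u q hq1 hq2 hq3
      by_cases hc : u = sF (j + 1)
      · subst hc
        simpa using hq2
      · have hc' : (u : ℕ) ≠ sF (j + 1) := fun h => hc (Fin.ext h)
        have : q ≠ j + 1 := fun h => hc (by rw [← hq3, h])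
        simpa [hc'] using h.head_le u q hq1 (by omega) hq3
    · intro q hq1 hq2
      by_cases hc : q = j + 1
      · subst hc
        simp
        omega
      · simpa [hc] using h.next_lt q hq1 (by omega)
    · intro q hq1 hq2 hq3
      by_cases hc : q = j + 1
      · subst hc
        simp at hq3 ⊢
        exact (h.head_src _ hq3).2
      · simp [hc] at hq3 ⊢
        exact h.next_src q hq1 (by omega) hq3
    · intro q hq1 hq2 q' hq3 hq4 hq5
      by_cases hc : q = j + 1
      · subst hc
        simpa using h.head_le _ q' hq3 (by omega) hq5
      · simpa [hc] using h.next_le q hq1 (by omega) q' hq3 hq4 hq5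

/-- The input is read in time `O(m)`; every vertex that is not isolated has a diagonal entry. -/
theorem WP.readP (hS : S.Reads L e) (b : Fin n → ℝ) :
    WP O IllCond.readP (26 * m + 6) (inputMem L e b) fun μ =>
      Frame IllCond.readP (inputMem L e b) μ ∧ S.Static μ ∧ μ.real 10 0 = ∑ u, S.L u u := by
  have hval : ∀ k < m, (inputMem L e b).real 0 k = S.val k := by
    intro k hk
    rw [← S.mat_eq k hk, hS.mat, submatrix_apply, hS.row ⟨k, hk⟩, hS.col ⟨k, hk⟩]
    simp [inputMem, inputState, hk]
  have hm : (inputMem L e b).nat 0 1 = m := by simp [inputMem, inputState]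
  have hn : (inputMem L e b).nat 0 0 = n := by simp [inputMem, inputState]
  have h1 : ∀ k : Fin m, (inputMem L e b).nat 1 k = (e k).1.1 := by simp [inputMem, inputState]
  have h2 : ∀ k : Fin m, (inputMem L e b).nat 2 k = (e k).1.2 := by simp [inputMem, inputState]
  have h10 : (inputMem L e b).nat 10 0 = 0 := by simp [inputMem, inputState]
  have h18 : ∀ k, (inputMem L e b).nat 18 k = 0 := by simp [inputMem, inputState]
  have hW : (inputMem L e b).real 10 0 = 0 := by simp [inputMem, inputState]
  generalize inputMem L e b = μ₀ at *
  refine WP.frame (WP.mono (WP.seq (WP.compact hS hm h1 h2 h10) ?_)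
    (T := 6 * m + 2 + (12 * m + 2 + (4 * (2 * m) + 2))) (by omega) fun _ h => h)
  rintro μ1 ⟨hf1, a1, a2, a3⟩
  refine WP.seq (WP.entries hS ?_ ?_ ?_ ?_ a3 ?_) ?_
  · rw [hf1.nat 0 (by decide), hm]
  · rw [hf1.nat 1 (by decide)]; exact h1
  · rw [hf1.nat 2 (by decide)]; exact h2
  · rw [hf1.real 0 (by decide)]; exact hval
  · rw [hf1.real 10 (by decide), hW]
  rintro μ2 ⟨hf2, b1, b2, b3, b4, b5, b6⟩
  have e0 : μ2.nat 0 = μ₀.nat 0 := by rw [hf2.nat 0 (by decide), hf1.nat 0 (by decide)]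
  refine WP.mono (WP.link (M := 2 * m) ?_ b3 b4 b5 ?_) le_rfl ?_
  · rw [e0, hm]; omega
  · rw [hf2.nat 18 (by decide), hf1.nat 18 (by decide)]; exact h18
  rintro μ3 ⟨hf3, hl⟩
  refine ⟨⟨?_, ?_, ?_, ?_, ?_, ?_, ?_, hl⟩, ?_⟩
  · rw [hf3.nat 0 (by decide), e0, hn]
  · rw [hf3.nat 0 (by decide), e0, hm]
  · rw [hf3.nat 10 (by decide), hf2.nat 10 (by decide), a1]
  · rw [hf3.nat 12 (by decide), hf2.nat 12 (by decide)]; exact a2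
  · rw [hf3.nat 13 (by decide)]; exact b1
  · rw [hf3.nat 14 (by decide)]; exact b2
  · rw [hf3.real 0 (by decide), hf2.real 0 (by decide), hf1.real 0 (by decide)]; exact hval
  · rw [hf3.real 10 (by decide), b6]

end Read

/-! ### Centering the demand -/

/-- The power of a real expression. -/
def RExp.npow (e : RExp) : ℕ → RExp
  | 0 => .ofNat (.lit 1)
  | k + 1 => .mul (e.npow k) e

theorem RExp.val_npow (μ : Mem) (e : RExp) (k : ℕ) : (e.npow k).val μ = e.val μ ^ k := by
  induction k with
  | zero => simp [RExp.npow]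
  | succ k ih => rw [RExp.npow, RExp.val, ih, pow_succ]

/-- One more term of a sum that is accumulated by a loop over the vertices. -/
theorem sum_lt_succ {ν : ℕ} (f : Fin ν → ℝ) {j : ℕ} (hj : j < ν) :
    (∑ u : Fin ν, if (u : ℕ) < j + 1 then f u else 0) =
        (∑ u : Fin ν, if (u : ℕ) < j then f u else 0) + f ⟨j, hj⟩ := by
  have e : ∀ u : Fin ν, (if (u : ℕ) < j + 1 then f u else 0)
      = (if (u : ℕ) < j then f u else 0) + if u = ⟨j, hj⟩ then f u else 0 := by
    intro u
    simp only [Fin.ext_iff]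
    rcases lt_trichotomy (u : ℕ) j with h | h | h
    · simp [h, h.ne, h.trans (Nat.lt_succ_self j)]
    · simp [h]
    · simp [h.ne', h.not_gt, show ¬ (u : ℕ) < j + 1 by omega]
  simp only [e, Finset.sum_add_distrib]
  simp

/-- The numbers and the total demands of the vertices of the connected components. -/
def sumBody : Program :=
  .seq (.setReal 13 (.get 30 ivar) (.add (.get 13 (.get 30 ivar)) (.ofNat (.lit 1))))
    (.setReal 14 (.get 30 ivar) (.add (.get 14 (.get 30 ivar)) (.get 1 (.get 12 ivar))))

/-- The centered demand: the mean of the component of a vertex is subtracted. -/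
def centerBody : Program :=
  .setReal 15 ivar (.sub (.get 1 (.get 12 ivar))
      (.div (.get 14 (.get 30 ivar)) (.get 13 (.get 30 ivar))))

/-- The centered demand (real array `15`), the ratio `n ^ 40` of successive thresholds (real array
`11`), and the flag for another scale (array `36`). -/
def prepP : Program :=
  .seq (cluster (.ofNat (.lit 0)) 30)
  (.seq (forP 20 nuvar sumBody)
  (.seq (forP 20 nuvar centerBody)
  (.seq (.setReal 11 (.lit 0) (RExp.npow (.ofNat (.get 0 (.lit 0))) 40))
    (.setNat 36 (.lit 0) (.lit 1)))))

section Prep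

variable {n m : ℕ} {S : Setup n m} {O : Solver} {μ₀ : Mem}

theorem WP.sums (hS : S.Static μ₀) {r : Fin S.ν → Fin S.ν} (hr : ∀ i : Fin S.ν, μ₀.nat 30 i = r i)
    {b : Fin n → ℝ} (hb : ∀ u : Fin n, μ₀.real 1 u = b u) (h13 : ∀ k, μ₀.real 13 k = 0)
    (h14 : ∀ k, μ₀.real 14 k = 0) :
    WP O (IllCond.forP 20 nuvar sumBody) (4 * S.ν + 2) μ₀ fun μ =>
      Frame (IllCond.forP 20 nuvar sumBody) μ₀ μ ∧
      (∀ v : Fin S.ν, μ.real 13 v = push r 1 v) ∧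
      ∀ v : Fin S.ν, μ.real 14 v = push r (fun i => b (S.orig i)) v := by
  refine WP.mono (WP.forP (c := sumBody) rfl (by decide) S.ν (fun j μ =>
    (∀ v : Fin S.ν, μ.real 13 v = ∑ u : Fin S.ν, if (u : ℕ) < j then
        (if r u = v then (1 : Fin S.ν → ℝ) u else 0) else 0) ∧
    ∀ v : Fin S.ν, μ.real 14 v = ∑ u : Fin S.ν, if (u : ℕ) < j then
        (if r u = v then b (S.orig u) else 0) else 0)
      ?_ ?_ ?_ ?_) (le_of_eq rfl) ?_
  · intro μ hf
    simp only [NExp.val]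
    rw [hf.nat 10 (by decide), hS.ν_eq]
  · rintro j μ x h
    exact h
  · exact ⟨fun v => by simp [h13], fun v => by simp [h14]⟩
  · rintro j hj μ hf hv ⟨ha, hc⟩
    have e30 : μ.nat 30 j = r ⟨j, hj⟩ := by rw [hf.nat 30 (by decide)]; exact hr ⟨j, hj⟩
    have e12 : μ.nat 12 j = S.orig ⟨j, hj⟩ := by
      rw [hf.nat 12 (by decide)]; exact hS.orig_eq ⟨j, hj⟩
    have e1 : ∀ u : Fin n, μ.real 1 u = b u := by rw [hf.real 1 (by decide)]; exact hb
    refine ⟨fun v => ?_, fun v => ?_⟩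
    · rw [sum_lt_succ _ hj, ← ha]
      by_cases hvr : v = r ⟨j, hj⟩
      · simp [sumBody, hv, e30, hvr]
      · have h1 : (v : ℕ) ≠ r ⟨j, hj⟩ := fun h => hvr (Fin.ext h)
        simp [sumBody, hv, e30, h1, Ne.symm hvr]
    · rw [sum_lt_succ _ hj, ← hc]
      by_cases hvr : v = r ⟨j, hj⟩
      · simp [sumBody, hv, e30, e12, e1, hvr]
      · have h1 : (v : ℕ) ≠ r ⟨j, hj⟩ := fun h => hvr (Fin.ext h)
        simp [sumBody, hv, e30, h1, Ne.symm hvr]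
  · rintro μ ⟨hf, ha, hc⟩
    refine ⟨hf, fun v => ?_, fun v => ?_⟩
    · rw [ha, push]
      simp
    · rw [hc, push]
      simp

theorem WP.center (hS : S.Static μ₀) {r : Fin S.ν → Fin S.ν} (hr : ∀ i : Fin S.ν, μ₀.nat 30 i = r i)
    {b : Fin n → ℝ} (hb : ∀ u : Fin n, μ₀.real 1 u = b u) {f g : Fin S.ν → ℝ}
    (h13 : ∀ k : Fin S.ν, μ₀.real 13 k = f k) (h14 : ∀ k : Fin S.ν, μ₀.real 14 k = g k) :
    WP O (IllCond.forP 20 nuvar centerBody) (3 * S.ν + 2) μ₀ fun μ =>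
      Frame (IllCond.forP 20 nuvar centerBody) μ₀ μ ∧
      ∀ i : Fin S.ν, μ.real 15 i = b (S.orig i) - g (r i) / f (r i) := by
  refine WP.mono (WP.forP (c := centerBody) rfl (by decide) S.ν (fun j μ =>
    ∀ i : Fin S.ν, (i : ℕ) < j → μ.real 15 i = b (S.orig i) - g (r i) / f (r i))
      ?_ ?_ ?_ ?_) (le_of_eq rfl) fun μ h => ⟨h.1, fun i => h.2 i i.2⟩
  · intro μ hf
    simp only [NExp.val]
    rw [hf.nat 10 (by decide), hS.ν_eq]
  · rintro j μ x h
    exact h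
  · intro i hi
    omega
  · rintro j hj μ hf hv h i hi
    have e30 : μ.nat 30 j = r ⟨j, hj⟩ := by rw [hf.nat 30 (by decide)]; exact hr ⟨j, hj⟩
    have e12 : μ.nat 12 j = S.orig ⟨j, hj⟩ := by
      rw [hf.nat 12 (by decide)]; exact hS.orig_eq ⟨j, hj⟩
    have e1 : ∀ u : Fin n, μ.real 1 u = b u := by rw [hf.real 1 (by decide)]; exact hb
    have e13 : ∀ u : Fin S.ν, μ.real 13 u = f u := by rw [hf.real 13 (by decide)]; exact h13
    have e14 : ∀ u : Fin S.ν, μ.real 14 u = g u := by rw [hf.real 14 (by decide)]; exact h14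
    by_cases hij : (i : ℕ) = j
    · subst hij
      simp [centerBody, hv, e30, e12, e1, e13, e14]
    · simpa [centerBody, hv, hij] using h i (by omega)

theorem WP.prepP (hS : S.Static μ₀) {b : Fin n → ℝ} (hb : ∀ u : Fin n, μ₀.real 1 u = b u)
    (h13 : ∀ k, μ₀.real 13 k = 0) (h14 : ∀ k, μ₀.real 14 k = 0) :
    WP O IllCond.prepP (60 * (m + S.ν) + 7 * S.ν + 26) μ₀ fun μ =>
      Frame IllCond.prepP μ₀ μ ∧
      (∀ i : Fin S.ν, μ.real 15 i = IllCond.center S.L (fun i => b (S.orig i)) i) ∧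
      μ.real 11 0 = (n : ℝ) ^ 40 ∧ μ.nat 36 0 = 1 := by
  refine WP.frame ?_
  refine WP.mono (WP.seq (hS.cluster (thr := .ofNat (.lit 0)) (τ := 0) (tgt := 30) (by simp) le_rfl
    (fun _ _ => rfl) (by norm_num)) ?_)
    (T := 60 * (m + S.ν) + 20 + (4 * S.ν + 2 + (3 * S.ν + 2 + 2))) (by omega) fun _ h => h
  rintro μ1 ⟨hf1, a1⟩
  have hS1 := hS.frame hf1 (by decide) (by decide)
  have hb1 : ∀ u : Fin n, μ1.real 1 u = b u := by rw [hf1.real 1 (by decide)]; exact hb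
  refine WP.seq (WP.sums hS1 a1 hb1 ?_ ?_) ?_
  · rw [hf1.real 13 (by decide)]; exact h13
  · rw [hf1.real 14 (by decide)]; exact h14
  rintro μ2 ⟨hf2, a2, a3⟩
  have hS2 := hS1.frame hf2 (by decide) (by decide)
  refine WP.seq (WP.center hS2 (r := rep S.L 0) ?_ (b := b) ?_ a2 a3) ?_
  · rw [hf2.nat 30 (by decide)]; exact a1
  · rw [hf2.real 1 (by decide)]; exact hb1
  rintro μ3 ⟨hf3, a4⟩
  have hS3 := hS2.frame hf3 (by decide) (by decide)
  refine WP.straight (c := .seq _ _) rfl ⟨fun i => ?_, ?_, ?_⟩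
  · simp only [Program.run, Mem.setN_real, Mem.setR_real, Nat.reduceEqDiff, if_false]
    rw [a4]
    rfl
  · simp [RExp.val_npow, hS3.n_eq]
  · simp

end Prep

/-! ### Handing over the system of a scale -/

/-- Appending one entry to the list that is handed over. -/
def emitBody (r c : NExp) (v : RExp) : Program :=
  .seq (.setNat 4 (.get 3 (.lit 1)) r) (.seq (.setNat 5 (.get 3 (.lit 1)) c)
    (.seq (.setReal 3 (.get 3 (.lit 1)) v) (.setNat 3 (.lit 1) (.add (.get 3 (.lit 1)) (.lit 1)))))

/-- `E` entries have been listed so far, and they add up to the matrix `A`. -/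
def Assembled {ν : ℕ} (μ : Mem) (E : ℕ) (A : Matrix (Fin ν) (Fin ν) ℝ) : Prop :=
  μ.nat 3 1 = E ∧ ∀ i j : Fin ν, (∑ e ∈ Finset.range E,
    if μ.nat 4 e = i ∧ μ.nat 5 e = j then μ.real 3 e else 0) = A i j

section Emit

variable {ν : ℕ} {O : Solver} {μ₀ : Mem} {A : Matrix (Fin ν) (Fin ν) ℝ}

theorem Assembled.congr {μ μ' : Mem} {E : ℕ} (h : Assembled μ E A) (h3 : μ'.nat 3 = μ.nat 3)
    (h4 : μ'.nat 4 = μ.nat 4) (h5 : μ'.nat 5 = μ.nat 5) (hr : μ'.real 3 = μ.real 3) :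
    Assembled μ' E A := by
  simpa only [Assembled, h3, h4, h5, hr] using h

/-- A loop that lists `cnt` entries adds the corresponding elementary matrices. The hypothesis `h`
says that the expressions for row, column and value may be evaluated in any memory that differs from
the initial one only in what the loop writes. -/
theorem WP.emit {bound r c : NExp} {v : RExp} {E cnt : ℕ} {rF cF : ℕ → Fin ν} {vF : ℕ → ℝ}
    (hA : Assembled μ₀ E A)
    (hb : ∀ μ : Mem, (∀ a, a ∉ [3, 4, 5, 20] → μ.nat a = μ₀.nat a) → bound.val μ = cnt)
    (h : ∀ j < cnt, ∀ μ : Mem, (∀ a, a ∉ [3, 4, 5, 20] → μ.nat a = μ₀.nat a) →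
      (∀ a, a ≠ 3 → μ.real a = μ₀.real a) → μ.nat 20 0 = j →
      r.val μ = rF j ∧ c.val μ = cF j ∧ v.val μ = vF j) :
    WP O (IllCond.forP 20 bound (emitBody r c v)) (6 * cnt + 2) μ₀ fun μ =>
      Frame (IllCond.forP 20 bound (emitBody r c v)) μ₀ μ ∧ Assembled μ (E + cnt)
        (A + ∑ k ∈ Finset.range cnt,
          vF k • vecMulVec (Pi.single (rF k) 1) (Pi.single (cF k) 1)) := by
  have hfr : ∀ μ : Mem, Frame (IllCond.forP 20 bound (emitBody r c v)) μ₀ μ →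
      (∀ a, a ∉ [3, 4, 5, 20] → μ.nat a = μ₀.nat a) ∧ ∀ a, a ≠ 3 → μ.real a = μ₀.real a := by
    intro μ hf
    constructor
    · intro a ha
      refine hf.nat a fun h => ha ?_
      simp [IllCond.forP, emitBody, Program.modN] at h ⊢
      tauto
    · intro a ha
      refine hf.real a fun h => ha ?_
      simpa [IllCond.forP, emitBody, Program.modR] using h
  refine WP.mono (WP.forP (c := emitBody r c v) rfl (by simp [emitBody, Program.modN]) cnt
    (fun j μ => Assembled μ (E + j) (A + ∑ k ∈ Finset.range j,
          vF k • vecMulVec (Pi.single (rF k) 1) (Pi.single (cF k) 1))) ?_ ?_ ?_ ?_) (le_of_eq rfl)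
              fun _ h => h
  · exact fun μ hf => hb μ (hfr μ hf).1
  · intro j μ x hμ
    exact hμ.congr (by simp [Mem.setN_nat_eq]) (by simp [Mem.setN_nat_eq])
      (by simp [Mem.setN_nat_eq]) rfl
  · simpa using hA
  · rintro j hj μ hf hv ⟨h1, h2⟩
    obtain ⟨hn, hr⟩ := hfr μ hf
    have er := (h j hj μ hn hr hv).1
    have ec := (h j hj (μ.setN 4 (E + j) (rF j)) (fun a ha => by
      rw [Mem.setN_nat_eq, if_neg (by rintro rfl; simp at ha), hn a ha]) hr (by simp [hv])).2.1
    have ev := (h j hj ((μ.setN 4 (E + j) (rF j)).setN 5 (E + j) (cF j)) (fun a ha => by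
      rw [Mem.setN_nat_eq, if_neg (by rintro rfl; simp at ha), Mem.setN_nat_eq,
        if_neg (by rintro rfl; simp at ha), hn a ha]) hr (by simp [hv])).2.2
    have hrun : (emitBody r c v).run O μ = (((μ.setN 4 (E + j) (rF j)).setN 5 (E + j) (cF j)).setR 3
        (E + j) (vF j)).setN 3 1 (E + j + 1) := by
      simp only [emitBody, Program.run, NExp.val, h1, er, Mem.setN_nat, Mem.setR_nat,
        Nat.reduceEqDiff, if_false, ec, ev]
    rw [hrun]
    refine ⟨by simp; ring, fun a b => ?_⟩
    rw [← add_assoc, Finset.sum_range_succ, Finset.sum_range_succ, ← add_assoc, Matrix.add_apply,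
      ← h2 a b]
    congr 1
    · refine Finset.sum_congr rfl fun k hk => ?_
      have : k ≠ E + j := by have := Finset.mem_range.1 hk; omega
      simp [this]
    · simp [vecMulVec_apply, Pi.single_apply, Fin.ext_iff]
      by_cases h3 : (a : ℕ) = rF j <;> by_cases h4 : (b : ℕ) = cF j <;>
        simp [h3, h4, eq_comm]

end Emit

/-- The vertex map of a scale (array `35`); the right-hand side is cleared. -/
def phiBody : Program :=
  .seq (.setReal 4 ivar (.ofNat (.lit 0)))
    (.ite (.natEq (.get 34 (.get 31 ivar)) (.get 31 ivar)) (.setNat 35 ivar (.lit 0))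
      (.setNat 35 ivar (.get 31 ivar)))

/-- For an entry inside a cluster of the grounding threshold, its target (array `37`) and `0` (real
array `7`); for any other entry, vertex `0` and the value of the entry. -/
def blockBody : Program :=
  .ite (.natEq (.get 34 (.get 13 ivar)) (.get 34 (.get 14 ivar)))
    (.seq (.setNat 37 ivar (.get 35 (.get 14 ivar))) (.setReal 7 ivar (.ofNat (.lit 0))))
    (.seq (.setNat 37 ivar (.lit 0)) (.setReal 7 ivar (.get 0 ivar)))

/-- The weight by which contracted vertices are attached. -/
abbrev attachWt : RExp := .div (rvar 10) (.mul (.mul (rvar 11) (rvar 11)) (rvar 11))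

/-- The list of entries of the system of a scale. -/
def systemP : Program :=
  .seq (forP 20 nuvar phiBody)
  (.seq (forP 20 mvar blockBody)
  (.seq (.setNat 3 (.lit 1) (.lit 0))
  (.seq (forP 20 mvar (emitBody (.get 35 (.get 13 ivar)) (.get 37 ivar) (.get 0 ivar)))
  (.seq (forP 20 mvar (emitBody (.lit 0) (.get 35 (.get 14 ivar)) (.get 7 ivar)))
  (.seq (forP 20 mvar (emitBody (.lit 0) (.lit 0) (.sub (.ofNat (.lit 0)) (.get 7 ivar))))
  (.seq (forP 20 nuvar (emitBody ivar ivar attachWt))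
  (.seq (forP 20 nuvar (emitBody (.get 35 ivar) (.get 35 ivar) attachWt))
  (.seq (forP 20 nuvar (emitBody ivar (.get 35 ivar) (.sub (.ofNat (.lit 0)) attachWt)))
    (forP 20 nuvar (emitBody (.get 35 ivar) ivar (.sub (.ofNat (.lit 0)) attachWt)))))))))))

section System

variable {n m : ℕ} {S : Setup n m} {O : Solver} {μ₀ : Mem}

theorem WP.phi (hS : S.Static μ₀) {σ σ' : ℝ} (hA : ∀ i : Fin S.ν, μ₀.nat 31 i = rep S.L σ i)
    (hD : ∀ i : Fin S.ν, μ₀.nat 34 i = rep S.L σ' i) :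
    WP O (IllCond.forP 20 nuvar phiBody) (6 * S.ν + 2) μ₀ fun μ =>
      Frame (IllCond.forP 20 nuvar phiBody) μ₀ μ ∧
      (∀ i : Fin S.ν, μ.nat 35 i = IllCond.phi S.L S.o σ σ' i) ∧ ∀ i : Fin S.ν, μ.real 4 i = 0 := by
  refine WP.mono (WP.forP (c := phiBody) rfl (by decide) S.ν (fun j μ => ∀ i : Fin S.ν,
      (i : ℕ) < j →
      μ.nat 35 i = IllCond.phi S.L S.o σ σ' i ∧ μ.real 4 i = 0)
      ?_ ?_ ?_ ?_) (le_of_eq rfl) fun μ h => ⟨h.1, fun i => (h.2 i i.2).1, fun i => (h.2 i i.2).2⟩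
  · intro μ hf
    simp only [NExp.val]
    rw [hf.nat 10 (by decide), hS.ν_eq]
  · intro j μ x h i hi
    simpa using h i hi
  · intro i hi
    omega
  · intro j hj μ hf hv h i hi
    have e31 : μ.nat 31 j = rep S.L σ ⟨j, hj⟩ := by rw [hf.nat 31 (by decide)]; exact hA ⟨j, hj⟩
    have e34 : ∀ i : Fin S.ν, μ.nat 34 i = rep S.L σ' i := by rw [hf.nat 34 (by decide)]; exact hD
    by_cases hc : rep S.L σ' (rep S.L σ ⟨j, hj⟩) = rep S.L σ ⟨j, hj⟩
    · by_cases hij : (i : ℕ) = j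
      · subst hij
        simp [phiBody, hv, e31, e34, hc, IllCond.phi, S.o_val]
      · simpa [phiBody, hv, e31, e34, hc, hij] using h i (by omega)
    · have hc' : (rep S.L σ' (rep S.L σ ⟨j, hj⟩) : ℕ) ≠ rep S.L σ ⟨j, hj⟩ := fun h => hc (Fin.ext h)
      by_cases hij : (i : ℕ) = j
      · subst hij
        simp [phiBody, hv, e31, e34, hc, hc', IllCond.phi]
      · simpa [phiBody, hv, e31, e34, hc', hij] using h i (by omega)

theorem WP.block (hS : S.Static μ₀) {φ q : Fin S.ν → Fin S.ν} (hφ : ∀ i : Fin S.ν,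
    μ₀.nat 35 i = φ i)
    (hD : ∀ i : Fin S.ν, μ₀.nat 34 i = q i) :
    WP O (IllCond.forP 20 mvar blockBody) (7 * m + 2) μ₀ fun μ =>
      Frame (IllCond.forP 20 mvar blockBody) μ₀ μ ∧ ∀ k < m,
      μ.nat 37 k = (if q (S.row k) = q (S.col k) then φ (S.col k) else S.o : Fin S.ν) ∧
      μ.real 7 k = if q (S.row k) = q (S.col k) then 0 else S.val k := by
  refine WP.mono (WP.forP (c := blockBody) rfl (by decide) m (fun j μ => ∀ k < j,
      μ.nat 37 k = (if q (S.row k) = q (S.col k) then φ (S.col k) else S.o : Fin S.ν) ∧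
      μ.real 7 k = if q (S.row k) = q (S.col k) then 0 else S.val k)
      ?_ ?_ ?_ ?_) (le_of_eq rfl) fun μ h => h
  · intro μ hf
    simp only [NExp.val]
    rw [hf.nat 0 (by decide), hS.m_eq]
  · intro j μ x h i hi
    simpa using h i hi
  · intro i hi
    omega
  · intro j hj μ hf hv h i hi
    have e35 : ∀ i : Fin S.ν, μ.nat 35 i = φ i := by rw [hf.nat 35 (by decide)]; exact hφ
    have e34 : ∀ i : Fin S.ν, μ.nat 34 i = q i := by rw [hf.nat 34 (by decide)]; exact hD
    have e13 : μ.nat 13 j = S.row j := by rw [hf.nat 13 (by decide)]; exact hS.row_eq j hj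
    have e14 : μ.nat 14 j = S.col j := by rw [hf.nat 14 (by decide)]; exact hS.col_eq j hj
    have e0 : μ.real 0 j = S.val j := by rw [hf.real 0 (by decide)]; exact hS.val_eq j hj
    by_cases hc : q (S.row j) = q (S.col j)
    · by_cases hij : i = j
      · subst hij
        simp [blockBody, hv, e35, e34, e13, e14, hc]
      · simpa [blockBody, hv, e35, e34, e13, e14, hc, hij] using h i (by omega)
    · have hc' : (q (S.row j) : ℕ) ≠ q (S.col j) := fun h => hc (Fin.ext h)
      by_cases hij : i = j
      · subst hij
        simp [blockBody, hv, e34, e13, e14, hc, hc', e0, S.o_val]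
      · simpa [blockBody, hv, e35, e34, e13, e14, hc', hij] using h i (by omega)

/-- A map of vertices as a function of natural numbers. -/
def natMap {ν : ℕ} (o : Fin ν) (φ : Fin ν → Fin ν) (k : ℕ) : Fin ν :=
  if h : k < ν then φ ⟨k, h⟩ else o

theorem sum_range_natMap {ν : ℕ} (o : Fin ν) (φ ψ : Fin ν → Fin ν) (ω : ℝ) :
    ∑ k ∈ Finset.range ν, ω • vecMulVec (Pi.single (natMap o φ k) (1 : ℝ))
        (Pi.single (natMap o ψ k) (1 : ℝ))
      = ω • ∑ i, vecMulVec (Pi.single (φ i) (1 : ℝ)) (Pi.single (ψ i) (1 : ℝ)) := by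
  rw [Finset.sum_range, Finset.smul_sum]
  refine Finset.sum_congr rfl fun i _ => ?_
  simp [natMap]

/-- The listed entries add up to the contracted matrix. -/
theorem contraction_eq_entries (S : Setup n m) (φ q : Fin S.ν → Fin S.ν) (ω : ℝ) :
    contraction S.L S.o φ q ω =
      0 + ∑ k ∈ Finset.range m, S.val k • vecMulVec (Pi.single (φ (S.row k)) 1)
          (Pi.single (if q (S.row k) = q (S.col k) then φ (S.col k) else S.o) 1)
      + ∑ k ∈ Finset.range m, (if q (S.row k) = q (S.col k) then 0 else S.val k) •
          vecMulVec (Pi.single S.o 1) (Pi.single (φ (S.col k)) 1)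
      + ∑ k ∈ Finset.range m, (0 - if q (S.row k) = q (S.col k) then 0 else S.val k) •
          vecMulVec (Pi.single S.o 1) (Pi.single S.o 1)
      + ∑ k ∈ Finset.range S.ν, ω • vecMulVec (Pi.single (natMap S.o id k) 1)
          (Pi.single (natMap S.o id k) 1)
      + ∑ k ∈ Finset.range S.ν, ω • vecMulVec (Pi.single (natMap S.o φ k) 1)
          (Pi.single (natMap S.o φ k) 1)
      + ∑ k ∈ Finset.range S.ν, (0 - ω) • vecMulVec (Pi.single (natMap S.o id k) 1)
          (Pi.single (natMap S.o φ k) 1)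
      + ∑ k ∈ Finset.range S.ν, (0 - ω) • vecMulVec (Pi.single (natMap S.o φ k) 1)
          (Pi.single (natMap S.o id k) 1) := by
  simp only [sum_range_natMap]
  have h1 : ∑ u, ∑ v, S.L u v • (if q u = q v then
        vecMulVec (Pi.single (φ u) (1 : ℝ)) (Pi.single (φ v) (1 : ℝ))
      else vecMulVec (Pi.single (φ u) 1) (Pi.single S.o 1)
        + vecMulVec (Pi.single S.o 1) (Pi.single (φ v) 1)
        - vecMulVec (Pi.single S.o 1) (Pi.single S.o 1))
      = ∑ k ∈ Finset.range m, S.val k • (if q (S.row k) = q (S.col k) then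
        vecMulVec (Pi.single (φ (S.row k)) (1 : ℝ)) (Pi.single (φ (S.col k)) (1 : ℝ))
      else vecMulVec (Pi.single (φ (S.row k)) 1) (Pi.single S.o 1)
        + vecMulVec (Pi.single S.o 1) (Pi.single (φ (S.col k)) 1)
        - vecMulVec (Pi.single S.o 1) (Pi.single S.o 1)) := by
    ext i j
    have := S.sum_eq fun u v => (if q u = q v then
        vecMulVec (Pi.single (φ u) (1 : ℝ)) (Pi.single (φ v) (1 : ℝ))
      else vecMulVec (Pi.single (φ u) 1) (Pi.single S.o 1)
        + vecMulVec (Pi.single S.o 1) (Pi.single (φ v) 1)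
        - vecMulVec (Pi.single S.o 1) (Pi.single S.o 1)) i j
    simpa only [Matrix.sum_apply, Matrix.smul_apply, smul_eq_mul] using this
  rw [contraction, h1, zero_add, ← Finset.sum_add_distrib, ← Finset.sum_add_distrib]
  simp only [add_assoc]
  congr 1
  · refine Finset.sum_congr rfl fun k _ => ?_
    split_ifs with h
    · simp
    · rw [zero_sub, neg_smul, smul_sub, smul_add]
      abel
  · simp only [← smul_add, zero_sub, neg_smul, ← smul_neg, ← Finset.sum_add_distrib,
      ← Finset.sum_neg_distrib]
    congr 1
    refine Finset.sum_congr rfl fun i _ => ?_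
    rw [sub_vecMulVec, vecMulVec_sub, vecMulVec_sub]
    simp only [id]
    abel

/-- The listed entries, three for every entry of the input and four for every vertex, add up to the
system of the scale. -/
theorem WP.systemP (hS : S.Static μ₀) {σ σ' τ N : ℝ}
    (hA : ∀ i : Fin S.ν, μ₀.nat 31 i = rep S.L σ i)
    (hD : ∀ i : Fin S.ν, μ₀.nat 34 i = rep S.L σ' i) (hτ : μ₀.real 10 0 = τ)
    (hN : μ₀.real 11 0 = N) (hω : τ / (N * N * N) = σ') :
    WP O IllCond.systemP (25 * m + 30 * S.ν + 19) μ₀ fun μ =>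
      Frame IllCond.systemP μ₀ μ ∧
      (∀ i : Fin S.ν, μ.nat 35 i = IllCond.phi S.L S.o σ σ' i) ∧ (∀ i : Fin S.ν, μ.real 4 i = 0) ∧
      Assembled μ (3 * m + 4 * S.ν) (scaleMat S.L S.o σ σ') := by
  set φ := IllCond.phi S.L S.o σ σ' with hφ
  set q := rep S.L σ' with hq
  refine WP.frame ?_
  refine WP.mono (WP.seq (WP.phi hS hA hD) ?_) (T :=
      6 * S.ν + 2 + (7 * m + 2 + (1 + (6 * m + 2 + (6 * m + 2 +
    (6 * m + 2 + (6 * S.ν + 2 + (6 * S.ν + 2 + (6 * S.ν + 2 + (6 * S.ν + 2)))))))))) (by omega)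
        fun _ h => h
  rintro μ1 ⟨hf1, a1, a2⟩
  have hS1 := hS.frame hf1 (by decide) (by decide)
  refine WP.seq (WP.block hS1 a1 (q := q) ?_) ?_
  · rw [hf1.nat 34 (by decide)]; exact hD
  rintro μ2 ⟨hf2, a3⟩
  have hS2 := hS1.frame hf2 (by decide) (by decide)
  have b35 : ∀ i : Fin S.ν, μ2.nat 35 i = φ i := by rw [hf2.nat 35 (by decide)]; exact a1
  have b4 : ∀ i : Fin S.ν, μ2.real 4 i = 0 := by rw [hf2.real 4 (by decide)]; exact a2
  have bω : μ2.real 10 0 / (μ2.real 11 0 * μ2.real 11 0 * μ2.real 11 0) = σ' := by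
    rw [hf2.real 10 (by decide), hf2.real 11 (by decide), hf1.real 10 (by decide),
      hf1.real 11 (by decide), hτ, hN, hω]
  -- what the emitting loops read does not change while they run
  have key : ∀ μ : Mem, (∀ a, a ∉ [3, 4, 5, 20] → μ.nat a = μ2.nat a) →
      (∀ a, a ≠ 3 → μ.real a = μ2.real a) →
      mvar.val μ = m ∧ nuvar.val μ = S.ν ∧ attachWt.val μ = σ' ∧
      (∀ j < S.ν, μ.nat 20 0 = j → ivar.val μ = natMap S.o id j ∧
        (NExp.get 35 ivar).val μ = natMap S.o φ j) ∧
      ∀ j < m, μ.nat 20 0 = j → (NExp.get 35 (.get 13 ivar)).val μ = φ (S.row j) ∧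
        (NExp.get 37 ivar).val μ = (if q (S.row j) = q (S.col j) then φ (S.col j) else S.o : Fin
            S.ν) ∧
        (RExp.get 0 ivar).val μ = S.val j ∧ (NExp.get 35 (.get 14 ivar)).val μ = φ (S.col j) ∧
        (RExp.get 7 ivar).val μ = if q (S.row j) = q (S.col j) then 0 else S.val j := by
    intro μ hn hr
    refine ⟨?_, ?_, ?_, fun j hj hv => ⟨?_, ?_⟩, fun j hj hv => ⟨?_, ?_, ?_, ?_, ?_⟩⟩
    · simp only [NExp.val]; rw [hn 0 (by decide), hS2.m_eq]
    · simp only [NExp.val]; rw [hn 10 (by decide), hS2.ν_eq]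
    · simp only [RExp.val, NExp.val]; rw [hr 10 (by decide), hr 11 (by decide), bω]
    · simp [hv, natMap, hj]
    · simp only [NExp.val, hv, natMap, hj, dif_pos]; rw [hn 35 (by decide)]; exact b35 ⟨j, hj⟩
    · simp only [NExp.val, hv]; rw [hn 35 (by decide), hn 13 (by decide), hS2.row_eq j hj, b35]
    · simp only [NExp.val, hv]; rw [hn 37 (by decide), (a3 j hj).1]
    · simp only [RExp.val, NExp.val, hv]; rw [hr 0 (by decide), hS2.val_eq j hj]
    · simp only [NExp.val, hv]; rw [hn 35 (by decide), hn 14 (by decide), hS2.col_eq j hj, b35]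
    · simp only [RExp.val, NExp.val, hv]; rw [hr 7 (by decide), (a3 j hj).2]
  have step : ∀ {c : Program} {μ μ' : Mem}, Frame c μ μ' → (∀ a ∈ c.modN, a ∈ [3, 4, 5, 20]) →
      (∀ a ∈ c.modR, a = 3) →
      (∀ a, a ∉ [3, 4, 5, 20] → μ.nat a = μ2.nat a) ∧ (∀ a, a ≠ 3 → μ.real a = μ2.real a) →
      (∀ a, a ∉ [3, 4, 5, 20] → μ'.nat a = μ2.nat a) ∧ ∀ a, a ≠ 3 → μ'.real a = μ2.real a := by
    intro c μ μ' hf h1 h2 h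
    exact ⟨fun a ha => (hf.nat a fun h => ha (h1 a h)).trans (h.1 a ha),
      fun a ha => (hf.real a fun h => ha (h2 a h)).trans (h.2 a ha)⟩
  refine WP.seq (T := 1) (WP.straight (c := .setNat 3 (.lit 1) (.lit 0))
    (Q := fun μ => Assembled μ 0 (0 : Matrix (Fin S.ν) (Fin S.ν) ℝ) ∧
      (∀ a, a ∉ [3, 4, 5, 20] → μ.nat a = μ2.nat a) ∧ (∀ a, a ≠ 3 → μ.real a = μ2.real a)) rfl
    ⟨⟨by simp, by simp⟩, fun a ha => ?_, fun a _ => rfl⟩) ?_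
  · rw [Program.run, Mem.setN_nat_eq, if_neg (by rintro rfl; simp at ha)]
  rintro μ3 ⟨A3, h3⟩
  have tr : ∀ {μ μ' : Mem}, ((∀ a, a ∉ [3, 4, 5, 20] → μ.nat a = μ2.nat a) ∧
      (∀ a, a ≠ 3 → μ.real a = μ2.real a)) → (∀ a, a ∉ [3, 4, 5, 20] → μ'.nat a = μ.nat a) →
      (∀ a, a ≠ 3 → μ'.real a = μ.real a) → _ := fun {μ μ'} h h1 h2 =>
    key μ' (fun a ha => (h1 a ha).trans (h.1 a ha)) fun a ha => (h2 a ha).trans (h.2 a ha)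
  refine WP.seq (WP.emit A3 (cnt := m) (rF := fun k => φ (S.row k))
    (cF := fun k => if q (S.row k) = q (S.col k) then φ (S.col k) else S.o) (vF := S.val)
    (fun μ h => by simp only [NExp.val]; rw [h 0 (by decide), h3.1 0 (by decide), hS2.m_eq])
    fun j hj μ h1 h2 hv => ?_) ?_
  · obtain ⟨-, -, -, -, k5⟩ := tr h3 h1 h2
    exact ⟨(k5 j hj hv).1, (k5 j hj hv).2.1, (k5 j hj hv).2.2.1⟩
  rintro μ4 ⟨hf4, A4⟩
  have h4 := step hf4 (by decide) (by decide) h3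
  refine WP.seq (WP.emit A4 (cnt := m) (rF := fun k => S.o) (cF := fun k => φ (S.col k))
    (vF := fun k => if q (S.row k) = q (S.col k) then 0 else S.val k)
    (fun μ h => by simp only [NExp.val]; rw [h 0 (by decide), h4.1 0 (by decide), hS2.m_eq])
    fun j hj μ h1 h2 hv => ?_) ?_
  · obtain ⟨-, -, -, -, k5⟩ := tr h4 h1 h2
    exact ⟨S.o_val.symm, (k5 j hj hv).2.2.2.1, (k5 j hj hv).2.2.2.2⟩
  rintro μ5 ⟨hf5, A5⟩
  have h5 := step hf5 (by decide) (by decide) h4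
  refine WP.seq (WP.emit A5 (cnt := m) (rF := fun k => S.o) (cF := fun k => S.o)
    (vF := fun k => 0 - if q (S.row k) = q (S.col k) then 0 else S.val k)
    (fun μ h => by simp only [NExp.val]; rw [h 0 (by decide), h5.1 0 (by decide), hS2.m_eq])
    fun j hj μ h1 h2 hv => ?_) ?_
  · obtain ⟨-, -, -, -, k5⟩ := tr h5 h1 h2
    refine ⟨S.o_val.symm, S.o_val.symm, ?_⟩
    rw [← (k5 j hj hv).2.2.2.2]
    simp
  rintro μ6 ⟨hf6, A6⟩
  have h6 := step hf6 (by decide) (by decide) h5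
  refine WP.seq (WP.emit A6 (cnt := S.ν) (rF := natMap S.o id) (cF := natMap S.o id)
    (vF := fun k => σ')
    (fun μ h => by simp only [NExp.val]; rw [h 10 (by decide), h6.1 10 (by decide), hS2.ν_eq])
    fun j hj μ h1 h2 hv => ?_) ?_
  · obtain ⟨-, -, k3, k4, -⟩ := tr h6 h1 h2
    exact ⟨(k4 j hj hv).1, (k4 j hj hv).1, k3⟩
  rintro μ7 ⟨hf7, A7⟩
  have h7 := step hf7 (by decide) (by decide) h6
  refine WP.seq (WP.emit A7 (cnt := S.ν) (rF := natMap S.o φ) (cF := natMap S.o φ)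
    (vF := fun k => σ')
    (fun μ h => by simp only [NExp.val]; rw [h 10 (by decide), h7.1 10 (by decide), hS2.ν_eq])
    fun j hj μ h1 h2 hv => ?_) ?_
  · obtain ⟨-, -, k3, k4, -⟩ := tr h7 h1 h2
    exact ⟨(k4 j hj hv).2, (k4 j hj hv).2, k3⟩
  rintro μ8 ⟨hf8, A8⟩
  have h8 := step hf8 (by decide) (by decide) h7
  have hneg : ∀ μ : Mem, attachWt.val μ = σ' →
      (RExp.sub (.ofNat (.lit 0)) attachWt).val μ = 0 - σ' := fun μ h => by rw [← h]; simp
  refine WP.seq (WP.emit A8 (cnt := S.ν) (rF := natMap S.o id) (cF := natMap S.o φ)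
    (vF := fun k => 0 - σ')
    (fun μ h => by simp only [NExp.val]; rw [h 10 (by decide), h8.1 10 (by decide), hS2.ν_eq])
    fun j hj μ h1 h2 hv => ?_) ?_
  · obtain ⟨-, -, k3, k4, -⟩ := tr h8 h1 h2
    exact ⟨(k4 j hj hv).1, (k4 j hj hv).2, hneg μ k3⟩
  rintro μ9 ⟨hf9, A9⟩
  have h9 := step hf9 (by decide) (by decide) h8
  refine WP.mono (WP.emit A9 (cnt := S.ν) (rF := natMap S.o φ) (cF := natMap S.o id)
    (vF := fun k => 0 - σ')
    (fun μ h => by simp only [NExp.val]; rw [h 10 (by decide), h9.1 10 (by decide), hS2.ν_eq])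
    fun j hj μ h1 h2 hv => ?_) le_rfl ?_
  · obtain ⟨-, -, k3, k4, -⟩ := tr h9 h1 h2
    exact ⟨(k4 j hj hv).2, (k4 j hj hv).1, hneg μ k3⟩
  rintro μ10 ⟨hf10, A10⟩
  have h10 := step hf10 (by decide) (by decide) h9
  refine ⟨?_, ?_, ?_⟩
  · rw [h10.1 35 (by decide)]; exact b35
  · rw [h10.2 4 (by decide)]; exact b4
  · rw [scaleMat, contraction_eq_entries]
    have : 0 + m + m + m + S.ν + S.ν + S.ν + S.ν = 3 * m + 4 * S.ν := by omega
    rw [← this]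
    exact A10

end System

/-! ### One scale and the main loop -/

/-- The right-hand side of a scale: the demand of every vertex is added at the image of its
representative at the threshold `τ`, and subtracted at the image of that at `τ / N`. -/
def rhsBody : Program :=
  .seq (.setReal 4 (.get 35 (.get 32 ivar)) (.add (.get 4 (.get 35 (.get 32 ivar))) (.get 15 ivar)))
    (.setReal 4 (.get 35 (.get 33 ivar)) (.sub (.get 4 (.get 35 (.get 33 ivar))) (.get 15 ivar)))

/-- The call to the solver, with error parameter `1 / N`. -/
def solveP : Program :=
  .seq (.setNat 3 (.lit 0) nuvar)
    (.seq (.setReal 5 (.lit 0) (.div (.ofNat (.lit 1)) (rvar 11))) .solve)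

/-- The answer is pulled back to the vertices of the input and added to the output. -/
def outBody : Program :=
  .setReal 2 (.get 12 ivar) (.add (.get 2 (.get 12 ivar)) (.get 6 (.get 35 ivar)))

/-- The flag is raised when an entry joins two clusters of the next threshold. -/
def flagBody : Program :=
  .ite (.natEq (.get 33 (.get 13 ivar)) (.get 33 (.get 14 ivar))) .skip
      (.setNat 36 (.lit 0) (.lit 1))

/-- The threshold is divided by `N`, and the flag says whether another scale is needed. -/
def nextP : Program :=
  .seq (.seq (.setReal 10 (.lit 0) (.div (rvar 10) (rvar 11))) (.setNat 36 (.lit 0) (.lit 0)))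
    (forP 20 mvar flagBody)

/-- The clusters at the four thresholds `τ N`, `τ`, `τ / N`, `τ / N ^ 3` of a scale. -/
def clustersP : Program :=
  .seq (cluster (.mul (rvar 10) (rvar 11)) 31)
    (.seq (cluster (rvar 10) 32) (.seq (cluster (.div (rvar 10) (rvar 11)) 33)
        (cluster attachWt 34)))

/-- The work for the threshold `τ`, in one iteration of the main loop. -/
def stepP : Program :=
  .seq clustersP (.seq systemP (.seq (forP 20 nuvar rhsBody)
    (.seq solveP (.seq (forP 20 nuvar outBody) nextP))))

/-- The program: the thresholds `τ = W / N ^ k` are treated in turn, where `W` is the trace. -/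
def mainP : Program :=
  .seq readP (.seq prepP (.loop (.natEq (nvar 36) (.lit 1)) stepP))

section Step

variable {n m : ℕ} {S : Setup n m} {O : Solver} {μ₀ : Mem}

theorem system_eq {s : State} {ν E : ℕ} {a : ℝ} {A : Matrix (Fin ν) (Fin ν) ℝ} (h0 : s.nat 3 0 = ν)
    (h1 : s.nat 3 1 = E) (h2 : s.real 5 0 = a)
    (hA : ∀ i j : Fin ν, (∑ e ∈ Finset.range E,
      if s.nat 4 e = i ∧ s.nat 5 e = j then s.real 3 e else 0) = A i j) :
    s.system = ⟨ν, A, E, a⟩ := by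
  subst h0 h1 h2
  have : A = s.system.mat := by
    ext i j
    exact (hA i j).symm
  subst this
  rfl

/-- A call is recorded, and its answer is found in array `6`. -/
theorem solved_spec {μ : Mem} {T : SystemSpec} (hT : (μ.toState 0).system = T) {c : Fin T.size → ℝ}
    (hc : ∀ i : Fin T.size, μ.real 4 i = c i) :
    (μ.solved O).calls = μ.calls ++ [⟨T, c⟩] ∧
      ∀ i : Fin T.size, (μ.solved O).real 6 i = O μ.calls.length T c i := by
  subst hT
  have : c = (μ.toState 0).rhs := by
    ext i
    exact (hc i).symm
  subst this
  refine ⟨rfl, fun i => ?_⟩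
  simp only [Mem.solved, State.afterSolve, Function.update_self]
  rw [dif_pos i.2]
  rfl

namespace Setup

/-- The system that is handed over at the threshold `τ`. -/
def system (S : Setup n m) (N τ : ℝ) : SystemSpec :=
  ⟨S.ν, scaleMat S.L S.o (τ * N) (τ / N ^ 3), 3 * m + 4 * S.ν, 1 / N⟩

/-- The right-hand side that is handed over at the threshold `τ`. -/
def rhs (S : Setup n m) (N : ℝ) (g : Fin S.ν → ℝ) (τ : ℝ) : Fin S.ν → ℝ :=
  push (phi S.L S.o (τ * N) (τ / N ^ 3)) (demand S.L N g τ)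

/-- Some entry joins different clusters at the threshold `τ`. -/
def Crossing (S : Setup n m) (τ : ℝ) : Prop :=
  ∃ k < m, rep S.L τ (S.row k) ≠ rep S.L τ (S.col k)

end Setup

theorem WP.clustersP (hS : S.Static μ₀) {τ N : ℝ} (hτ : μ₀.real 10 0 = τ) (hN : μ₀.real 11 0 = N)
    (hτ0 : 0 ≤ τ) (hN0 : 0 ≤ N) :
    WP O IllCond.clustersP (240 * (m + S.ν) + 80) μ₀ fun μ => Frame IllCond.clustersP μ₀ μ ∧
      (∀ i : Fin S.ν, μ.nat 31 i = rep S.L (τ * N) i) ∧ (∀ i : Fin S.ν, μ.nat 32 i = rep S.L τ i) ∧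
      (∀ i : Fin S.ν, μ.nat 33 i = rep S.L (τ / N) i) ∧
      ∀ i : Fin S.ν, μ.nat 34 i = rep S.L (τ / N ^ 3) i := by
  refine WP.frame ?_
  refine WP.mono (WP.seq (hS.cluster (τ := τ * N) (by simp [hτ, hN]) (by positivity)
    (fun μ' h => by simp [h]) (by norm_num)) ?_)
    (T := 60 * (m + S.ν) + 20 + (60 * (m + S.ν) + 20 + (60 * (m + S.ν) + 20 +
      (60 * (m + S.ν) + 20)))) (by omega) fun _ h => h
  rintro μ1 ⟨hf1, a1⟩
  have hS1 := hS.frame hf1 (by decide) (by decide)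
  have t1 : μ1.real 10 0 = τ := by rw [hf1.real 10 (by decide), hτ]
  have n1 : μ1.real 11 0 = N := by rw [hf1.real 11 (by decide), hN]
  refine WP.seq (hS1.cluster (τ := τ) (by simp [t1]) hτ0
    (fun μ' h => by simp [h]) (by norm_num)) ?_
  rintro μ2 ⟨hf2, a2⟩
  have hS2 := hS1.frame hf2 (by decide) (by decide)
  have t2 : μ2.real 10 0 = τ := by rw [hf2.real 10 (by decide), t1]
  have n2 : μ2.real 11 0 = N := by rw [hf2.real 11 (by decide), n1]
  refine WP.seq (hS2.cluster (τ := τ / N) (by simp [t2, n2]) (by positivity)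
    (fun μ' h => by simp [h]) (by norm_num)) ?_
  rintro μ3 ⟨hf3, a3⟩
  have hS3 := hS2.frame hf3 (by decide) (by decide)
  have t3 : μ3.real 10 0 = τ := by rw [hf3.real 10 (by decide), t2]
  have n3 : μ3.real 11 0 = N := by rw [hf3.real 11 (by decide), n2]
  refine WP.mono (hS3.cluster (τ := τ / N ^ 3) (by simp [t3, n3]; ring) (by positivity)
    (fun μ' h => by simp [h]) (by norm_num)) le_rfl ?_
  rintro μ4 ⟨hf4, a4⟩
  refine ⟨?_, ?_, ?_, a4⟩
  · rw [hf4.nat 31 (by decide), hf3.nat 31 (by decide), hf2.nat 31 (by decide)]; exact a1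
  · rw [hf4.nat 32 (by decide), hf3.nat 32 (by decide)]; exact a2
  · rw [hf4.nat 33 (by decide)]; exact a3

/-- The right-hand side is the image of the difference of the cluster demands at the thresholds `τ`
and `τ / N`, as both cluster demands are pushed forward vertex by vertex. -/
theorem WP.rhs (hS : S.Static μ₀) {φ B C : Fin S.ν → Fin S.ν} {g : Fin S.ν → ℝ}
    (hφ : ∀ i : Fin S.ν, μ₀.nat 35 i = φ i) (hB : ∀ i : Fin S.ν, μ₀.nat 32 i = B i)
    (hC : ∀ i : Fin S.ν, μ₀.nat 33 i = C i) (hg : ∀ i : Fin S.ν, μ₀.real 15 i = g i)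
    (h4 : ∀ i : Fin S.ν, μ₀.real 4 i = 0) :
    WP O (IllCond.forP 20 nuvar rhsBody) (4 * S.ν + 2) μ₀ fun μ =>
      Frame (IllCond.forP 20 nuvar rhsBody) μ₀ μ ∧
      ∀ v : Fin S.ν, μ.real 4 v = push φ (push B g - push C g) v := by
  refine WP.mono (WP.forP (c := rhsBody) rfl (by decide) S.ν (fun j μ =>
    ∀ v : Fin S.ν, μ.real 4 v = ∑ u : Fin S.ν, if (u : ℕ) < j then
      ((if φ (B u) = v then g u else 0) - if φ (C u) = v then g u else 0) else 0)
      ?_ ?_ ?_ ?_) (le_of_eq rfl) ?_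
  · intro μ hf
    simp only [NExp.val]
    rw [hf.nat 10 (by decide), hS.ν_eq]
  · rintro j μ x h
    exact h
  · exact fun v => by simp [h4]
  · intro j hj μ hf hv h v
    have e35 : ∀ i : Fin S.ν, μ.nat 35 i = φ i := by rw [hf.nat 35 (by decide)]; exact hφ
    have e32 : μ.nat 32 j = B ⟨j, hj⟩ := by rw [hf.nat 32 (by decide)]; exact hB ⟨j, hj⟩
    have e33 : μ.nat 33 j = C ⟨j, hj⟩ := by rw [hf.nat 33 (by decide)]; exact hC ⟨j, hj⟩
    have e15 : μ.real 15 j = g ⟨j, hj⟩ := by rw [hf.real 15 (by decide)]; exact hg ⟨j, hj⟩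
    rw [sum_lt_succ _ hj, ← h]
    simp only [rhsBody, Program.run, NExp.val, hv, RExp.val, e35, e32, e33, e15, Mem.setR_nat,
      Mem.setR_real, if_true, Fin.val_inj, Nat.reduceEqDiff, if_false]
    by_cases h1 : v = φ (B ⟨j, hj⟩) <;> by_cases h2 : v = φ (C ⟨j, hj⟩)
    · rw [if_pos h2, if_pos (h2.symm.trans h1), if_pos h1.symm, if_pos h2.symm, ← h1]
      ring
    · rw [if_neg h2, if_pos h1, if_pos h1.symm, if_neg (Ne.symm h2), ← h1]
      ring
    · rw [if_pos h2, if_neg (fun h => h1 (h2.trans h)), if_neg (Ne.symm h1), if_pos h2.symm, ← h2]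
      ring
    · rw [if_neg h2, if_neg h1, if_neg (Ne.symm h1), if_neg (Ne.symm h2)]
      ring
  · rintro μ ⟨hf, h⟩
    refine ⟨hf, fun v => ?_⟩
    rw [h, push_sub, push_push, push_push]
    simp [push]

theorem WP.solveP (hS : S.Static μ₀) {N : ℝ} {A : Matrix (Fin S.ν) (Fin S.ν) ℝ} {E : ℕ}
    {c : Fin S.ν → ℝ} (hA : Assembled μ₀ E A) (hN : μ₀.real 11 0 = N)
    (hc : ∀ i : Fin S.ν, μ₀.real 4 i = c i) :
    WP O IllCond.solveP 3 μ₀ fun μ => Frame IllCond.solveP μ₀ μ ∧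
      μ.calls = μ₀.calls ++ [⟨⟨S.ν, A, E, 1 / N⟩, c⟩] ∧
      ∀ i : Fin S.ν, μ.real 6 i = O μ₀.calls.length ⟨S.ν, A, E, 1 / N⟩ c i := by
  refine WP.frame (WP.straight (c := IllCond.solveP) rfl ?_)
  refine solved_spec (T := ⟨S.ν, A, E, 1 / N⟩) ?_ (c := c) ?_
  · refine system_eq ?_ ?_ ?_ ?_
    · simp [Mem.toState, hS.ν_eq]
    · simp [Mem.toState, hA.1]
    · simp [Mem.toState, hN]
    · intro i j
      rw [← hA.2]
      simp [Mem.toState]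
  · intro i
    simp [hc]

theorem WP.out (hS : S.Static μ₀) {φ : Fin S.ν → Fin S.ν} {y : Fin S.ν → ℝ}
    (hφ : ∀ i : Fin S.ν, μ₀.nat 35 i = φ i) (hy : ∀ i : Fin S.ν, μ₀.real 6 i = y i) :
    WP O (IllCond.forP 20 nuvar outBody) (3 * S.ν + 2) μ₀ fun μ =>
      Frame (IllCond.forP 20 nuvar outBody) μ₀ μ ∧
      (∀ i : Fin S.ν, μ.real 2 (S.orig i) = μ₀.real 2 (S.orig i) + y (φ i)) ∧
      ∀ a, (∀ i, a ≠ (S.orig i : ℕ)) → μ.real 2 a = μ₀.real 2 a := by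
  refine WP.mono (WP.forP (c := outBody) rfl (by decide) S.ν (fun j μ =>
    (∀ i : Fin S.ν, μ.real 2 (S.orig i) = μ₀.real 2 (S.orig i) + if (i : ℕ) < j then y (φ i) else
        0) ∧
      ∀ a, (∀ i, a ≠ (S.orig i : ℕ)) → μ.real 2 a = μ₀.real 2 a)
      ?_ ?_ ?_ ?_) (le_of_eq rfl) ?_
  · intro μ hf
    simp only [NExp.val]
    rw [hf.nat 10 (by decide), hS.ν_eq]
  · rintro j μ x h
    exact h
  · exact ⟨fun v => by simp, fun _ _ => rfl⟩
  · rintro j hj μ hf hv ⟨h1, h2⟩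
    have e12 : μ.nat 12 j = S.orig ⟨j, hj⟩ := by
      rw [hf.nat 12 (by decide)]; exact hS.orig_eq ⟨j, hj⟩
    have e35 : μ.nat 35 j = φ ⟨j, hj⟩ := by rw [hf.nat 35 (by decide)]; exact hφ ⟨j, hj⟩
    have e6 : ∀ i : Fin S.ν, μ.real 6 i = y i := by rw [hf.real 6 (by decide)]; exact hy
    have hrun : outBody.run O μ = μ.setR 2 (S.orig ⟨j, hj⟩)
        (μ.real 2 (S.orig ⟨j, hj⟩) + y (φ ⟨j, hj⟩)) := by
      simp only [outBody, Program.run, NExp.val, hv, RExp.val, e12, e35, e6]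
    rw [hrun]
    refine ⟨fun i => ?_, fun a ha => ?_⟩
    · by_cases hij : i = ⟨j, hj⟩
      · subst hij
        simp [h1]
      · have h3 : (S.orig i : ℕ) ≠ S.orig ⟨j, hj⟩ := fun h => hij (S.orig_inj (Fin.ext h))
        have h4 : (i : ℕ) ≠ j := fun h => hij (Fin.ext h)
        have h5 : (i : ℕ) < j + 1 ↔ (i : ℕ) < j := by omega
        simp [h3, h1, h5]
    · simp [ha, h2 a ha]
  · rintro μ ⟨hf, h1, h2⟩
    exact ⟨hf, fun i => by simp [h1], h2⟩

open Classical in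
theorem WP.nextP (hS : S.Static μ₀) {τ N τ' : ℝ} (hτ : μ₀.real 10 0 = τ) (hN : μ₀.real 11 0 = N)
    (hC : ∀ i : Fin S.ν, μ₀.nat 33 i = rep S.L τ' i) :
    WP O IllCond.nextP (4 * m + 4) μ₀ fun μ => Frame IllCond.nextP μ₀ μ ∧
      μ.real 10 0 = τ / N ∧ μ.nat 36 0 = if S.Crossing τ' then 1 else 0 := by
  refine WP.frame ?_
  refine WP.mono (WP.seq (WP.straight (c := .seq _ _) rfl (Q := fun μ =>
      Frame (.seq (.setReal 10 (.lit 0) (.div (rvar 10) (rvar 11))) (.setNat 36 (.lit 0) (.lit 0)))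
          μ₀ μ ∧
      μ.real 10 0 = τ / N ∧ μ.nat 36 0 = 0) ⟨frame_run O rfl _, by simp [hτ, hN], by simp⟩) ?_)
    (T := 2 + (4 * m + 2)) (by omega) fun _ h => h
  rintro μ1 ⟨hf1, a1, a2⟩
  have hS1 := hS.frame hf1 (by decide) (by decide)
  refine WP.mono (WP.forP (c := flagBody) rfl (by decide) m (fun j μ =>
    μ.nat 36 0 = if ∃ k < j, rep S.L τ' (S.row k) ≠ rep S.L τ' (S.col k) then 1 else 0)
      ?_ ?_ ?_ ?_) (le_of_eq rfl) ?_
  · intro μ hf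
    simp only [NExp.val]
    rw [hf.nat 0 (by decide), hS1.m_eq]
  · rintro j μ x h
    simpa using h
  · simp [a2]
  · intro j hj μ hf hv h
    have e33 : ∀ i : Fin S.ν, μ.nat 33 i = rep S.L τ' i := by
      rw [hf.nat 33 (by decide), hf1.nat 33 (by decide)]; exact hC
    have e13 : μ.nat 13 j = S.row j := by rw [hf.nat 13 (by decide)]; exact hS1.row_eq j hj
    have e14 : μ.nat 14 j = S.col j := by rw [hf.nat 14 (by decide)]; exact hS1.col_eq j hj
    by_cases hc : rep S.L τ' (S.row j) = rep S.L τ' (S.col j)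
    · have hrun : flagBody.run O μ = μ := by simp [flagBody, hv, e33, e13, e14, hc]
      rw [hrun, h]
      refine if_congr ⟨fun ⟨k, hk, h'⟩ => ⟨k, by omega, h'⟩, fun ⟨k, hk, h'⟩ => ⟨k, ?_, h'⟩⟩ rfl rfl
      rcases Nat.lt_succ_iff_lt_or_eq.1 hk with hk | rfl
      · exact hk
      · exact (h' hc).elim
    · have hc' : (rep S.L τ' (S.row j) : ℕ) ≠ rep S.L τ' (S.col j) := fun h => hc (Fin.ext h)
      rw [if_pos ⟨j, by omega, hc⟩]
      simp [flagBody, hv, e33, e13, e14, hc']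
  · rintro μ ⟨hf, h⟩
    exact ⟨by rw [hf.real 10 (by decide), a1], by rw [h]; exact if_congr Iff.rfl rfl rfl⟩

open Classical in
theorem WP.stepP (hS : S.Static μ₀) {τ N : ℝ} {g : Fin S.ν → ℝ} (hτ : μ₀.real 10 0 = τ)
    (hN : μ₀.real 11 0 = N) (hτ0 : 0 ≤ τ) (hN0 : 0 ≤ N) (hg : ∀ i : Fin S.ν, μ₀.real 15 i = g i) :
    WP O IllCond.stepP (269 * m + 277 * S.ν + 110) μ₀ fun μ => Frame IllCond.stepP μ₀ μ ∧
      S.Static μ ∧ μ.real 10 0 = τ / N ∧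
      μ.calls = μ₀.calls ++ [⟨S.system N τ, S.rhs N g τ⟩] ∧
      (∀ i : Fin S.ν, μ.real 2 (S.orig i) = μ₀.real 2 (S.orig i) +
        O μ₀.calls.length (S.system N τ) (S.rhs N g τ) (IllCond.phi S.L S.o (τ * N) (τ / N ^ 3) i))
            ∧
      (∀ a, (∀ i, a ≠ (S.orig i : ℕ)) → μ.real 2 a = μ₀.real 2 a) ∧
      μ.nat 36 0 = if S.Crossing (τ / N) then 1 else 0 := by
  refine WP.frame ?_
  refine WP.mono (WP.seq (WP.clustersP hS hτ hN hτ0 hN0) ?_)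
    (T := 240 * (m + S.ν) + 80 + (25 * m + 30 * S.ν + 19 +
        (4 * S.ν + 2 + (3 + (3 * S.ν + 2 + (4 * m + 4))))))
    (by omega) fun _ h => h
  rintro μ1 ⟨hf1, a1, a2, a3, a4⟩
  have hS1 := hS.frame hf1 (by decide) (by decide)
  refine WP.seq (WP.systemP hS1 a1 a4 (τ := τ) (N := N) ?_ ?_ ?_) ?_
  · rw [hf1.real 10 (by decide), hτ]
  · rw [hf1.real 11 (by decide), hN]
  · rw [show N * N * N = N ^ 3 by ring]
  rintro μ2 ⟨hf2, b1, b2, b3⟩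
  have hS2 := hS1.frame hf2 (by decide) (by decide)
  refine WP.seq (WP.rhs hS2 b1 (B := rep S.L τ) (C := rep S.L (τ / N)) (g := g) ?_ ?_ ?_ b2) ?_
  · rw [hf2.nat 32 (by decide)]; exact a2
  · rw [hf2.nat 33 (by decide)]; exact a3
  · rw [hf2.real 15 (by decide), hf1.real 15 (by decide)]; exact hg
  rintro μ3 ⟨hf3, c1⟩
  have hS3 := hS2.frame hf3 (by decide) (by decide)
  refine WP.seq (WP.solveP hS3 (N := N) (b3.congr (hf3.nat 3 (by decide)) (hf3.nat 4 (by decide))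
    (hf3.nat 5 (by decide)) (hf3.real 3 (by decide))) ?_ c1) ?_
  · rw [hf3.real 11 (by decide), hf2.real 11 (by decide), hf1.real 11 (by decide), hN]
  rintro μ4 ⟨hf4, d1, d2⟩
  have hS4 := hS3.frame hf4 (by decide) (by decide)
  have hcalls : μ3.calls = μ₀.calls := by
    rw [hf3.calls (by decide), hf2.calls (by decide), hf1.calls (by decide)]
  rw [hcalls] at d1 d2
  have h2 : μ4.real 2 = μ₀.real 2 := by
    rw [hf4.real 2 (by decide), hf3.real 2 (by decide), hf2.real 2 (by decide),
        hf1.real 2 (by decide)]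
  refine WP.seq (WP.out hS4 (φ := IllCond.phi S.L S.o (τ * N) (τ / N ^ 3)) ?_ d2) ?_
  · rw [hf4.nat 35 (by decide), hf3.nat 35 (by decide)]; exact b1
  rintro μ5 ⟨hf5, f1, f2⟩
  have hS5 := hS4.frame hf5 (by decide) (by decide)
  refine WP.mono (WP.nextP hS5 (τ := τ) (N := N) (τ' := τ / N) ?_ ?_ ?_) le_rfl ?_
  · rw [hf5.real 10 (by decide), hf4.real 10 (by decide), hf3.real 10 (by decide),
      hf2.real 10 (by decide), hf1.real 10 (by decide), hτ]
  · rw [hf5.real 11 (by decide), hf4.real 11 (by decide), hf3.real 11 (by decide),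
      hf2.real 11 (by decide), hf1.real 11 (by decide), hN]
  · rw [hf5.nat 33 (by decide), hf4.nat 33 (by decide), hf3.nat 33 (by decide),
      hf2.nat 33 (by decide)]; exact a3
  rintro μ6 ⟨hf6, g1, g2⟩
  have e2 : μ6.real 2 = μ5.real 2 := hf6.real 2 (by decide)
  rw [h2] at f1 f2
  refine ⟨hS5.frame hf6 (by decide) (by decide), g1, ?_, ?_, ?_, g2⟩
  · rw [hf6.calls (by decide), hf5.calls (by decide)]; exact d1
  · rw [e2]; exact f1
  · rw [e2]; exact f2

end Step

/-! ### The run of the algorithm -/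

section Main

variable {n m : ℕ} {S : Setup n m} {L : Matrix (Fin n) (Fin n) ℝ}
  {e : Fin m ≃ {p : Fin n × Fin n // L p.1 p.2 ≠ 0}} {O : Solver}

/-- The run of the algorithm, when `K` is the first positive number such that no entry joins
different clusters of the threshold `W / N ^ K`. -/
theorem WP.mainP (hS : S.Reads L e) (b : Fin n → ℝ) {N W : ℝ} (hN : N = (n : ℝ) ^ 40)
    (hW : W = ∑ u, S.L u u) (hW0 : 0 ≤ W) {g : Fin S.ν → ℝ}
    (hg : g = IllCond.center S.L fun i => b (S.orig i)) {K : ℕ}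
    (hK0 : 1 ≤ K) (hK : ¬ S.Crossing (W / N ^ K))
    (hlt : ∀ k, 1 ≤ k → k < K → S.Crossing (W / N ^ k)) :
    WP O IllCond.mainP ((269 * m + 277 * S.ν + 111) * K + 86 * m + 67 * S.ν + 33) (inputMem L e b)
        fun μ =>
      μ.calls = (List.range K).map (fun k => ⟨S.system N (W / N ^ k), S.rhs N g (W / N ^ k)⟩) ∧
      (∀ i : Fin S.ν, μ.real 2 (S.orig i) = ∑ k ∈ Finset.range K, O k (S.system N (W / N ^ k))
        (S.rhs N g (W / N ^ k)) (IllCond.phi S.L S.o (W / N ^ k * N) (W / N ^ k / N ^ 3) i)) ∧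
      ∀ u : Fin n, u ∉ Set.range S.orig → μ.real 2 u = 0 := by
  have hN0 : 0 ≤ N := by rw [hN]; positivity
  refine WP.mono (WP.seq (WP.readP hS b) ?_) (T := 26 * m + 6 + (60 * (m + S.ν) + 7 * S.ν + 26 +
    ((269 * m + 277 * S.ν + 110 + 1) * K + 1))) (le_of_eq (by ring)) fun _ h => h
  rintro μ1 ⟨hf1, hS1, hW1⟩
  have hb1 : ∀ u : Fin n, μ1.real 1 u = b u := by
    rw [hf1.real 1 (by decide)]; simp [inputMem, inputState]
  refine WP.seq (WP.prepP hS1 hb1 ?_ ?_) ?_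
  · rw [hf1.real 13 (by decide)]; simp [inputMem, inputState]
  · rw [hf1.real 14 (by decide)]; simp [inputMem, inputState]
  rintro μ2 ⟨hf2, hg2, hN2, hflag2⟩
  have h2 : ∀ a, μ2.real 2 a = 0 := by
    rw [hf2.real 2 (by decide), hf1.real 2 (by decide)]; simp [inputMem, inputState]
  have hc2 : μ2.calls = [] := by
    rw [hf2.calls (by decide), hf1.calls (by decide)]; rfl
  refine WP.loop (Inv := fun k μ => ∃ j, j + k = K ∧ S.Static μ ∧ μ.real 10 0 = W / N ^ j ∧
      μ.real 11 0 = N ∧ (∀ i : Fin S.ν, μ.real 15 i = g i) ∧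
      μ.calls = (List.range j).map (fun k => ⟨S.system N (W / N ^ k), S.rhs N g (W / N ^ k)⟩) ∧
      (∀ i : Fin S.ν, μ.real 2 (S.orig i) = ∑ k ∈ Finset.range j, O k (S.system N (W / N ^ k))
        (S.rhs N g (W / N ^ k)) (IllCond.phi S.L S.o (W / N ^ k * N) (W / N ^ k / N ^ 3) i)) ∧
      (∀ a, (∀ i, a ≠ (S.orig i : ℕ)) → μ.real 2 a = 0) ∧
      μ.nat 36 0 = if k = 0 then 0 else 1) ?_ ?_ ?_ K _ ?_
  · rintro μ ⟨j, -, -, -, -, -, -, -, -, h⟩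
    simp [h]
  · rintro k μ ⟨j, hj, i1, i2, i3, i4, i5, i6, i7, -⟩ -
    refine WP.mono (WP.stepP i1 i2 i3 (by positivity) hN0 i4) le_rfl ?_
    rintro μ' ⟨hf, s1, s2, s3, s4, s5, s6⟩
    have e1 : W / N ^ j / N = W / N ^ (j + 1) := by rw [div_div, pow_succ]
    have hlen : μ.calls.length = j := by simp [i5]
    refine ⟨j + 1, by omega, s1, by rw [s2, e1], by rw [hf.real 11 (by decide), i3],
      by rw [hf.real 15 (by decide)]; exact i4, ?_, fun i => ?_, fun a ha => ?_, ?_⟩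
    · rw [s3, i5, List.range_succ, List.map_append]
      rfl
    · rw [s4, i6, Finset.sum_range_succ, hlen]
    · rw [s5 a ha, i7 a ha]
    · rw [s6, e1]
      by_cases hk : k = 0
      · have : j + 1 = K := by omega
        rw [this, if_neg hK, if_pos hk]
      · rw [if_pos (hlt _ (by omega) (by omega)), if_neg hk]
  · rintro k μ ⟨j, hj, i1, i2, i3, i4, i5, i6, i7, i8⟩ hflag
    have hk : k = 0 := by
      by_contra h
      rw [if_neg h] at i8
      exact hflag (by simp [i8])
    have hjK : j = K := by omega
    subst hjK
    refine ⟨i5, i6, fun u hu => i7 u fun i h => hu ⟨i, (Fin.ext h).symm⟩⟩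
  · refine ⟨0, by omega, hS1.frame hf2 (by decide) (by decide), ?_, by rw [hN2, hN],
      by rw [hg]; exact hg2, by simp [hc2], by simp [h2], fun a _ => h2 a, ?_⟩
    · rw [hf2.real 10 (by decide), hW1, hW]; simp
    · rw [hflag2, if_neg (by omega)]

end Main

/-! ### The number of scales -/

section Bounds

variable {n m : ℕ} {S : Setup n m} {L : Matrix (Fin n) (Fin n) ℝ}
  {e : Fin m ≃ {p : Fin n × Fin n // L p.1 p.2 ≠ 0}}

theorem Setup.ν_le (S : Setup n m) : S.ν ≤ n := by
  simpa using Fintype.card_le_of_injective _ S.orig_inj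

namespace Setup.Reads

theorem ν_le_m (hS : S.Reads L e) : S.ν ≤ m := by
  classical
  rw [hS.count]
  exact Nat.count_le _

theorem eulerian (hS : S.Reads L e) (hL : IsEulerianLaplacian L) : IsEulerianLaplacian S.L := by
  rw [hS.mat]
  exact hL.submatrix S.orig_inj fun u => (hS.range u).1

theorem diag_pos (hS : S.Reads L e) (hL : IsEulerianLaplacian L) (i : Fin S.ν) : 0 < S.L i i := by
  have h1 := (hS.eulerian hL).abs_apply_le i i
  have h2 : S.L i i ≠ 0 := by
    rw [hS.mat, submatrix_apply]
    exact (hS.range _).2 ⟨i, rfl⟩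
  exact lt_of_le_of_ne ((abs_nonneg _).trans h1) h2.symm

theorem trace_pos (hS : S.Reads L e) (hL : IsEulerianLaplacian L) : 0 < ∑ u, S.L u u :=
  Finset.sum_pos (fun i _ => hS.diag_pos hL i) ⟨S.o, Finset.mem_univ _⟩

theorem neg_le_trace (hS : S.Reads L e) (hL : IsEulerianLaplacian L) (u v : Fin S.ν) : -S.L u v ≤
    ∑ u, S.L u u :=
  ((neg_le_abs _).trans ((hS.eulerian hL).abs_apply_le u v)).trans
    (Finset.single_le_sum (f := fun u => S.L u u) (fun i _ => (hS.diag_pos hL i).le)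
      (Finset.mem_univ u))

theorem one_le_cond (hS : S.Reads L e) (hL : IsEulerianLaplacian L) : 1 ≤ condNumber (L + Lᵀ) := by
  refine one_le_condNumber fun h => ?_
  have h1 := congrFun (congrFun h (S.orig S.o)) (S.orig S.o)
  have h2 := hS.diag_pos hL S.o
  rw [hS.mat, submatrix_apply] at h2
  simp only [Matrix.add_apply, transpose_apply, Matrix.zero_apply] at h1
  linarith

theorem two_le (hS : S.Reads L e) (hL : IsEulerianLaplacian L) : 2 ≤ n := by
  by_contra hn
  have h2 := hS.diag_pos hL S.o
  rw [hS.mat, submatrix_apply] at h2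
  have : Subsingleton (Fin n) := Fin.subsingleton_iff_le_one.2 (by omega)
  have h3 := hL.row (S.orig S.o)
  rw [Fintype.sum_subsingleton _ (S.orig S.o)] at h3
  linarith

/-- While the clusters of a threshold are joined by entries, the threshold is bounded below in
terms of the condition number. -/
theorem pow_le_of_crossing (hS : S.Reads L e) (hL : IsEulerianLaplacian L) {N : ℝ} (hN : 0 < N)
    {k : ℕ}
    (hc : S.Crossing ((∑ u, S.L u u) / N ^ k)) : N ^ k ≤ 2 * n ^ 3 * condNumber (L + Lᵀ) := by
  set W := ∑ u, S.L u u with hW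
  have hW0 : 0 < W := hS.trace_pos hL
  obtain ⟨q, hq, hne⟩ := hc
  set τ := W / N ^ k with hτ
  have hτ0 : 0 ≤ τ := by positivity
  have hr : ∀ u, L u u ≠ 0 → u ∈ Set.range S.orig := fun u => (hS.range u).1
  have hsame : ∀ i, (∃ i', S.orig i' = S.orig i ∧ rep S.L τ i' = rep S.L τ (S.row q)) ↔
      rep S.L τ i = rep S.L τ (S.row q) := fun i =>
    ⟨fun ⟨i', h1, h2⟩ => by rwa [← S.orig_inj h1], fun h => ⟨i, rfl, h⟩⟩
  have h := hL.trace_le (Q := fun u => ∃ i, S.orig i = u ∧ rep S.L τ i = rep S.L τ (S.row q))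
    (τ := τ) hτ0 ?_ (u := S.orig (S.row q)) (v := S.orig (S.col q)) ?_ ?_
  · have e : ∑ a, L a a = W := by
      rw [sum_eq_sum_orig S.orig_inj (fun a => L a a) fun u hu => not_not.1 fun h => hu (hr u h),
          hW, hS.mat]
      rfl
    rw [e, Fintype.card_fin, hτ] at h
    have hNk : 0 < N ^ k := by positivity
    have h' : W * N ^ k ≤ W * (2 * n ^ 3 * condNumber (L + Lᵀ)) := by
      calc W * N ^ k ≤ (2 * n ^ 3 * (W / N ^ k) * condNumber (L + Lᵀ)) * N ^ k :=
            mul_le_mul_of_nonneg_right h hNk.le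
        _ = _ := by field_simp
    exact le_of_mul_le_mul_left h' hW0
  · intro a b hab
    by_cases h0 : L a b = 0
    · rw [h0, neg_zero]; exact hτ0
    obtain ⟨i, rfl⟩ := hr a fun h => h0 (hL.apply_eq_zero h b).1
    obtain ⟨j, rfl⟩ := hr b fun h => h0 (hL.apply_eq_zero h _).2
    rw [hsame, hsame] at hab
    have h1 : rep S.L τ i ≠ rep S.L τ j := fun h => by rw [h] at hab; tauto
    have := le_of_rep_ne h1
    rwa [hS.mat, submatrix_apply] at this
  · have := S.val_ne q hq
    rwa [← S.mat_eq q hq, hS.mat, submatrix_apply] at this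
  · rw [hsame, hsame]
    exact ⟨fun _ => hne.symm, fun _ => rfl⟩

/-- The number `K` of scales is at most `8 log (n κ)`: all scales but the last are crossed, so
`N ^ (K - 1) ≤ 2 n ^ 3 κ ≤ (n κ) ^ 4`. -/
theorem exists_scales (hS : S.Reads L e) (hL : IsEulerianLaplacian L) {κ : ℝ}
    (hκ : condNumber (L + Lᵀ) ≤ κ) {N : ℝ} (hN : N = (n : ℝ) ^ 40) :
    ∃ K : ℕ, 1 ≤ K ∧ ¬ S.Crossing ((∑ u, S.L u u) / N ^ K) ∧
      (∀ k, 1 ≤ k → k < K → S.Crossing ((∑ u, S.L u u) / N ^ k)) ∧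
      1 ≤ 8 * Real.log (n * κ) ∧ (K : ℝ) ≤ 8 * Real.log (n * κ) := by
  classical
  have hn : (2 : ℝ) ≤ n := by exact_mod_cast hS.two_le hL
  have hN2 : 2 ≤ N := by
    rw [hN]
    exact hn.trans (le_self_pow₀ (by linarith) (by norm_num))
  have hκ0 := hS.one_le_cond hL
  have hκ1 : 1 ≤ κ := hκ0.trans hκ
  have hcross : ∀ k, S.Crossing ((∑ u, S.L u u) / N ^ k) → (2 : ℝ) ^ k ≤ (n * κ) ^ 4 := by
    intro k hk
    have h1 := hS.pow_le_of_crossing hL (by linarith) hk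
    calc (2 : ℝ) ^ k ≤ N ^ k := pow_le_pow_left₀ (by norm_num) hN2 k
      _ ≤ 2 * n ^ 3 * condNumber (L + Lᵀ) := h1
      _ ≤ n * n ^ 3 * κ := by gcongr
      _ = n ^ 4 * κ := by ring
      _ ≤ n ^ 4 * κ ^ 4 := by
        gcongr
        exact le_self_pow₀ hκ1 (by norm_num)
      _ = (n * κ) ^ 4 := by ring
  have hnκ : 2 ≤ n * κ := by nlinarith
  have hlog : Real.log 2 ≤ Real.log (n * κ) := Real.log_le_log (by norm_num) hnκ
  have hlog2 := Real.log_two_gt_d9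
  have hex : ∃ k, 1 ≤ k ∧ ¬ S.Crossing ((∑ u, S.L u u) / N ^ k) := by
    obtain ⟨k, hk⟩ := pow_unbounded_of_one_lt ((n * κ) ^ 4) (one_lt_two : (1 : ℝ) < 2)
    refine ⟨k + 1, by omega, fun h => ?_⟩
    have h1 := hcross _ h
    have h2 : (2 : ℝ) ^ k ≤ 2 ^ (k + 1) := pow_le_pow_right₀ (by norm_num) (by omega)
    linarith
  have hlow : ∀ k, 1 ≤ k → k < Nat.find hex → S.Crossing ((∑ u, S.L u u) / N ^ k) :=
      fun k h1 h2 => by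
    have := Nat.find_min hex h2
    tauto
  refine ⟨Nat.find hex, (Nat.find_spec hex).1, (Nat.find_spec hex).2, hlow, by linarith, ?_⟩
  have hK1 := (Nat.find_spec hex).1
  generalize Nat.find hex = K at *
  have hpow : (2 : ℝ) ^ (K - 1) ≤ (n * κ) ^ 4 := by
    rcases Nat.lt_or_ge 1 K with h | h
    · exact hcross _ (hlow _ (by omega) (by omega))
    · rw [show K - 1 = 0 by omega, pow_zero]
      exact one_le_pow₀ (by linarith)
  have h1 := Real.log_le_log (by positivity) hpow
  rw [Real.log_pow, Real.log_pow, Nat.cast_sub hK1] at h1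
  push_cast at h1
  nlinarith

end Setup.Reads

end Bounds

/-! ### Tameness of the systems that are handed over -/

section Tame

/-- Each listed entry adds at most one nonzero. -/
theorem card_support_le {ν : ℕ} {A : Matrix (Fin ν) (Fin ν) ℝ} {E : ℕ}
    (hA : (Set.ncard {p : Fin ν × Fin ν | A p.1 p.2 ≠ 0}) ≤ E) (cnt : ℕ) (r c : ℕ → Fin ν)
    (v : ℕ → ℝ) :
    (Set.ncard {p : Fin ν × Fin ν | (A + ∑ k ∈ Finset.range cnt,
      v k • vecMulVec (Pi.single (r k) (1 : ℝ)) (Pi.single (c k) (1 : ℝ))) p.1 p.2 ≠ 0}) ≤ E +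
          cnt := by
  induction cnt with
  | zero => simpa using hA
  | succ k ih =>
    refine (Set.ncard_le_ncard (t := insert (r k, c k)
        {p : Fin ν × Fin ν | (A + ∑ k ∈ Finset.range k,
      v k • vecMulVec (Pi.single (r k) (1 : ℝ)) (Pi.single (c k) (1 : ℝ))) p.1 p.2 ≠ 0})
      ?_ (Set.toFinite _)).trans ((Set.ncard_insert_le _ _).trans (by omega))
    rintro ⟨i, j⟩ hp
    by_contra h
    rw [Set.mem_insert_iff, not_or] at h
    refine hp ?_
    have h2 := not_not.1 h.2
    rw [Finset.sum_range_succ, ← add_assoc, Matrix.add_apply, h2, zero_add, Matrix.smul_apply,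
      vecMulVec_apply, Pi.single_apply, Pi.single_apply]
    by_cases hi : i = r k
    · by_cases hj : j = c k
      · exact (h.1 (by rw [hi, hj])).elim
      · simp [hj]
    · simp [hi]

variable {n m : ℕ} {S : Setup n m} {L : Matrix (Fin n) (Fin n) ℝ}
  {e : Fin m ≃ {p : Fin n × Fin n // L p.1 p.2 ≠ 0}}

theorem Setup.card_system_le (S : Setup n m) (N τ : ℝ) :
    Set.ncard {p : Fin S.ν × Fin S.ν | scaleMat S.L S.o (τ * N) (τ / N ^ 3) p.1 p.2 ≠ 0}
      ≤ 3 * m + 4 * S.ν := by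
  have h0 : Set.ncard {p : Fin S.ν × Fin S.ν | (0 : Matrix (Fin S.ν) (Fin S.ν) ℝ) p.1 p.2 ≠ 0} ≤
      0 := by
    simp
  rw [scaleMat, contraction_eq_entries]
  refine (card_support_le (card_support_le (card_support_le (card_support_le (card_support_le
    (card_support_le (card_support_le h0 _ _ _ _) _ _ _ _) _ _ _ _) _ _ _ _) _ _ _ _) _ _ _ _)
    _ _ _ _).trans ?_
  omega

theorem Setup.sum_rhs (S : Setup n m) {N τ : ℝ} (h : τ / N ≤ τ) (g : Fin S.ν → ℝ) :
    ∑ i, S.rhs N g τ i = 0 := by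
  have h1 := dot_push (phi S.L S.o (τ * N) (τ / N ^ 3)) 1 (demand S.L N g τ)
  have h2 := sum_demand_mul (L := S.L) h g (w := 1) fun _ => rfl
  have h3 := h1.trans h2
  simpa [dotProduct, Setup.rhs] using h3

/-- The error parameter is `1 / N = n ^ (-40)`, and the thresholds `τ N` and `τ / N ^ 3` differ by
the factor `N ^ 4 = n ^ 160`, so the condition number is at most `16 n ^ 6 N ^ 4 ≤ n ^ 170`. -/
theorem Setup.Reads.tame (hS : S.Reads L e) (hL : IsEulerianLaplacian L) {C : ℕ} (hC : 200 ≤ C)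
    {N τ : ℝ} (hN : N = (n : ℝ) ^ 40) (hτ : 0 < τ) : IsTame n m C (S.system N τ) := by
  have hn : (2 : ℝ) ≤ n := by exact_mod_cast hS.two_le hL
  have hN1 : 1 ≤ N := by
    rw [hN]
    exact one_le_pow₀ (by linarith)
  have hN0 : 0 < N := by linarith
  have hν := S.ν_le
  have hνm := hS.ν_le_m
  have hL' := hS.eulerian hL
  have h1 : τ / N ^ 3 ≤ τ * N :=
    (div_le_self hτ.le (one_le_pow₀ hN1)).trans (le_mul_of_one_le_right hτ.le hN1)
  have hC' : ∀ k ≤ C, (n : ℝ) ^ k ≤ (n : ℝ) ^ C := fun k hk => pow_le_pow_right₀ (by linarith) hk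
  refine ⟨scaleMat_eulerian hL' (by positivity), scaleMat_connected hL' (by positivity) h1,
    hν.trans (Nat.le_mul_of_pos_left _ (by omega)), S.card_system_le N τ, ?_, ?_, ?_, ?_⟩
  · change 3 * m + 4 * S.ν ≤ C * m
    have := Nat.mul_le_mul_right m hC
    omega
  · change ((n : ℝ) ^ C)⁻¹ ≤ 1 / N
    rw [one_div, hN]
    exact inv_anti₀ (by positivity) (hC' 40 (by omega))
  · change 1 / N ≤ 1
    exact (div_le_one hN0).2 hN1
  · refine (scaleMat_condNumber_le hL' (o := S.o) (by positivity) h1).trans ?_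
    have hνn : (S.ν : ℝ) ≤ n := by exact_mod_cast hν
    have e1 : τ * N / (τ / N ^ 3) = N ^ 4 := by field_simp
    calc (16 : ℝ) * S.ν ^ 6 * (τ * N / (τ / N ^ 3)) = 2 ^ 4 * S.ν ^ 6 * N ^ 4 := by
          rw [e1]; norm_num
      _ ≤ n ^ 4 * n ^ 6 * N ^ 4 := by gcongr
      _ = n ^ 170 := by rw [hN]; ring
      _ ≤ n ^ C := hC' 170 (by omega)

end Tame

/-! ### The output as a polynomial in the solver -/

section Polynomial

variable {n m : ℕ}

theorem push_add {ν : ℕ} (φ : Fin ν → Fin ν) (g g' : Fin ν → ℝ) :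
    push φ (g + g') = push φ g + push φ g' := by
  ext j
  simp only [push, Pi.add_apply, ← Finset.sum_add_distrib]
  exact Finset.sum_congr rfl fun _ _ => by split_ifs <;> simp

theorem push_smul {ν : ℕ} (φ : Fin ν → Fin ν) (a : ℝ) (g : Fin ν → ℝ) :
    push φ (a • g) = a • push φ g := by
  ext j
  simp only [push, Pi.smul_apply, smul_eq_mul, Finset.mul_sum]
  exact Finset.sum_congr rfl fun _ _ => by split_ifs <;> simp

/-- The right-hand side that is handed over at a threshold depends linearly on `b`. -/
def Setup.rhsLin (S : Setup n m) (N τ : ℝ) : (Fin n → ℝ) →ₗ[ℝ] (Fin S.ν → ℝ) where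
  toFun b := S.rhs N (center S.L fun i => b (S.orig i)) τ
  map_add' b b' := by
    have h1 : (fun i => (b + b') (S.orig i)) = (fun i => b (S.orig i)) + fun i => b' (S.orig i) :=
        rfl
    have h2 : center S.L ((fun i => b (S.orig i)) + fun i => b' (S.orig i))
        = center S.L (fun i => b (S.orig i)) + center S.L fun i => b' (S.orig i) := by
      ext i
      simp only [center, Pi.add_apply, push_add]
      ring
    rw [h1, h2]
    simp only [Setup.rhs, demand, push_add, push_sub]
    abel
  map_smul' a b := by
    have h1 : (fun i => (a • b) (S.orig i)) = a • fun i => b (S.orig i) := rfl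
    have h2 : center S.L (a • fun i => b (S.orig i)) = a • center S.L fun i => b (S.orig i) := by
      ext i
      simp only [center, Pi.smul_apply, push_smul, smul_eq_mul]
      ring
    rw [h1, h2]
    simp only [Setup.rhs, demand, push_smul, push_sub, smul_sub, RingHom.id_apply]

/-- The matrix that maps `b` to the right-hand side that is handed over at a threshold. -/
def Setup.rhsMat (S : Setup n m) (N τ : ℝ) : Matrix (Fin (S.system N τ).size) (Fin n) ℝ :=
  LinearMap.toMatrix' (S.rhsLin N τ)

theorem Setup.rhsMat_mulVec (S : Setup n m) (N τ : ℝ) (b : Fin n → ℝ) :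
    S.rhsMat N τ *ᵥ b = S.rhs N (center S.L fun i => b (S.orig i)) τ :=
  LinearMap.toMatrix'_mulVec _ _

/-- The matrix that pulls an answer back to the vertices of the input. -/
def Setup.liftMat (S : Setup n m) (N τ : ℝ) : Matrix (Fin n) (Fin (S.system N τ).size) ℝ :=
  Matrix.of fun u (j : Fin S.ν) => ∑ i, if S.orig i = u ∧
      phi S.L S.o (τ * N) (τ / N ^ 3) i = j then 1 else 0

theorem Setup.liftMat_mulVec (S : Setup n m) (N τ : ℝ) (y : Fin S.ν → ℝ) (u : Fin n) :
    (S.liftMat N τ *ᵥ y) u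
      = ∑ i, if S.orig i = u then y (phi S.L S.o (τ * N) (τ / N ^ 3) i) else 0 := by
  change ∑ j : Fin S.ν, (∑ i, if S.orig i = u ∧ phi S.L S.o (τ * N) (τ / N ^ 3) i = j then 1 else
      0) * y j = _
  simp only [Finset.sum_mul]
  rw [Finset.sum_comm]
  refine Finset.sum_congr rfl fun i _ => ?_
  by_cases h : S.orig i = u <;> simp [h]

theorem Setup.liftMat_mulVec_orig (S : Setup n m) (N τ : ℝ) (y : Fin S.ν → ℝ) (i : Fin S.ν) :
    (S.liftMat N τ *ᵥ y) (S.orig i) = y (phi S.L S.o (τ * N) (τ / N ^ 3) i) := by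
  rw [S.liftMat_mulVec]
  simp [S.orig_inj.eq_iff]

theorem exists_solverPoly_mul {Ss : List SystemSpec} (t : Fin Ss.length) {T : SystemSpec}
    (h : Ss.get t = T) (A : Matrix (Fin n) (Fin T.size) ℝ) (B : Matrix (Fin T.size) (Fin n) ℝ) :
    ∃ P : SolverPoly Ss n n, ∀ Z, P.eval Z = A * (Z t T * B) := by
  subst h
  exact ⟨.mul (.coeff A) (.mul (.solver t) (.coeff B)), fun Z => rfl⟩

theorem exists_solverPoly_sum {Ss : List SystemSpec} {K : ℕ}
    {f : ℕ → (ℕ → (S : SystemSpec) → Matrix (Fin S.size) (Fin S.size) ℝ) → Matrix (Fin n) (Fin n) ℝ}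
    (h : ∀ k < K, ∃ P : SolverPoly Ss n n, ∀ Z, P.eval Z = f k Z) :
    ∃ P : SolverPoly Ss n n, ∀ Z, P.eval Z = ∑ k ∈ Finset.range K, f k Z := by
  induction K with
  | zero => exact ⟨.coeff 0, fun Z => by simp [SolverPoly.eval]⟩
  | succ K ih =>
    obtain ⟨P, hP⟩ := ih fun k hk => h k (by omega)
    obtain ⟨Q, hQ⟩ := h K (by omega)
    exact ⟨.add P Q, fun Z => by rw [SolverPoly.eval, hP, hQ, Finset.sum_range_succ]⟩

end Polynomial

/-! ### Correctness -/

section Final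

variable {n m : ℕ} {S : Setup n m} {L : Matrix (Fin n) (Fin n) ℝ}
  {e : Fin m ≃ {p : Fin n × Fin n // L p.1 p.2 ≠ 0}}

/-- The program halts with an output of the required accuracy, within the required numbers of calls and
steps. The hypothesis on `C` comes from the running time: at most `900 m` steps for each of at most
`8 log (n κ)` scales. -/
theorem mainP_correct (hS : S.Reads L e) (hL : IsEulerianLaplacian L) {C : ℕ} (hC : 8000 ≤ C)
    {κ : ℝ} (hκ : condNumber (L + Lᵀ) ≤ κ) (b : Fin n → ℝ) {O : Solver}
    (hO : IsApproxSolver n m C O) :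
    ∃ s : State, Exec O mainP (inputState L e b) s ∧
      energyNorm (symPart L) (s.output n - pinv L *ᵥ b)
        ≤ 1 / 2 * energyNorm (symPart L) (pinv L *ᵥ b) ∧
      (s.calls.length : ℝ) ≤ C * Real.log (n * κ) ∧
      (∀ c ∈ s.calls, IsTame n m C c.1 ∧ ∑ i, c.2 i = 0) ∧
      (s.time : ℝ) ≤ C * m * Real.log (n * κ) := by
  set N : ℝ := (n : ℝ) ^ 40 with hN
  set W := ∑ u, S.L u u with hW
  set g := center S.L fun i => b (S.orig i) with hg
  have hW0 : 0 < W := hS.trace_pos hL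
  have hn : (2 : ℝ) ≤ n := by exact_mod_cast hS.two_le hL
  have hN1 : 1 ≤ N := one_le_pow₀ (by linarith)
  have hN0 : 0 < N := by linarith
  obtain ⟨K, hK0, hK, hlt, hlog, hKlog⟩ := hS.exists_scales hL hκ hN
  obtain ⟨μ, t, hexec, ht, hcalls, hout, hzero⟩ :=
    WP.mainP (O := O) hS b hN hW hW0.le hg hK0 hK hlt 0
  have hτ : ∀ k, 0 < W / N ^ k := fun k => by positivity
  have htame : ∀ k, IsTame n m C (S.system N (W / N ^ k)) := fun k =>
    hS.tame hL (by omega) hN (hτ k)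
  have hrhs : ∀ k, ∑ i, S.rhs N g (W / N ^ k) i = 0 := fun k =>
    S.sum_rhs (div_le_self (hτ k).le hN1) g
  have hC' : (8000 : ℝ) ≤ C := by exact_mod_cast hC
  refine ⟨μ.toState t, hexec, ?_, ?_, ?_, ?_⟩
  · rw [energyNorm_symPart, energyNorm_symPart]
    have hr' := fun u => (hS.range u).1
    rw [← hL.nrm_orig S.orig_inj hr', ← hL.nrm_orig S.orig_inj hr', ← hS.mat]
    have hxs : S.L *ᵥ (fun i => (pinv L *ᵥ b) (S.orig i)) = g := by
      rw [hg, hS.mat]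
      exact hL.mulVec_pinv_orig S.orig_inj hS.range b
    have hP2 : ((n : ℝ) ^ 20) ^ 2 = N := by rw [hN]; ring
    have herr := total_error (hS.eulerian hL) S.o_le hW0 (hS.neg_le_trace hL)
      (P := (n : ℝ) ^ 20) (one_le_pow₀ (by linarith)) hxs (K := K) ?_ (τ := fun k => W / N ^ k)
      (fun k => by rw [hP2]) (x := fun k => O k (S.system N (W / N ^ k)) (S.rhs N g (W / N ^ k))) ?_
    · rw [hP2] at herr
      have hfun : (fun i => ((μ.toState t).output n - pinv L *ᵥ b) (S.orig i))
          = (fun u => ∑ k ∈ Finset.range K, O k (S.system N (W / N ^ k)) (S.rhs N g (W / N ^ k))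
            (phi S.L S.o (W / N ^ k * N) (W / N ^ k / N ^ 3) u))
            - fun i => (pinv L *ᵥ b) (S.orig i) := by
        ext i
        simp only [Pi.sub_apply]
        rw [← hout i]
        rfl
      rw [hfun]
      refine herr.trans (mul_le_mul_of_nonneg_right ?_ (nrm_nonneg _ _))
      -- `200 ν ^ 10 / n ^ 20 ≤ 1 / 2` since `400 ≤ 2 ^ 10 ≤ n ^ 10`
      have hνn : (S.ν : ℝ) ≤ n := by exact_mod_cast S.ν_le
      have hn10 : (2 : ℝ) ^ 10 ≤ n ^ 10 := pow_le_pow_left₀ (by norm_num) hn 10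
      have hν10 : (S.ν : ℝ) ^ 10 ≤ n ^ 10 := pow_le_pow_left₀ (by positivity) hνn 10
      rw [div_le_iff₀ (by positivity), show (n : ℝ) ^ 20 = n ^ 10 * n ^ 10 by ring]
      nlinarith
    · intro u v huv
      rw [hP2]
      obtain ⟨k, hk, rfl, rfl⟩ := S.surj u v huv
      by_contra hne
      exact hK ⟨k, hk, hne⟩
    · intro k _
      rw [hP2]
      have := hO k _ (htame k) (S.rhs N g (W / N ^ k)) (hrhs k)
      rw [energyNorm_symPart, energyNorm_symPart] at this
      exact this
  · change (μ.calls.length : ℝ) ≤ _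
    rw [hcalls, List.length_map, List.length_range]
    nlinarith
  · intro c hc
    change c ∈ μ.calls at hc
    rw [hcalls, List.mem_map] at hc
    obtain ⟨k, -, rfl⟩ := hc
    exact ⟨htame k, hrhs k⟩
  · change (t : ℝ) ≤ _
    have hνm := hS.ν_le_m
    have hm : 1 ≤ m := S.o.pos.trans_le hνm
    have h1 : t ≤ 900 * m * K := by
      have h2 : (269 * m + 277 * S.ν + 111) * K ≤ (657 * m) * K := Nat.mul_le_mul_right _ (by omega)
      have h3 : m * 1 ≤ m * K := Nat.mul_le_mul_left _ hK0
      have h4 : 900 * m * K = 900 * (m * K) := by ring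
      have h5 : 657 * m * K = 657 * (m * K) := by ring
      omega
    have h2 : (t : ℝ) ≤ 900 * m * K := by exact_mod_cast h1
    have hm' : (0 : ℝ) ≤ m := by positivity
    calc (t : ℝ) ≤ 900 * m * K := h2
      _ ≤ 900 * m * (8 * Real.log (n * κ)) := by gcongr
      _ ≤ C * m * Real.log (n * κ) := by
        have : (0 : ℝ) ≤ m * Real.log (n * κ) := mul_nonneg hm' (by linarith)
        nlinarith

/-- The program computes an implicit polynomial: no call depends on the answers to earlier ones, and the output is the sum
over the scales of `lift * Z * rhs`, with matrices `lift` and `rhs` that only depend on `L`. -/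
theorem mainP_polynomial (hS : S.Reads L e) (hL : IsEulerianLaplacian L) {C : ℕ} (hC : 8000 ≤ C) :
    ∃ (Ss : List SystemSpec) (P : SolverPoly Ss n n),
      ∀ (b : Fin n → ℝ) (O : Solver)
        (Z : ℕ → (S : SystemSpec) → Matrix (Fin S.size) (Fin S.size) ℝ) (s : State),
        IsImplicitMatrix n m C O Z →
        Exec O mainP (inputState L e b) s →
        s.calls.map Sigma.fst = Ss ∧ s.output n = P.eval Z *ᵥ b := by
  set N : ℝ := (n : ℝ) ^ 40 with hN
  set W := ∑ u, S.L u u with hW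
  have hW0 : 0 < W := hS.trace_pos hL
  have hn : (2 : ℝ) ≤ n := by exact_mod_cast hS.two_le hL
  have hN1 : 1 ≤ N := one_le_pow₀ (by linarith)
  have hN0 : 0 < N := by linarith
  have hτ : ∀ k, 0 < W / N ^ k := fun k => by positivity
  obtain ⟨K, hK0, hK, hlt, -, -⟩ := hS.exists_scales hL le_rfl hN
  set Ss := (List.range K).map fun k => S.system N (W / N ^ k) with hSs
  obtain ⟨P, hP⟩ := exists_solverPoly_sum (Ss := Ss) (K := K) (f := fun k Z =>
    S.liftMat N (W / N ^ k) * (Z k (S.system N (W / N ^ k)) * S.rhsMat N (W / N ^ k))) fun k hk =>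
    exists_solverPoly_mul (Ss := Ss) ⟨k, by simpa [hSs] using hk⟩ (T := S.system N (W / N ^ k))
      (by simp [hSs]) _ _
  refine ⟨Ss, P, fun b O Z s hZ hs => ?_⟩
  set g := center S.L fun i => b (S.orig i) with hg
  obtain ⟨μ, t, hexec, ht, hcalls, hout, hzero⟩ :=
    WP.mainP (O := O) hS b hN hW hW0.le hg hK0 hK hlt 0
  obtain rfl : s = μ.toState t := Exec.deterministic hs hexec
  refine ⟨?_, ?_⟩
  · change μ.calls.map Sigma.fst = Ss
    rw [hcalls, List.map_map]
    rfl
  · rw [hP, Matrix.sum_mulVec]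
    have hterm : ∀ k, (S.liftMat N (W / N ^ k) * (Z k (S.system N (W / N ^ k)) *
        S.rhsMat N (W / N ^ k))) *ᵥ b = S.liftMat N (W / N ^ k) *ᵥ
          (O k (S.system N (W / N ^ k)) (S.rhs N g (W / N ^ k))) := by
      intro k
      rw [← mulVec_mulVec, ← mulVec_mulVec, S.rhsMat_mulVec,
        hZ k _ (hS.tame hL (by omega) hN (hτ k)) (S.rhs N g (W / N ^ k))
          (S.sum_rhs (div_le_self (hτ k).le hN1) g)]
    simp only [hterm]
    ext u
    change μ.real 2 u = _
    rw [Finset.sum_apply]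
    by_cases hu : u ∈ Set.range S.orig
    · obtain ⟨i, rfl⟩ := hu
      rw [hout]
      exact Finset.sum_congr rfl fun k _ => Eq.symm (S.liftMat_mulVec_orig N (W / N ^ k) _ i)
    · rw [hzero u hu]
      refine (Finset.sum_eq_zero fun k _ => ?_).symm
      exact (S.liftMat_mulVec N (W / N ^ k) _ u).trans
        (Finset.sum_eq_zero fun i _ => if_neg fun h => hu ⟨i, h⟩)

end Final

end IllCond

end

theorem mainTheorem5 :
    ∃ (crudeSolveIllConditioned : IllCond.Program) (C : ℕ),
      ∀ (n m : ℕ) (L : Matrix (Fin n) (Fin n) ℝ)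
        (e : Fin m ≃ {p : Fin n × Fin n // L p.1 p.2 ≠ 0}),
        IllCond.IsEulerianLaplacian L → L ≠ 0 →
        (∀ (κ : ℝ) (b : Fin n → ℝ) (O : IllCond.Solver),
          IllCond.condNumber (L + L.transpose) ≤ κ → IllCond.IsApproxSolver n m C O →
          ∃ s : IllCond.State,
            IllCond.Exec O crudeSolveIllConditioned (IllCond.inputState L e b) s ∧
            IllCond.energyNorm (IllCond.symPart L)
                (s.output n - (IllCond.pinv L).mulVec b)
              ≤ 1 / 2 * IllCond.energyNorm (IllCond.symPart L) ((IllCond.pinv L).mulVec b) ∧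
            (s.calls.length : ℝ) ≤ C * Real.log (n * κ) ∧
            (∀ c ∈ s.calls, IllCond.IsTame n m C c.1 ∧ ∑ i, c.2 i = 0) ∧
            (s.time : ℝ) ≤ C * m * Real.log (n * κ)) ∧
        (∃ (Ss : List IllCond.SystemSpec) (P : IllCond.SolverPoly Ss n n),
          ∀ (b : Fin n → ℝ) (O : IllCond.Solver)
            (Z : ℕ → (S : IllCond.SystemSpec) → Matrix (Fin S.size) (Fin S.size) ℝ)
            (s : IllCond.State),
            IllCond.IsApproxSolver n m C O → IllCond.IsImplicitMatrix n m C O Z →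
            IllCond.Exec O crudeSolveIllConditioned (IllCond.inputState L e b) s →
            s.calls.map Sigma.fst = Ss ∧ s.output n = (P.eval Z).mulVec b) := by
  refine ⟨IllCond.mainP, 8000, fun n m L e hL h0 => ?_⟩
  obtain ⟨S, hS⟩ := IllCond.exists_setup hL h0 e
  refine ⟨fun κ b O hκ hO => IllCond.mainP_correct hS hL le_rfl hκ b hO, ?_⟩
  obtain ⟨Ss, P, h⟩ := IllCond.mainP_polynomial hS hL (C := 8000) le_rfl
  exact ⟨Ss, P, fun b O Z s _ hZ hs => h b O Z s hZ hs⟩
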